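/- **Conventions.** A positive hypergraph $S$ consists of finite sets of faces $S_k$ ($k\ge 0$), only finitely many of them non-empty, with codomain functions $\gamma:S_{k+1}\to S_k$ and total relations $\delta$ from $S_{k+1}$ to $S_k$ (write $\delta(a)\subseteq S_k$), where $\delta:S_1\to S_0$ is a function. $<^+$ is the transitive closure of the relation "$a\in\delta(\alpha)$ and $\gamma(\alpha)=b$ for some $\alpha$", $<^-$ is the transitive closure of "$\gamma(a)\in\delta(b)$" on faces of positive dimension, and $\gamma^{(k)}(a)$ is the iterated codomain of dimension $k$ ($\gamma^{(k)}(a)=a$ if $\dim a\le k$). $S$ is a *positive opetope* if $S_0\ne\emptyset$, $|S_n\setminus\delta(S_{n+1})|\le 1$ for all $n$, and: $\{\gamma\gamma(a)\}=\gamma\delta(a)\setminus\delta\delta(a)$ and $\delta\gamma(a)=\delta\delta(a)\setminus\gamma\delta(a)$ if $\dim a\ge2$; $<^+$ is a strict order, linear on $S_0$; no two faces are both $<^+$- and $<^-$-comparable; for each face $x$ the sets $\{a:\gamma(a)=x\}$ and $\{a: x\in\delta(a)\}$ are linearly ordered by $<^+$. $I$ is the opetope with a single $1$-face $\mathbf a$,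 from $-$ to $+$. An *$\iota$-map* $h:Q\to P$ of positive hypergraphs is a function on faces with $\dim h(q)\le\dim q$ and, for $q\in Q_{k+1}$ and $\ker h=\{q:\dim h(q)<\dim q\}$: $h(\gamma(q))=\gamma^{(k)}(h(q))$; $h$ restricts to a bijection $\delta(q)\setminus\ker h\to\delta(h(q))$ if $\dim h(q)=\dim q$, and $\delta(q)\setminus\ker h\to\{h(q)\}$ if $\dim h(q)=\dim q-1$; and $\delta(q)\subseteq\ker h$ if $\dim h(q)<\dim q-1$. **The cylinder.** Let $P$ be a positive opetope. A flag under $x_k\in P_k$ is a sequence $[x_k,\dots,x_0]$ with $x_i\in P_i$ and $x_i\in\delta(x_{i+1})\cup\{\gamma(x_{i+1})\}$. Its sign is $(-1)^m$, $m$ the number of $i<k$ with $x_i\in\delta(x_{i+1})$. For distinct flags under $x_k$ with least level of difference $j$, $\vec x\lhd\vec y$ iff $j=0$ and $y_0<^+x_0$; or $j>0$, $[x_{j-1},\dots,x_0]$ has sign $+1$ and $x_j\prec y_j$; or $j>0$, that sign is $-1$ and $y_j\prec x_j$. Here, over $x=x_{j-1}$, $a\prec b$ iff $\gamma(b)=x\in\delta(a)$,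 or $x\in\delta(a)\cap\delta(b)$ and $a<^+b$, or $\gamma(a)=x=\gamma(b)$ and $b<^+a$. This is a linear order. For a flag $\vec x$ under $x_k$ that is neither first nor last, $k>1$, its low level is $\max\{i<k-1: x_{i+1}\in\delta(x_{i+2})\}$. Writing $\vec x_{(i)}$ for $\vec x$ with $x_i$ erased (a dummy $0$ at level $i$, if $i$ is below the top), a high p-flag is $\vec x_{(k-1)}$ ($k\ge1$), and a low p-flag is $\vec x_{(i)}$ with $i$ the low level of $\vec x$. The faces of $\mathrm{Cyl}_h(P)$ are $-p$, $+p$ ($p\in P$), of dimension $\dim p$, and all flags and p-flags of faces of $P$, of dimension the number of non-dummy entries. $\pi_P$ sends $\pm p$ to $p$ and a (p-)flag to its top face; $\varrho_I$ sends $-p$ to $-$, $+p$ to $+$, and (p-)flags to $\mathbf a$. For a p-flag $\vec z=[z_n,\dots,0,\dots,z_0]$ with dummy at level $l$ and $p\in P_k$, $k\geq l$, let $D_j(p)=\delta\gamma^{(j+1)}(p)$ for $j<k$ and $D_k(p)=\{p\}$, and let $p\star\vec z$ be given by the first applicable case: 1. $[z_k,\dots,0,\dots,z_0]$, if $k\ne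 l$ and $p=z_k$; 2. $[p,\gamma(p),\dots,\gamma^{(l+2)}(p),t,0,z_{l-1},\dots,z_0]$, if $k>l$ and $z_{l+1}\le^+t\in D_{l+1}(p)$; 3. $[p,\gamma(p),\dots,\gamma^{(l+1)}(p),t,0,z_{l-2},\dots,z_0]$, if $l>0$ and $\gamma(z_{l+1})\le^+t\in D_l(p)$; 4. $[p,\gamma(p),\dots,\gamma^{(\bar l+2)}(p),t,0,z_{\bar l-1},\dots,z_0]$, if $\bar l$ is the largest $l'\le l-2$ for which some $t'\in D_{l'+1}(p)$ has $z_{l'+1}\le^+t'$, and $z_{\bar l+1}\le^+t\in D_{\bar l+1}(p)$; 5. $-p$, if $l>0$ and $\gamma^{(0)}(p)\le^+z_0$, or $l=0$ and $\gamma^{(0)}(p)<^+\gamma(z_1)$; 6. $+p$ otherwise. (If $t$ is $p$ itself, the list starts with $t$.) The operations are: $\gamma(\pm p)=\pm\gamma(p)$, $\delta(\pm p)=\{\pm q:q\in\delta(p)\}$; $\gamma([x_0])=+x_0$, $\delta([x_0])=\{-x_0\}$; for a flag $\vec x$ with $k>0$, $\gamma(\vec x)=\vec x_{(k-1)}$ and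 $\delta(\vec x)=\{[x_{k-1},\dots,x_0],\vec x_{low}\}$, where $\vec x_{low}$ is $-x_k$ for the first flag under $x_k$, $+x_k$ for the last one, and the low p-flag of $\vec x$ otherwise; for a p-flag $\vec z$ with top $z_n$, $\gamma(\vec z)=\gamma(z_n)\star\vec z$, and $\delta(\vec z)=\{q\star\vec z:q\in\delta(z_n)\}$, together with $[z_{n-2},\dots,z_0]$ if $\vec z$ is high and $n>1$. **The map $H$.** Let $h:Q\to P$ and $\varrho:Q\to I$ be $\iota$-maps of positive opetopes. A face $q\in Q_1$ is splitting if $\dim h(q)=0$ and $\varrho(q)=\mathbf a$; $q\in Q_{\ge2}$ is splitting if $\dim h(q)=\dim q-1$, $\varrho(q)=\mathbf a$ and $\delta(q)$ contains a splitting face. A face $q\in Q_1$ is a threshold face if $\dim h(q)=1$ and $\varrho(q)=\mathbf a$; $q\in Q_{\ge2}$ is a threshold face if $q\notin\ker h$ and $\delta(q)$ contains a splitting face. For $q\in Q_{\ge 2}$ let $\sigma(q)$ and $\tau(q)$ be the splitting, resp. threshold, face in $\delta(q)$, if there is one. Let $H(q)=-h(q)$ if $\varrho(q)=-$, $H(q)=+h(q)$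 if $\varrho(q)=+$, and if $\varrho(q)=\mathbf a$ let $H(q)$ be given by the first applicable case: $[h(q)]$ if $q\in Q_1$ is splitting; $[h(q),0]$ if $q\in Q_1$; $[h(q),H(\sigma(q))]$ if $q$ is splitting; $[h(q),0,H(\sigma(q))]$ if $q\notin\ker h$ and $\sigma(q)$ exists; $[h(q),H(\tau(q))]$ if $q\notin\ker h$ and $\tau(q)$ exists; $[h(q),H(\gamma(q))]$ if $q\notin\ker h$; and $H(\gamma(q))$ otherwise. **Proposition.** For all $\iota$-maps $h:Q\to P$ and $\varrho:Q\to I$ of positive opetopes, the map $H$ is an $\iota$-map $Q\to\mathrm{Cyl}_h(P)$ with $\pi_P\circ H=h$ and $\varrho_I\circ H=\varrho$, and it is the only $\iota$-map $Q\to\mathrm{Cyl}_h(P)$ with these two properties. -/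

import Mathlib

universe u v

/-- A positive hypergraph. The graded family `(S_k)` is stored as one finite type of faces with a
dimension function; finitely many finite sets of faces is the same as finitely many faces.
The codomain `γ` matters only on faces of positive dimension (on `S_0` it is the identity);
`δ x` is the set of faces in the domain of `x`, empty for `x` in `S_0`. -/
structure PosHypergraph where
  Face : Type u
  finite : Finite Face
  dim : Face → ℕ
  γ : Face → Face
  δ : Face → Set Face
  dim_γ : ∀ x, 0 < dim x → dim (γ x) + 1 = dim x
  γ_zero : ∀ x, dim x = 0 → γ x = x
  dim_δ : ∀ x, ∀ y ∈ δ x, dim y + 1 = dim x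
  δ_nonempty : ∀ x, 0 < dim x → (δ x).Nonempty
  δ_one : ∀ x, dim x = 1 → (δ x).Subsingleton

namespace PosHypergraph

/-- The upper order `a <⁺ b`. -/
def UpperLT (S : PosHypergraph.{u}) : S.Face → S.Face → Prop :=
  Relation.TransGen fun a b => ∃ α, a ∈ S.δ α ∧ S.γ α = b

/-- `a ≤⁺ b`. -/
def UpperLE (S : PosHypergraph.{u}) (a b : S.Face) : Prop := a = b ∨ S.UpperLT a b

/-- The lower order `a <⁻ b` (on faces of positive dimension). -/
def LowerLT (S : PosHypergraph.{u}) : S.Face → S.Face → Prop :=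
  Relation.TransGen fun a b => 0 < S.dim a ∧ S.γ a ∈ S.δ b

/-- The iterated codomain `γ^(k)`; it is the identity on faces of dimension at most `k`. -/
def γIter (S : PosHypergraph.{u}) (k : ℕ) (p : S.Face) : S.Face := S.γ^[S.dim p - k] p

/-- The boundary `∂ x = γ x ∪ δ x` of a face of positive dimension (empty for dimension `0`). -/
def boundary (S : PosHypergraph.{u}) (x : S.Face) : Set S.Face :=
  {y | 0 < S.dim x ∧ (y = S.γ x ∨ y ∈ S.δ x)}

/-- Positive opetopic cardinals. -/
structure IsOpetopicCardinal (S : PosHypergraph.{u}) : Prop where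
  nonempty : ∃ x, S.dim x = 0
  globularity_γ : ∀ a, 2 ≤ S.dim a →
    {S.γ (S.γ a)} = (S.γ '' S.δ a) \ (⋃ x ∈ S.δ a, S.δ x)
  globularity_δ : ∀ a, 2 ≤ S.dim a →
    S.δ (S.γ a) = (⋃ x ∈ S.δ a, S.δ x) \ (S.γ '' S.δ a)
  strictness : ∀ a, ¬ S.UpperLT a a
  linear_zero : ∀ a b, S.dim a = 0 → S.dim b = 0 → a ≠ b → S.UpperLT a b ∨ S.UpperLT b a
  disjointness : ∀ a b, ¬ ((S.LowerLT a b ∨ S.LowerLT b a) ∧ (S.UpperLT a b ∨ S.UpperLT b a))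
  pencil_γ : ∀ a b, 0 < S.dim a → 0 < S.dim b → S.γ a = S.γ b → a ≠ b →
    S.UpperLT a b ∨ S.UpperLT b a
  pencil_δ : ∀ a b x, x ∈ S.δ a → x ∈ S.δ b → a ≠ b → S.UpperLT a b ∨ S.UpperLT b a

/-- The `n`-th term of the size, `|S_n - δ(S_{n+1})|`. -/
noncomputable def size (S : PosHypergraph.{u}) (n : ℕ) : ℕ :=
  Set.ncard {x | S.dim x = n ∧ ∀ y, x ∉ S.δ y}

/-- Positive opetopes. -/
def IsOpetope (S : PosHypergraph.{u}) : Prop := S.IsOpetopicCardinal ∧ ∀ n, S.size n ≤ 1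

/-- The kernel of a function between faces: the faces whose dimension drops. -/
def ker {Q : PosHypergraph.{v}} {P : PosHypergraph.{u}} (h : Q.Face → P.Face) : Set Q.Face :=
  {q | P.dim (h q) < Q.dim q}

/-- `ι`-maps (contraction morphisms) between positive hypergraphs. -/
structure IsIotaMap (Q : PosHypergraph.{v}) (P : PosHypergraph.{u}) (h : Q.Face → P.Face) :
    Prop where
  dim_le : ∀ q, P.dim (h q) ≤ Q.dim q
  map_γ : ∀ k q, Q.dim q = k + 1 → h (Q.γIter k q) = P.γIter k (h q)
  bijOn_δ : ∀ q, 0 < Q.dim q → P.dim (h q) = Q.dim q →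
    Set.BijOn h (Q.δ q \ ker h) (P.δ (h q))
  bijOn_singleton : ∀ q, P.dim (h q) + 1 = Q.dim q → Set.BijOn h (Q.δ q \ ker h) {h q}
  subset_ker : ∀ q, P.dim (h q) + 1 < Q.dim q → Q.δ q ⊆ ker h

end PosHypergraph

/-- The faces of the one-dimensional opetope `I`. -/
inductive IFace
  | neg
  | pos
  | arrow

open PosHypergraph

/-- The one-dimensional opetope `I`, consisting of one arrow from `neg` to `pos`. -/
def intervalOpetope : PosHypergraph.{0} where
  Face := IFace
  finite := Finite.of_injective
    (fun x : IFace => match x with | .neg => (0 : Fin 3) | .pos => 1 | .arrow => 2) (by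
      intro x y; cases x <;> cases y <;> simp)
  dim x := match x with | .neg => 0 | .pos => 0 | .arrow => 1
  γ x := match x with | .neg => .neg | .pos => .pos | .arrow => .pos
  δ x := match x with | .neg => ∅ | .pos => ∅ | .arrow => {.neg}
  dim_γ x := by cases x <;> simp
  γ_zero x := by cases x <;> simp
  dim_δ x := by cases x <;> simp
  δ_nonempty x := by cases x <;> simp
  δ_one x := by cases x <;> simp

/-- Sequences `[x_k, …, x_0]` of faces, indexed by level; `none` stands both for the dummy node `0`
and for the levels above the top one. -/
abbrev FaceSeq (P : PosHypergraph.{u}) : Type u := ℕ → Option P.Face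

section Flags

variable {P : PosHypergraph.{u}}

/-- `x` is a flag under `p`: `x = [x_k, …, x_0]`, with `x_k = p` and `x_i ∈ ∂ x_{i+1}`. -/
def IsFlag (p : P.Face) (x : FaceSeq P) : Prop :=
  x (P.dim p) = some p ∧ (∀ i, P.dim p < i → x i = none) ∧
    ∀ i, i < P.dim p → ∃ a b, x i = some a ∧ x (i + 1) = some b ∧ a ∈ P.boundary b

/-- The operation `x ↦ x_(i)`: erase the face at level `i`. -/
def FaceSeq.erase (x : FaceSeq P) (i : ℕ) : FaceSeq P := Function.update x i none

/-- Truncation of a sequence to the levels `≤ k`. -/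
def FaceSeq.trunc (x : FaceSeq P) (k : ℕ) : FaceSeq P := fun i => if i ≤ k then x i else none

open Classical in
/-- The sign of the flag `[x_k, …, x_0]`. -/
noncomputable def FaceSeq.sgn (x : FaceSeq P) : ℕ → ℤ
  | 0 => 1
  | k + 1 => if x k = (x (k + 1)).map P.γ then x.sgn k else - x.sgn k

/-- The pencil order `a ≺_x b`. -/
def PencilLT (x a b : P.Face) : Prop :=
  (P.γ b = x ∧ x ∈ P.δ a) ∨ (x ∈ P.δ a ∧ x ∈ P.δ b ∧ P.UpperLT a b) ∨
    (P.γ a = x ∧ P.γ b = x ∧ P.UpperLT b a)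

/-- The flag order `x ◁ y` on flags under a common face; `k` is the least level at which they
differ. -/
def FlagLT (x y : FaceSeq P) : Prop :=
  ∃ k, (∀ j, j < k → x j = y j) ∧ x k ≠ y k ∧
    ((k = 0 ∧ ∃ a b, x 0 = some a ∧ y 0 = some b ∧ P.UpperLT b a) ∨
      ∃ m a b c, k = m + 1 ∧ x m = some c ∧ x k = some a ∧ y k = some b ∧
        ((x.sgn m = 1 ∧ PencilLT c a b) ∨ (x.sgn m = -1 ∧ PencilLT c b a)))

/-- `x` is the first (initial) flag under `p`. -/
def IsFirstFlag (p : P.Face) (x : FaceSeq P) : Prop :=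
  IsFlag p x ∧ ∀ y, IsFlag p y → y ≠ x → FlagLT x y

/-- `x` is the last (terminal) flag under `p`. -/
def IsLastFlag (p : P.Face) (x : FaceSeq P) : Prop :=
  IsFlag p x ∧ ∀ y, IsFlag p y → y ≠ x → FlagLT y x

/-- The low level `max {i < k - 1 | x_{i+1} ∈ δ x_{i+2}}` of a flag under `p ∈ P_k`. -/
noncomputable def lowLevel (p : P.Face) (x : FaceSeq P) : ℕ :=
  sSup {i | i + 1 < P.dim p ∧ ∃ a b, x (i + 1) = some a ∧ x (i + 2) = some b ∧ a ∈ P.δ b}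

/-- `z` is a punctured flag (p-flag) under `p`: a flag with the face at the level just below the
top (high p-flag), or at the low level (low p-flag), erased. -/
def IsPFlag (p : P.Face) (z : FaceSeq P) : Prop :=
  ∃ x, IsFlag p x ∧ ((0 < P.dim p ∧ z = x.erase (P.dim p - 1)) ∨
    (1 < P.dim p ∧ ¬ IsFirstFlag p x ∧ ¬ IsLastFlag p x ∧ z = x.erase (lowLevel p x)))

/-- The level of the dummy node of a p-flag. -/
noncomputable def puncture (z : FaceSeq P) : ℕ := sInf {i | z i = none}

end Flags

/-- The faces of the cylinder over `P`: flat faces `-p`, `+p`, flags and p-flags (of all faces). -/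
inductive CylFace (P : PosHypergraph.{u}) : Type u
  | minus (p : P.Face)
  | plus (p : P.Face)
  | flag (p : P.Face) (x : FaceSeq P) (hx : IsFlag p x)
  | pflag (p : P.Face) (z : FaceSeq P) (hz : IsPFlag p z)

namespace CylFace

variable {P : PosHypergraph.{u}}

/-- The dimension; for flags and p-flags it is the number of (non-dummy) faces in the sequence. -/
def dim : CylFace P → ℕ
  | minus p => P.dim p
  | plus p => P.dim p
  | flag p _ _ => P.dim p + 1
  | pflag p _ _ => P.dim p

/-- The projection `π_P` from the cylinder to `P`. -/
def proj : CylFace P → P.Face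
  | minus p => p
  | plus p => p
  | flag p _ _ => p
  | pflag p _ _ => p

/-- The projection `ϱ_I` from the cylinder to `I`. -/
def projI : CylFace P → intervalOpetope.Face
  | minus _ => IFace.neg
  | plus _ => IFace.pos
  | flag _ _ _ => IFace.arrow
  | pflag _ _ _ => IFace.arrow

/-- The sequence of faces of a flag or p-flag (nothing, for a flat face). -/
def seq : CylFace P → FaceSeq P
  | minus _ => fun _ => none
  | plus _ => fun _ => none
  | flag _ x _ => x
  | pflag _ z _ => z

open Classical in
/-- The face of the cylinder with top face `p` given by the sequence `s`. Over an opetope it is only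
applied to sequences that are flags or p-flags under `p`; the last branch makes it total. -/
noncomputable def ofSeq (p : P.Face) (s : FaceSeq P) : CylFace P :=
  if hx : IsFlag p s then .flag p s hx else if hz : IsPFlag p s then .pflag p s hz else .minus p

/-- The set of faces `t ∈ δ γ^(j+1)(p)` of dimension `j`, for `j < dim p`; for `j = dim p` only
`t = p` is allowed. -/
def domLevel (j : ℕ) (p : P.Face) : Set P.Face :=
  {t | (j < P.dim p ∧ t ∈ P.δ (P.γIter (j + 1) p)) ∨ (j = P.dim p ∧ t = p)}

/-- The sequence `[p, γ(p), …, γ^(j+2)(p), t, 0, z_{j-1}, …, z_0]`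
(for `dim p = j + 1` and `t = p`, this is `[p, 0, z_{j-1}, …, z_0]`). -/
def liftSeq (p t : P.Face) (j : ℕ) (z : FaceSeq P) : FaceSeq P := fun i =>
  if i < j then z i
  else if i = j then none
  else if i = j + 1 then some t
  else if i ≤ P.dim p then some (P.γIter i p)
  else none

/-- `∃ t ∈ domLevel j p` with `a ≤⁺ t`, where `a = z_j`. -/
def Below (z : FaceSeq P) (j : ℕ) (p t : P.Face) : Prop :=
  t ∈ domLevel j p ∧ ∃ a, z j = some a ∧ P.UpperLE a t

open Classical in
/-- The star operation `p ⋆ z` on a p-flag `z` with dummy node at level `l`. -/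
noncomputable def star (p : P.Face) (z : FaceSeq P) : CylFace P :=
  let k := P.dim p
  let l := puncture z
  if k ≠ l ∧ z k = some p then
    ofSeq p (z.trunc k)
  else if h₁ : l < k ∧ ∃ t, Below z (l + 1) p t then
    ofSeq p (liftSeq p h₁.2.choose l z)
  else if h₂ : (0 < l ∧ l ≤ k) ∧
      ∃ t ∈ domLevel l p, ∃ a, z (l + 1) = some a ∧ P.UpperLE (P.γ a) t then
    ofSeq p (liftSeq p h₂.2.choose (l - 1) z)
  else if h₃ : ∃ j, (j + 2 ≤ l ∧ j + 1 ≤ k ∧ ∃ t, Below z (j + 1) p t) ∧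
      ∀ i, i + 2 ≤ l ∧ i + 1 ≤ k ∧ (∃ t, Below z (i + 1) p t) → i ≤ j then
    ofSeq p (liftSeq p h₃.choose_spec.1.2.2.choose h₃.choose z)
  else if (0 < l ∧ ∃ a, z 0 = some a ∧ P.UpperLE (P.γIter 0 p) a) ∨
      (l = 0 ∧ ∃ a, z 1 = some a ∧ P.UpperLT (P.γIter 0 p) (P.γ a)) then
    .minus p
  else
    .plus p

open Classical in
/-- The face `x_low` of a flag `x` under `p`. -/
noncomputable def low (p : P.Face) (x : FaceSeq P) : CylFace P :=
  if IsFirstFlag p x then .minus p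
  else if IsLastFlag p x then .plus p
  else ofSeq p (x.erase (lowLevel p x))

open Classical in
/-- The codomain of a face of the cylinder. The one-element flag `[x_0]` is an arrow
from `-x_0` to `+x_0`. -/
noncomputable def γ : CylFace P → CylFace P
  | minus p => minus (P.γ p)
  | plus p => plus (P.γ p)
  | flag p x _ => if P.dim p = 0 then .plus p else ofSeq p (x.erase (P.dim p - 1))
  | pflag p z _ => star (P.γ p) z

/-- The face `[x_i, …, x_0]` obtained by removing everything above level `i` (as a set with one
element). -/
def side (x : FaceSeq P) (i : ℕ) : Set (CylFace P) :=
  {φ | ∃ q, x i = some q ∧ ∃ hq : IsFlag q (x.trunc i), φ = .flag q (x.trunc i) hq}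

open Classical in
/-- The domain of a face of the cylinder. For a flag `x = [x_k, …, x_0]` with `k > 0` it consists of
`[x_{k-1}, …, x_0]` and `x_low`; for a p-flag it consists of the `q ⋆ z` with `q ∈ δ x_k` and, for
a high p-flag with `k > 1`, of the flag `[x_{k-2}, …, x_0]`. -/
noncomputable def δ : CylFace P → Set (CylFace P)
  | minus p => minus '' P.δ p
  | plus p => plus '' P.δ p
  | flag p x _ => if P.dim p = 0 then {.minus p} else side x (P.dim p - 1) ∪ {low p x}
  | pflag p z _ => ((fun q => star q z) '' P.δ p) ∪
      (if 1 < P.dim p ∧ z (P.dim p - 1) = none then side z (P.dim p - 2) else ∅)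

theorem flag_level {p : P.Face} {x : FaceSeq P} (hx : IsFlag p x) {i : ℕ} {a : P.Face}
    (ha : x i = some a) : P.dim a = i := by
  obtain ⟨h0, h1, h2⟩ := hx
  have key : ∀ n i, i + n = P.dim p → ∀ a, x i = some a → P.dim a = i := by
    intro n
    induction n with
    | zero =>
      intro i hi a ha
      obtain rfl : i = P.dim p := by omega
      rw [h0] at ha
      cases ha; rfl
    | succ n ih =>
      intro i hi a ha
      obtain ⟨c, b, hc, hb, hcb⟩ := h2 i (by omega)
      rw [ha] at hc
      cases hc
      have hb' := ih (i + 1) (by omega) b hb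
      obtain ⟨hpos, rfl | hm⟩ := hcb
      · have := P.dim_γ b hpos; omega
      · have := P.dim_δ b _ hm; omega
  by_cases hi : i ≤ P.dim p
  · exact key (P.dim p - i) i (by omega) a ha
  · rw [h1 i (by omega)] at ha
    cases ha

theorem lowLevel_lt (p : P.Face) (x : FaceSeq P) (hp : 0 < P.dim p) : lowLevel p x < P.dim p := by
  have : lowLevel p x ≤ P.dim p - 1 := csSup_le' (by
    rintro i ⟨hi, -⟩
    omega)
  omega

theorem exists_hole {p : P.Face} {z : FaceSeq P} (hz : IsPFlag p z) :
    ∃ i, i < P.dim p ∧ z i = none := by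
  obtain ⟨x, -, ⟨h, rfl⟩ | ⟨h, -, -, rfl⟩⟩ := hz
  · exact ⟨P.dim p - 1, by omega, by simp [FaceSeq.erase]⟩
  · exact ⟨lowLevel p x, lowLevel_lt p x (by omega), by simp [FaceSeq.erase]⟩

theorem pflag_level {p : P.Face} {z : FaceSeq P} (hz : IsPFlag p z) {i : ℕ} {a : P.Face}
    (ha : z i = some a) : P.dim a = i := by
  obtain ⟨x, hx, ⟨h, rfl⟩ | ⟨h, -, -, rfl⟩⟩ := hz <;>
  · refine flag_level hx (i := i) ?_
    rw [← ha, FaceSeq.erase, Function.update_apply]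
    split_ifs with hi
    · simp [FaceSeq.erase, hi] at ha
    · rfl

theorem puncture_spec {p : P.Face} {z : FaceSeq P} (hz : IsPFlag p z) :
    puncture z < P.dim p ∧ z (puncture z) = none := by
  obtain ⟨i, hi, hn⟩ := exists_hole hz
  have hne : {i | z i = none}.Nonempty := ⟨i, hn⟩
  exact ⟨lt_of_le_of_lt (Nat.sInf_le hn) hi, Nat.sInf_mem hne⟩

theorem dim_ofSeq_of_hole {p : P.Face} {s : FaceSeq P} {i : ℕ} (hi : i < P.dim p)
    (hs : s i = none) : (ofSeq p s).dim = P.dim p := by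
  unfold ofSeq
  split_ifs with h1 h2
  · obtain ⟨a, b, ha, -⟩ := h1.2.2 i hi
    rw [hs] at ha
    cases ha
  · rfl
  · rfl

theorem dim_star {p : P.Face} {z : FaceSeq P} (hl : puncture z ≤ P.dim p)
    (hn : z (puncture z) = none) : (star p z).dim = P.dim p := by
  have hj : ∀ t j, j < P.dim p → (ofSeq p (liftSeq p t j z)).dim = P.dim p := fun t j hj =>
    dim_ofSeq_of_hole hj (by simp [liftSeq])
  unfold star
  dsimp only
  split_ifs with h1 h2 h3 h4
  · exact dim_ofSeq_of_hole (i := puncture z) (lt_of_le_of_ne hl (Ne.symm h1.1))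
      (by simp [FaceSeq.trunc, hn])
  · exact hj _ _ h2.1
  · exact hj _ _ (by omega)
  · exact hj _ _ (by have := h4.choose_spec.1.2.1; omega)
  · rfl
  · rfl

theorem dim_low {p : P.Face} {x : FaceSeq P} (hp : 0 < P.dim p) : (low p x).dim = P.dim p := by
  unfold low
  split_ifs
  · rfl
  · rfl
  · exact dim_ofSeq_of_hole (lowLevel_lt p x hp) (by simp [FaceSeq.erase])

theorem pflag_dim_pos {p : P.Face} {z : FaceSeq P} (hz : IsPFlag p z) : 0 < P.dim p := by
  obtain ⟨i, hi, -⟩ := exists_hole hz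
  omega

/-- A code for faces of the cylinder, used to show that there are finitely many of them. -/
def code : CylFace P → Fin 4 × P.Face × Set P.Face
  | minus p => (0, p, ∅)
  | plus p => (1, p, ∅)
  | flag p x _ => (2, p, {a | x (P.dim a) = some a})
  | pflag p z _ => (3, p, {a | z (P.dim a) = some a})

theorem seq_ext {x y : FaceSeq P} (hx : ∀ i a, x i = some a → P.dim a = i)
    (hy : ∀ i a, y i = some a → P.dim a = i)
    (h : {a | x (P.dim a) = some a} = {a | y (P.dim a) = some a}) : x = y := by
  funext i
  refine Option.ext fun a => ⟨fun ha => ?_, fun ha => ?_⟩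
  · have hi := hx i a ha
    have : a ∈ {a | x (P.dim a) = some a} := by simpa [hi] using ha
    rw [h] at this
    simpa [hi] using this
  · have hi := hy i a ha
    have : a ∈ {a | y (P.dim a) = some a} := by simpa [hi] using ha
    rw [← h] at this
    simpa [hi] using this

theorem code_injective : Function.Injective (code (P := P)) := by
  intro φ ψ h
  cases φ <;> cases ψ <;> simp only [code, Prod.mk.injEq, Fin.reduceEq, false_and, true_and] at h
  · obtain ⟨rfl, -⟩ := h; rfl
  · obtain ⟨rfl, -⟩ := h; rfl
  · obtain ⟨rfl, h⟩ := h
    rename_i hx _ hy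
    have e := seq_ext (fun _ _ => flag_level hx) (fun _ _ => flag_level hy) h
    simp only [flag.injEq, true_and]
    exact e
  · obtain ⟨rfl, h⟩ := h
    rename_i hx _ hy
    have e := seq_ext (fun _ _ => pflag_level hx) (fun _ _ => pflag_level hy) h
    simp only [pflag.injEq, true_and]
    exact e

end CylFace

/-- The cylinder over `P` as a positive hypergraph. -/
noncomputable def cylinder (P : PosHypergraph.{u}) : PosHypergraph.{u} where
  Face := CylFace P
  finite := by
    have := P.finite
    exact Finite.of_injective _ CylFace.code_injective
  dim := CylFace.dim
  γ := CylFace.γ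
  δ := CylFace.δ
  dim_γ := by
    rintro (p | p | ⟨p, x, hx⟩ | ⟨p, z, hz⟩) h
    · exact P.dim_γ p h
    · exact P.dim_γ p h
    · unfold CylFace.γ
      dsimp only
      split_ifs with hp
      · rfl
      · rw [CylFace.dim_ofSeq_of_hole (i := P.dim p - 1) (by omega) (by simp [FaceSeq.erase])]
        rfl
    · have h1 := CylFace.puncture_spec hz
      have h2 := P.dim_γ p h
      exact (congrArg (· + 1) (CylFace.dim_star (p := P.γ p) (by omega) h1.2)).trans h2
  γ_zero := by
    rintro (p | p | ⟨p, x, hx⟩ | ⟨p, z, hz⟩) h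
    · exact congrArg CylFace.minus (P.γ_zero p h)
    · exact congrArg CylFace.plus (P.γ_zero p h)
    · exact absurd h (Nat.succ_ne_zero _)
    · exact absurd h (CylFace.pflag_dim_pos hz).ne'
  dim_δ := by
    rintro (p | p | ⟨p, x, hx⟩ | ⟨p, z, hz⟩) φ h
    · obtain ⟨q, hq, rfl⟩ := h
      exact P.dim_δ p q hq
    · obtain ⟨q, hq, rfl⟩ := h
      exact P.dim_δ p q hq
    · unfold CylFace.δ at h
      dsimp only at h
      split_ifs at h with hp
      · rw [Set.mem_singleton_iff] at h
        subst h
        rfl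
      · rcases h with ⟨q, hq, hf, rfl⟩ | h
        · have := CylFace.flag_level hx hq
          simp only [CylFace.dim]
          omega
        · rw [Set.mem_singleton_iff] at h
          subst h
          rw [CylFace.dim_low (by omega)]
          rfl
    · unfold CylFace.δ at h
      dsimp only at h
      rcases h with ⟨q, hq, rfl⟩ | h
      · have h1 := CylFace.puncture_spec hz
        have h2 := P.dim_δ p q hq
        exact (congrArg (· + 1) (CylFace.dim_star (p := q) (by omega) h1.2)).trans h2
      · split_ifs at h with hp
        · obtain ⟨q, hq, hf, rfl⟩ := h
          have := CylFace.pflag_level hz hq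
          simp only [CylFace.dim]
          omega
        · exact absurd h (Set.notMem_empty _)
  δ_nonempty := by
    rintro (p | p | ⟨p, x, hx⟩ | ⟨p, z, hz⟩) h
    · exact (P.δ_nonempty p h).image _
    · exact (P.δ_nonempty p h).image _
    · unfold CylFace.δ
      dsimp only
      split_ifs
      · exact Set.singleton_nonempty _
      · exact ⟨_, Or.inr rfl⟩
    · exact ((P.δ_nonempty p h).image _).inl
  δ_one := by
    rintro (p | p | ⟨p, x, hx⟩ | ⟨p, z, hz⟩) h
    · exact (P.δ_one p h).image _
    · exact (P.δ_one p h).image _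
    · have hp : P.dim p = 0 := Nat.succ.inj h
      simp [CylFace.δ, hp]
    · have hp : P.dim p = 1 := h
      simpa [CylFace.δ, hp] using (P.δ_one p hp).image (fun q => CylFace.star q z)

section Lift

variable {Q : PosHypergraph.{v}} {P : PosHypergraph.{u}}

/-- `q` is a `⟨ϱ, h⟩`-splitting face. -/
inductive IsSplitting (h : Q.Face → P.Face) (ϱ : Q.Face → intervalOpetope.Face) : Q.Face → Prop
  | base (q : Q.Face) : Q.dim q = 1 → P.dim (h q) = 0 → ϱ q = IFace.arrow → IsSplitting h ϱ q
  | step (q q' : Q.Face) : P.dim (h q) + 1 = Q.dim q → ϱ q = IFace.arrow → q' ∈ Q.δ q →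
      IsSplitting h ϱ q' → IsSplitting h ϱ q

/-- `q` is a threshold face. -/
def IsThreshold (h : Q.Face → P.Face) (ϱ : Q.Face → intervalOpetope.Face) (q : Q.Face) : Prop :=
  (Q.dim q = 1 ∧ P.dim (h q) = 1 ∧ ϱ q = IFace.arrow) ∨
    (2 ≤ Q.dim q ∧ q ∉ ker h ∧ ∃ s ∈ Q.δ q, IsSplitting h ϱ s)

/-- `[p, φ]` and `[p, 0, φ]`: put `p`, at its own level, on top of the sequence of `φ`. The dummy
node is present exactly when the top of `φ` is two levels below `p`. -/
noncomputable def bracket (p : P.Face) (φ : CylFace P) : CylFace P :=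
  CylFace.ofSeq p (Function.update φ.seq (P.dim p) (some p))

open Classical in
/-- The map `H` into the cylinder determined by `h` and `ϱ`. Here `h₁.choose` is the splitting face
`σ(q)` in `δ q`, and `h₂.choose` is the threshold face `τ(q)` in `δ q`. (No face `q` of dimension
`0` has `ϱ q = IFace.arrow` when `ϱ` is an `ι`-map.) -/
noncomputable def cylLift (h : Q.Face → P.Face) (ϱ : Q.Face → intervalOpetope.Face)
    (q : Q.Face) : (cylinder P).Face :=
  if ϱ q = IFace.neg then CylFace.minus (h q)
  else if ϱ q = IFace.pos then CylFace.plus (h q)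
  else if hq : Q.dim q ≤ 1 then
    -- `[h(q)]` if `q` is splitting, and `[h(q), 0]` otherwise
    CylFace.ofSeq (h q) (Function.update (fun _ => none) (P.dim (h q)) (some (h q)))
  else if h₁ : (IsSplitting h ϱ q ∨ q ∉ ker h) ∧ ∃ s ∈ Q.δ q, IsSplitting h ϱ s then
    -- `[h(q), H(σ(q))]` if `q` is splitting, and `[h(q), 0, H(σ(q))]` otherwise
    bracket (h q) (cylLift h ϱ h₁.2.choose)
  else if h₂ : q ∉ ker h ∧ ∃ t ∈ Q.δ q, IsThreshold h ϱ t then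
    bracket (h q) (cylLift h ϱ h₂.2.choose)
  else if q ∉ ker h then
    bracket (h q) (cylLift h ϱ (Q.γ q))
  else
    cylLift h ϱ (Q.γ q)
termination_by Q.dim q
decreasing_by
  · have := Q.dim_δ q _ h₁.2.choose_spec.1; omega
  · have := Q.dim_δ q _ h₂.2.choose_spec.1; omega
  · have := Q.dim_γ q (by omega); omega

end Lift

/-! Existence. Off the arrow part of `ϱ` the map is `±h`. On the arrow part, call splitting and
threshold faces active. The key fact is `IsCylPair.transport`: the domain of a face `α` contains an
active face exactly when `γ α` is active, and then only one. Two incomparable faces of an opetope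
lie below distinct faces of one common domain (`exists_branching`), so the active faces of each
dimension form a `<⁺`-chain, with the splitting faces before the threshold ones. An active face of
the next dimension is a bridge: a splitting face in its domain, a threshold face as its codomain.

All splitting faces of one dimension have the same image (`map_splitting_eq`). Hence there is a
single sequence `splitSeq` in `P`, and `H` sends each splitting face to a truncation of it. For an
uncollapsed face `q`, let its level be the threshold face `t` of highest dimension in its iterated
domains. Then `H(q)` is the p-flag that consists of iterated codomains of `h q` above `h t`, then `h
t`, a dummy, and `splitSeq` below. These closed forms (`cylMap_of_splitting`, `cylMap_of_isLevel`)
replace the recursion that defines `H`.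

The axioms of an `ι`-map then say that, for `r` in the boundary of `q`, the star operation applied
to the p-flag of `q` stops exactly at the level of `r`. It does stop there by `marker_le`, and
nowhere higher by `not_marker_le`. Both represent the entries of the p-flag by threshold faces of
`Q`, since on uncollapsed faces `h` preserves the upper order and reflects it up to collapsed pairs
(`map_le`, `reflect_le`). If `r` is flat, the sign is found by comparing vertices. For a splitting
`q`, `splitSeq_level` identifies the low face of its flag.

Uniqueness. Two lifts are compared by induction on dimension. A face on which the dimension drops
has the value of its codomain; otherwise the domain and codomain of the value are already known.
With its projections fixed, a flat face is determined outright, a flag by its domain (which contains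
the flag of all its lower levels), and a p-flag by its domain and codomain. A flag and a p-flag over
the same face differ in dimension, and `not_flag_pflag` excludes this discrepancy. -/

namespace PosHypergraph

/-! ### The upper order, iterated codomains and closures in a positive hypergraph. -/

section Basic

variable {S : PosHypergraph.{u}} {a b c x y q : S.Face}

theorem dim_pos_of_mem_δ (h : a ∈ S.δ x) : 0 < S.dim x := by
  have := S.dim_δ x a h; omega

theorem dim_γ_eq_of_mem_δ (h : a ∈ S.δ x) : S.dim (S.γ x) = S.dim a := by
  have := S.dim_δ x a h
  have := S.dim_γ x (by omega)
  omega

theorem upperLT_of_mem (h : a ∈ S.δ x) : S.UpperLT a (S.γ x) :=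
  Relation.TransGen.single ⟨x, h, rfl⟩

theorem UpperLT.trans (h : S.UpperLT a b) (h' : S.UpperLT b c) : S.UpperLT a c :=
  Relation.TransGen.trans h h'

theorem UpperLE.refl (a : S.Face) : S.UpperLE a a := Or.inl rfl

theorem UpperLT.le (h : S.UpperLT a b) : S.UpperLE a b := Or.inr h

theorem UpperLT.trans_le (h : S.UpperLT a b) (h' : S.UpperLE b c) : S.UpperLT a c := by
  rcases h' with rfl | h'
  · exact h
  · exact h.trans h'

theorem UpperLE.trans_lt (h : S.UpperLE a b) (h' : S.UpperLT b c) : S.UpperLT a c := by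
  rcases h with rfl | h
  · exact h'
  · exact h.trans h'

theorem UpperLE.trans (h : S.UpperLE a b) (h' : S.UpperLE b c) : S.UpperLE a c := by
  rcases h with rfl | h
  · exact h'
  · exact (h.trans_le h').le

theorem UpperLT.dim_eq (h : S.UpperLT a b) : S.dim a = S.dim b := by
  induction h with
  | single h => obtain ⟨α, h, rfl⟩ := h; exact (dim_γ_eq_of_mem_δ h).symm
  | tail _ h ih => obtain ⟨α, h, rfl⟩ := h; rw [ih]; exact (dim_γ_eq_of_mem_δ h).symm

theorem UpperLE.dim_eq (h : S.UpperLE a b) : S.dim a = S.dim b := by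
  rcases h with rfl | h
  · rfl
  · exact h.dim_eq

theorem upperLE_iff_reflTransGen :
    S.UpperLE a b ↔ Relation.ReflTransGen (fun a b => ∃ α, a ∈ S.δ α ∧ S.γ α = b) a b := by
  rw [Relation.reflTransGen_iff_eq_or_transGen, UpperLE, UpperLT, eq_comm]

theorem UpperLT.exists_head (h : S.UpperLT a b) : ∃ α, a ∈ S.δ α ∧ S.UpperLE (S.γ α) b := by
  obtain ⟨_, ⟨α, hα, rfl⟩, h⟩ := Relation.TransGen.head'_iff.1 h
  exact ⟨α, hα, upperLE_iff_reflTransGen.2 h⟩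

theorem UpperLT.exists_tail (h : S.UpperLT a b) :
    ∃ α a', S.UpperLE a a' ∧ a' ∈ S.δ α ∧ S.γ α = b := by
  obtain ⟨a', h, α, hα, e⟩ := Relation.TransGen.tail'_iff.1 h
  exact ⟨α, a', upperLE_iff_reflTransGen.2 h, hα, e⟩

/-! ### Iterated codomains -/

theorem γIter_of_le {k : ℕ} {p : S.Face} (h : S.dim p ≤ k) : S.γIter k p = p := by
  simp [γIter, Nat.sub_eq_zero_of_le h]

theorem γIter_γ {k : ℕ} {p : S.Face} (h : k < S.dim p) : S.γIter k (S.γ p) = S.γIter k p := by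
  have := S.dim_γ p (by omega)
  unfold γIter
  rw [show S.dim p - k = (S.dim (S.γ p) - k) + 1 by omega, Function.iterate_succ_apply]

theorem dim_γIter {k : ℕ} {p : S.Face} (h : k ≤ S.dim p) : S.dim (S.γIter k p) = k := by
  induction hn : S.dim p - k generalizing p with
  | zero => rw [γIter_of_le (by omega)]; omega
  | succ n ih =>
    have := S.dim_γ p (by omega)
    rw [← γIter_γ (by omega)]
    exact ih (by omega) (by omega)

theorem γ_γIter {k : ℕ} {p : S.Face} (h : k < S.dim p) :
    S.γ (S.γIter (k + 1) p) = S.γIter k p := by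
  unfold γIter
  rw [show S.dim p - k = (S.dim p - (k + 1)) + 1 by omega, Function.iterate_succ_apply']

theorem γIter_pred {p : S.Face} (h : 0 < S.dim p) : S.γIter (S.dim p - 1) p = S.γ p := by
  have := S.dim_γ p h
  rw [← γIter_γ (by omega), γIter_of_le (by omega)]

theorem γIter_γIter {i k : ℕ} {p : S.Face} (h : i ≤ k) :
    S.γIter i (S.γIter k p) = S.γIter i p := by
  induction hn : S.dim p - k generalizing p with
  | zero => rw [γIter_of_le (k := k) (by omega)]
  | succ n ih =>
    have := S.dim_γ p (by omega)
    rw [← γIter_γ (k := k) (by omega), ih (by omega), γIter_γ (by omega)]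

/-! ### Faces of faces -/

/-- `x` belongs to the closure of `q`. -/
def FaceOf (S : PosHypergraph.{u}) (x q : S.Face) : Prop :=
  Relation.ReflTransGen (fun x y => x ∈ S.boundary y) x q

theorem FaceOf.refl (q : S.Face) : S.FaceOf q q := Relation.ReflTransGen.refl

theorem FaceOf.trans (h : S.FaceOf x y) (h' : S.FaceOf y q) : S.FaceOf x q :=
  Relation.ReflTransGen.trans h h'

theorem mem_boundary_γ (h : 0 < S.dim x) : S.γ x ∈ S.boundary x := ⟨h, Or.inl rfl⟩

theorem mem_boundary_δ (h : a ∈ S.δ x) : a ∈ S.boundary x := ⟨dim_pos_of_mem_δ h, Or.inr h⟩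

theorem dim_of_mem_boundary (h : a ∈ S.boundary x) : S.dim a + 1 = S.dim x := by
  obtain ⟨h, rfl | h'⟩ := h
  · exact S.dim_γ x h
  · exact S.dim_δ x a h'

theorem faceOf_of_mem_boundary (h : a ∈ S.boundary x) : S.FaceOf a x :=
  Relation.ReflTransGen.single h

theorem faceOf_γ (x : S.Face) : S.FaceOf (S.γ x) x := by
  rcases Nat.eq_zero_or_pos (S.dim x) with h | h
  · rw [S.γ_zero x h]; exact .refl _
  · exact faceOf_of_mem_boundary (mem_boundary_γ h)

theorem faceOf_δ (h : a ∈ S.δ x) : S.FaceOf a x := faceOf_of_mem_boundary (mem_boundary_δ h)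

theorem faceOf_γIter (k : ℕ) (x : S.Face) : S.FaceOf (S.γIter k x) x := by
  induction hn : S.dim x - k generalizing x with
  | zero => rw [γIter_of_le (by omega)]; exact .refl _
  | succ n ih =>
    have := S.dim_γ x (by omega)
    rw [← γIter_γ (by omega)]
    exact (ih _ (by omega)).trans (faceOf_γ x)

theorem FaceOf.dim_le (h : S.FaceOf x q) : S.dim x ≤ S.dim q := by
  induction h with
  | refl => rfl
  | tail _ h ih => have := dim_of_mem_boundary h; omega

theorem FaceOf.eq_of_dim_le (h : S.FaceOf x q) (hd : S.dim q ≤ S.dim x) : x = q := by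
  rcases Relation.ReflTransGen.cases_tail h with rfl | ⟨y, hy, hb⟩
  · rfl
  · have := FaceOf.dim_le (S := S) hy
    have := dim_of_mem_boundary hb
    omega

theorem FaceOf.exists_boundary (h : S.FaceOf x q) (hd : S.dim x < S.dim q) :
    ∃ y, S.FaceOf x y ∧ y ∈ S.boundary q := by
  rcases Relation.ReflTransGen.cases_tail h with rfl | h
  · omega
  · exact h

theorem FaceOf.mem_boundary (h : S.FaceOf x q) (hd : S.dim x + 1 = S.dim q) :
    x ∈ S.boundary q := by
  obtain ⟨y, hy, hb⟩ := h.exists_boundary (by omega)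
  have := dim_of_mem_boundary hb
  rwa [hy.eq_of_dim_le (by omega)]

theorem upperLE_γ_of_mem_boundary (h : a ∈ S.boundary x) : S.UpperLE a (S.γ x) := by
  obtain ⟨_, rfl | h⟩ := h
  · exact .refl _
  · exact (upperLT_of_mem h).le

end Basic

/-! ### Order structure of opetopic cardinals. -/

namespace IsOpetopicCardinal

variable {S : PosHypergraph.{u}} (hS : S.IsOpetopicCardinal) {a b c x y q : S.Face}
include hS

theorem not_lt_of_le (h : S.UpperLE a b) : ¬ S.UpperLT b a := fun h' =>
  hS.strictness _ (h'.trans_le h)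

theorem le_antisymm (h : S.UpperLE a b) (h' : S.UpperLE b a) : a = b := by
  rcases h with rfl | h
  · rfl
  · exact absurd h (hS.not_lt_of_le h')

theorem wf_lt : WellFounded S.UpperLT := by
  have := S.finite
  have : IsTrans S.Face S.UpperLT := ⟨fun _ _ _ h h' => h.trans h'⟩
  have : Std.Irrefl S.UpperLT := ⟨hS.strictness⟩
  exact Finite.wellFounded_of_trans_of_irrefl _

theorem wf_gt : WellFounded (Function.swap S.UpperLT) := by
  have := S.finite
  have : IsTrans S.Face (Function.swap S.UpperLT) := ⟨fun _ _ _ h h' => UpperLT.trans h' h⟩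
  have : Std.Irrefl (Function.swap S.UpperLT) := ⟨hS.strictness⟩
  exact Finite.wellFounded_of_trans_of_irrefl _

theorem γ_not_mem_δ (x : S.Face) : S.γ x ∉ S.δ x := fun h =>
  hS.strictness _ (upperLT_of_mem h)

theorem γ_cases (h : a ∈ S.δ x) (ha : 0 < S.dim a) :
    S.γ a = S.γ (S.γ x) ∨ ∃ b ∈ S.δ x, S.γ a ∈ S.δ b := by
  by_cases hb : ∃ b ∈ S.δ x, S.γ a ∈ S.δ b
  · exact Or.inr hb
  · left
    have h2 := S.dim_δ x a h
    have : S.γ a ∈ (S.γ '' S.δ x) \ (⋃ y ∈ S.δ x, S.δ y) := by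
      refine ⟨⟨a, h, rfl⟩, ?_⟩
      simpa using hb
    rw [← hS.globularity_γ x (by omega)] at this
    exact this

theorem exists_γ_eq_γγ (h : 2 ≤ S.dim x) : ∃ a ∈ S.δ x, S.γ a = S.γ (S.γ x) := by
  have : S.γ (S.γ x) ∈ (S.γ '' S.δ x) \ (⋃ y ∈ S.δ x, S.δ y) := by
    rw [← hS.globularity_γ x h]; rfl
  exact this.1

theorem mem_δγ_iff (h : 2 ≤ S.dim x) :
    y ∈ S.δ (S.γ x) ↔ (∃ a ∈ S.δ x, y ∈ S.δ a) ∧ ∀ a ∈ S.δ x, S.γ a ≠ y := by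
  rw [hS.globularity_δ x h]
  simp

/-- For one step `a ∈ δ α`, globularity leaves two possibilities: `γ a` is `γ γ α`, or it lies in
the domain of another `b ∈ δ α`. In the second case `γ b` is strictly higher, so the walk through `δ
α` ends at `γ γ α`. -/
theorem γ_mono_lt (h : S.UpperLT a b) : S.UpperLE (S.γ a) (S.γ b) := by
  have step : ∀ α a, a ∈ S.δ α → S.UpperLE (S.γ a) (S.γ (S.γ α)) := by
    intro α a ha
    rcases Nat.eq_zero_or_pos (S.dim a) with h0 | h0
    · rw [S.γ_zero a h0, S.γ_zero (S.γ α) (by rw [dim_γ_eq_of_mem_δ ha, h0])]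
      exact (upperLT_of_mem ha).le
    · revert ha h0
      induction hg : S.γ a using hS.wf_gt.induction generalizing a with
      | _ g ih =>
        intro ha h0
        rcases hS.γ_cases ha h0 with e | ⟨b, hb, hab⟩
        · rw [← hg, e]; exact .refl _
        · rw [hg] at hab
          have hlt := upperLT_of_mem hab
          have e := S.dim_δ α a ha
          have e' := S.dim_δ α b hb
          exact hlt.le.trans (ih _ hlt b rfl hb (by omega))
  induction h with
  | single h => obtain ⟨α, h, rfl⟩ := h; exact step α _ h
  | tail _ h ih => obtain ⟨α, h, rfl⟩ := h; exact ih.trans (step α _ h)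

theorem γ_mono (h : S.UpperLE a b) : S.UpperLE (S.γ a) (S.γ b) := by
  rcases h with rfl | h
  · exact .refl _
  · exact hS.γ_mono_lt h

theorem γIter_mono (k : ℕ) (h : S.UpperLE a b) : S.UpperLE (S.γIter k a) (S.γIter k b) := by
  induction hn : S.dim a - k generalizing a b with
  | zero =>
    have := h.dim_eq
    rw [γIter_of_le (by omega), γIter_of_le (by omega)]; exact h
  | succ n ih =>
    have := h.dim_eq
    have := S.dim_γ a (by omega)
    rw [← γIter_γ (by omega), ← γIter_γ (p := b) (by omega)]
    exact ih (hS.γ_mono h) (by omega)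

/-- The faces above a given face are linearly ordered. -/
theorem upset_linear (hx : S.UpperLE a x) (hy : S.UpperLE a y) :
    S.UpperLE x y ∨ S.UpperLT y x := by
  induction a using hS.wf_gt.induction generalizing x y with
  | _ a ih =>
    rcases hx with rfl | hx
    · exact Or.inl hy
    rcases hy with rfl | hy
    · exact Or.inr hx
    obtain ⟨α, hα, hαx⟩ := hx.exists_head
    obtain ⟨β, hβ, hβy⟩ := hy.exists_head
    by_cases e : α = β
    · subst e; exact ih _ (upperLT_of_mem hα) hαx hβy
    -- The two first steps share `a` in their domains, hence are comparable. By monotonicity of `γ`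
    -- both `x` and `y` lie above the codomain of the smaller one, where induction applies.
    · rcases hS.pencil_δ α β a hα hβ e with h | h
      · exact ih _ (upperLT_of_mem hα) hαx ((hS.γ_mono_lt h).trans hβy)
      · exact ih _ (upperLT_of_mem hβ) ((hS.γ_mono_lt h).trans hαx) hβy

/-- An upper chain from `γ a` to `b` is read as a lower chain: the face witnessing each step has the
preceding codomain in its domain. This turns upper comparisons in a domain into lower ones, so that
disjointness can be used. -/
theorem lowerLT_of_γ_le (ha : 0 < S.dim a) (h : S.UpperLE (S.γ a) b) (hb : b ∈ S.δ x) :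
    S.LowerLT a x := by
  induction hg : S.γ a using hS.wf_gt.induction generalizing a with
  | _ g ih =>
    rcases h with e | h
    · exact Relation.TransGen.single ⟨ha, e ▸ hb⟩
    · obtain ⟨α, hα, hαb⟩ := h.exists_head
      exact Relation.TransGen.head ⟨ha, hα⟩
        (ih _ (hg ▸ upperLT_of_mem hα) (dim_pos_of_mem_δ hα) hαb rfl)

theorem not_upperLT_of_lowerLT (h : S.LowerLT a b) : ¬ S.UpperLT a b ∧ ¬ S.UpperLT b a :=
  ⟨fun h' => hS.disjointness _ _ ⟨Or.inl h, Or.inl h'⟩,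
    fun h' => hS.disjointness _ _ ⟨Or.inl h, Or.inr h'⟩⟩

/-- The domain of a face is an antichain. -/
theorem δ_antichain (ha : a ∈ S.δ x) (hb : b ∈ S.δ x) : ¬ S.UpperLT a b := by
  intro h
  obtain ⟨α, hα, hαb⟩ := h.exists_head
  by_cases e : α = x
  · subst e
    exact hS.strictness _ (hαb.trans_lt (upperLT_of_mem hb))
  -- The first step `α` of the chain satisfies `α <⁻ x`, yet shares `a` with `x`, which makes the
  -- two `<⁺`-comparable.
  · have h1 := hS.not_upperLT_of_lowerLT (hS.lowerLT_of_γ_le (dim_pos_of_mem_δ hα) hαb hb)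
    rcases hS.pencil_δ α x a hα ha e with h | h
    · exact h1.1 h
    · exact h1.2 h

theorem δ_eq_of_le (ha : a ∈ S.δ x) (hb : b ∈ S.δ x) (h : S.UpperLE a b) : a = b :=
  h.resolve_right (hS.δ_antichain ha hb)

theorem δ_eq_of_common (ha : a ∈ S.δ x) (hb : b ∈ S.δ x) (h : S.UpperLE c a)
    (h' : S.UpperLE c b) : a = b := by
  rcases hS.upset_linear h h' with h | h
  · exact hS.δ_eq_of_le ha hb h
  · exact absurd h (hS.δ_antichain hb ha)

theorem eq_of_mem_δδ (ha : a ∈ S.δ x) (hb : b ∈ S.δ x) (h : c ∈ S.δ a) (h' : c ∈ S.δ b) :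
    a = b := by
  by_contra e
  rcases hS.pencil_δ a b c h h' e with h | h
  · exact hS.δ_antichain ha hb h
  · exact hS.δ_antichain hb ha h

theorem eq_of_γ_eq (ha : a ∈ S.δ x) (hb : b ∈ S.δ x) (h0 : 0 < S.dim a) (h : S.γ a = S.γ b) :
    a = b := by
  by_contra e
  have h1 := S.dim_δ x a ha
  have h2 := S.dim_δ x b hb
  rcases hS.pencil_γ a b h0 (by omega) h e with h | h
  · exact hS.δ_antichain ha hb h
  · exact hS.δ_antichain hb ha h

/-- The codomain of `a ∈ δ x` is below `γ γ x`. -/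
theorem γ_le_γγ (ha : a ∈ S.δ x) : S.UpperLE (S.γ a) (S.γ (S.γ x)) :=
  hS.γ_mono_lt (upperLT_of_mem ha)

/-! ### Closures -/

/-- Descend: as long as `y` is the codomain of a face of `δ x`, pass to a face in the domain of that
face. What remains is no codomain, so globularity puts it in `δ (γ x)`. -/
theorem exists_le_of_mem (hx : 2 ≤ S.dim x)
    (hy : (∃ a ∈ S.δ x, y ∈ S.δ a) ∨ ∃ a ∈ S.δ x, S.γ a = y) :
    ∃ d ∈ S.δ (S.γ x), S.UpperLE d y := by
  induction y using hS.wf_lt.induction with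
  | _ y ih =>
    by_cases hg : ∃ a ∈ S.δ x, S.γ a = y
    · obtain ⟨a, ha, rfl⟩ := hg
      have := S.dim_δ x a ha
      obtain ⟨e, he⟩ := S.δ_nonempty a (by omega)
      obtain ⟨d, hd, hde⟩ := ih e (upperLT_of_mem he) (Or.inl ⟨a, ha, he⟩)
      exact ⟨d, hd, hde.trans (upperLT_of_mem he).le⟩
    · refine ⟨y, (hS.mem_δγ_iff hx).2 ⟨hy.resolve_right hg, ?_⟩, .refl _⟩
      intro a ha e
      exact hg ⟨a, ha, e⟩

/-- Lets a path through `δ W` be replaced by one through `γ W`. If `y` is the codomain of some `a ∈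
δ W`, globularity finds `x` in the boundary of a smaller face of `δ a`. After finitely many such
moves `y` is no codomain and lies in `δ (γ W)`. -/
theorem mem_boundary_boundary_γ {W w : S.Face} (hW : 3 ≤ S.dim W) (hw : w ∈ S.δ W)
    (hy : y ∈ S.boundary w) (hx : x ∈ S.boundary y) :
    ∃ y' ∈ S.boundary (S.γ W), x ∈ S.boundary y' := by
  have hγW := S.dim_γ W (by omega)
  have hdw := S.dim_δ W w hw
  have key : ∀ y, (∃ w ∈ S.δ W, y ∈ S.δ w) → ∀ x ∈ S.boundary y,
      ∃ y' ∈ S.boundary (S.γ W), x ∈ S.boundary y' := by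
    intro y
    induction y using hS.wf_lt.induction with
    | _ y ih =>
      intro hy x hx
      by_cases hg : ∃ a ∈ S.δ W, S.γ a = y
      · obtain ⟨a, ha, rfl⟩ := hg
        have hda := S.dim_δ W a ha
        have hex : ∃ b ∈ S.δ a, x ∈ S.boundary b := by
          obtain ⟨h0, rfl | hx⟩ := hx
          · obtain ⟨b, hb, e⟩ := hS.exists_γ_eq_γγ (x := a) (by omega)
            have := S.dim_δ a b hb
            exact ⟨b, hb, by omega, Or.inl e.symm⟩
          · obtain ⟨b, hb, e⟩ := ((hS.mem_δγ_iff (by omega)).1 hx).1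
            exact ⟨b, hb, mem_boundary_δ e⟩
        obtain ⟨b, hb, hxb⟩ := hex
        exact ih b (upperLT_of_mem hb) ⟨a, ha, hb⟩ x hxb
      · refine ⟨y, mem_boundary_δ ((hS.mem_δγ_iff (by omega)).2 ⟨hy, ?_⟩), hx⟩
        intro a ha e
        exact hg ⟨a, ha, e⟩
  obtain ⟨h0, rfl | hy⟩ := hy
  · rcases hS.γ_cases hw h0 with e | h
    · rw [e] at hx
      exact ⟨_, mem_boundary_γ (by omega), hx⟩
    · exact key _ h x hx
  · exact key y ⟨w, hw, hy⟩ x hx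

/-- Iterating the preceding replacement brings any face of codimension at least two down to an
iterated codomain only two dimensions above it. -/
theorem faceOf_mem_boundary_boundary (h : S.FaceOf x q) (hd : S.dim x + 2 ≤ S.dim q) :
    ∃ y ∈ S.boundary (S.γIter (S.dim x + 2) q), x ∈ S.boundary y := by
  induction hn : S.dim q - S.dim x generalizing x with
  | zero => omega
  | succ n ih =>
    rcases Relation.ReflTransGen.cases_head h with rfl | ⟨y, hxy, hyq⟩
    · omega
    have hxy' := dim_of_mem_boundary hxy
    by_cases h3 : S.dim x + 2 = S.dim q
    · refine ⟨y, ?_, hxy⟩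
      rw [γIter_of_le (by omega)]
      exact FaceOf.mem_boundary hyq (by omega)
    · obtain ⟨w, hw, hyw⟩ := ih (x := y) hyq (by omega) (by omega)
      rw [← hxy'] at hw
      have hdim : S.dim (S.γIter (S.dim x + 3) q) = S.dim x + 3 := dim_γIter (by omega)
      have hγ : S.γ (S.γIter (S.dim x + 3) q) = S.γIter (S.dim x + 2) q := γ_γIter (by omega)
      obtain ⟨-, rfl | hw⟩ := hw
      · rw [hγ] at hyw
        exact ⟨y, hyw, hxy⟩
      · rw [← hγ]
        exact hS.mem_boundary_boundary_γ (by omega) hw hyw hxy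

theorem faceOf_le_γIter (h : S.FaceOf x q) : S.UpperLE x (S.γIter (S.dim x) q) := by
  induction h using Relation.ReflTransGen.head_induction_on with
  | refl => rw [γIter_of_le le_rfl]; exact .refl _
  | @head x y hxy hyq ih =>
    have e := dim_of_mem_boundary hxy
    have h1 := hS.γ_mono ih
    have := FaceOf.dim_le hyq
    rw [← e, γ_γIter (by omega)] at h1
    exact (upperLE_γ_of_mem_boundary hxy).trans h1

/-- Together with `faceOf_le_γIter`, this traps the `i`-dimensional faces of `q` between the domain
and the codomain of `γ^(i+1) q`. -/
theorem faceOf_exists_le (h : S.FaceOf x q) (hd : S.dim x < S.dim q) :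
    ∃ d ∈ S.δ (S.γIter (S.dim x + 1) q), S.UpperLE d x := by
  by_cases h1 : S.dim x + 1 = S.dim q
  · rw [γIter_of_le (by omega)]
    obtain ⟨h0, rfl | hx⟩ := h.mem_boundary h1
    · obtain ⟨d, hd⟩ := S.δ_nonempty q h0
      exact ⟨d, hd, (upperLT_of_mem hd).le⟩
    · exact ⟨x, hx, .refl _⟩
  · obtain ⟨y, hy, hxy⟩ := hS.faceOf_mem_boundary_boundary h (by omega)
    rw [← γ_γIter (by omega)]
    have hdim : S.dim (S.γIter (S.dim x + 2) q) = S.dim x + 2 := dim_γIter (by omega)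
    change ∃ d ∈ S.δ (S.γ (S.γIter (S.dim x + 2) q)), S.UpperLE d x
    generalize S.γIter (S.dim x + 2) q = G at hy hdim
    obtain ⟨-, rfl | hy⟩ := hy
    · obtain ⟨h0, rfl | hxy⟩ := hxy
      · obtain ⟨a, ha, e⟩ := hS.exists_γ_eq_γγ (x := G) (by omega)
        exact hS.exists_le_of_mem (by omega) (Or.inr ⟨a, ha, e⟩)
      · exact ⟨x, hxy, .refl _⟩
    · obtain ⟨h0, rfl | hxy⟩ := hxy
      · exact hS.exists_le_of_mem (by omega) (Or.inr ⟨y, hy, rfl⟩)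
      · exact hS.exists_le_of_mem (by omega) (Or.inl ⟨y, hy, hxy⟩)

/-! ### Intervals -/

/-- A discrete intermediate value argument: codomains increase along the chain from `α` to `d`, and
`Γ` is the step at which they pass `y`. -/
theorem exists_crossing {α d : S.Face} (h : S.UpperLT α d) (h1 : S.UpperLE (S.γ α) y)
    (h2 : S.UpperLT y (S.γ d)) :
    ∃ Γ, ∃ α' ∈ S.δ Γ, S.UpperLE (S.γ Γ) d ∧ S.UpperLE (S.γ α') y ∧
      S.UpperLT y (S.γ (S.γ Γ)) := by
  induction h using Relation.TransGen.head_induction_on with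
  | single h =>
    obtain ⟨Γ, hΓ, rfl⟩ := h
    exact ⟨Γ, _, hΓ, .refl _, h1, h2⟩
  | @head α β h hβ ih =>
    obtain ⟨Γ, hΓ, rfl⟩ := h
    rcases hS.upset_linear (hS.γ_le_γγ hΓ) h1 with h | h
    · exact ih h
    · exact ⟨Γ, α, hΓ, UpperLT.le hβ, h1, h⟩

/-- The interval from `x` to `γ d` is filled by faces below `d`. The crossing step `Γ` has codomain
at most `d`, so every face of `δ Γ` is below `d`. A walk through `δ Γ` meets `y` as a codomain, or
jumps over it along some `e < d`, to which induction applies. -/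
theorem exists_between {d : S.Face} (hx : x ∈ S.δ d) (h1 : S.UpperLT x y)
    (h2 : S.UpperLT y (S.γ d)) :
    (∃ e, S.UpperLT e d ∧ y ∈ S.δ e) ∧ ∃ e, S.UpperLT e d ∧ S.γ e = y ∧ 0 < S.dim e := by
  induction d using hS.wf_lt.induction generalizing x with
  | _ d ih =>
  obtain ⟨α, hα, hαy⟩ := h1.exists_head
  have hαd : S.UpperLT α d := by
    by_cases e : α = d
    · subst e; exact absurd h2 (hS.not_lt_of_le hαy)
    · rcases hS.pencil_δ α d x hα hx e with h | h
      · exact h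
      · exact absurd h2 (hS.not_lt_of_le ((hS.γ_mono_lt h).trans hαy))
  obtain ⟨Γ, α', hα', hΓd, hαy', hyΓ⟩ := hS.exists_crossing hαd hαy h2
  clear hα hαy hαd
  have hdα' : 0 < S.dim α' := by
    have := hΓd.dim_eq
    have := dim_γ_eq_of_mem_δ hα'
    have := S.dim_δ d x hx
    omega
  -- The inner induction is the walk through `δ Γ`; the outer one, on `d`, handles a face whose
  -- codomain jumps over `y`.
  induction hg : S.γ α' using hS.wf_gt.induction generalizing α' with
  | _ g ihg =>
    have hlt : ∀ e ∈ S.δ Γ, S.UpperLT e d := fun e he => (upperLT_of_mem he).trans_le hΓd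
    rcases hS.γ_cases hα' hdα' with e | ⟨e, he, hge⟩
    · rw [e] at hαy'
      exact absurd hyΓ (hS.not_lt_of_le hαy')
    rcases hαy' with rfl | hαy'
    · exact ⟨⟨e, hlt e he, hge⟩, α', hlt _ hα', rfl, hdα'⟩
    have hde := dim_pos_of_mem_δ hge
    rcases hS.upset_linear (upperLT_of_mem hge).le hαy'.le with h | h
    · exact ihg _ (hg ▸ upperLT_of_mem hge) e he h hde rfl
    · obtain ⟨⟨e1, h1, h1'⟩, e2, h2, h2'⟩ := ih e (hlt e he) hge hαy' h
      exact ⟨⟨e1, h1.trans (hlt e he), h1'⟩, e2, h2.trans (hlt e he), h2'⟩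

/-- If `Γ` is the last step up to `β'`, the codomain of `β₁ ∈ δ Γ` is squeezed to `γ γ Γ`. A face of
`δ δ Γ` climbs through codomains in `δ Γ` until it meets the one face with codomain `γ γ Γ`, which
is `β₁`. -/
theorem exists_le_of_γ_eq {β β' w : S.Face} (h : S.UpperLE β β') (h0 : 0 < S.dim β)
    (hγ : S.γ β = S.γ β') (hw : w ∈ S.δ β') : ∃ w' ∈ S.δ β, S.UpperLE w w' := by
  induction β' using hS.wf_lt.induction generalizing w with
  | _ β' ih =>
  rcases h with rfl | h
  · exact ⟨w, hw, .refl _⟩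
  obtain ⟨Γ, β₁, hβ₁, hm, rfl⟩ := h.exists_tail
  have hd1 := hβ₁.dim_eq
  have hd2 := S.dim_δ Γ β₁ hm
  have hγ₁ : S.γ β₁ = S.γ (S.γ Γ) :=
    hS.le_antisymm (hS.γ_le_γγ hm) (hγ ▸ hS.γ_mono hβ₁)
  have key : ∀ w, (∃ e ∈ S.δ Γ, w ∈ S.δ e) → ∃ w' ∈ S.δ β₁, S.UpperLE w w' := by
    intro w
    induction w using hS.wf_gt.induction with
    | _ w ihw =>
      rintro ⟨e, he, hwe⟩
      rcases hS.γ_cases he (dim_pos_of_mem_δ hwe) with h | h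
      · have : e = β₁ := hS.eq_of_γ_eq he hm (dim_pos_of_mem_δ hwe) (h.trans hγ₁.symm)
        exact ⟨w, this ▸ hwe, .refl _⟩
      · obtain ⟨w', hw', hle⟩ := ihw _ (upperLT_of_mem hwe) h
        exact ⟨w', hw', (upperLT_of_mem hwe).le.trans hle⟩
  obtain ⟨w₁, hw₁, hle₁⟩ := key w ((hS.mem_δγ_iff (by omega)).1 hw).1
  obtain ⟨w', hw', hle⟩ := ih β₁ (upperLT_of_mem hm) hβ₁ (hγ.trans hγ₁.symm) hw₁
  exact ⟨w', hw', hle₁.trans hle⟩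

end IsOpetopicCardinal

/-! ### Common upper bounds and branching in an opetope. -/

namespace IsOpetope

variable {S : PosHypergraph.{u}} (hS : S.IsOpetope) {x y : S.Face}
include hS

/-- Every face climbs to one that lies in no domain, and the size condition allows only one such
face in each dimension. -/
theorem exists_common_upper (h : S.dim x = S.dim y) : ∃ w, S.UpperLE x w ∧ S.UpperLE y w := by
  have top : ∀ x, ∃ w, S.UpperLE x w ∧ ∀ z, w ∉ S.δ z := by
    intro x
    induction x using hS.1.wf_gt.induction with
    | _ x ih =>
      by_cases hx : ∃ z, x ∈ S.δ z
      · obtain ⟨z, hz⟩ := hx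
        obtain ⟨w, hw, hw'⟩ := ih _ (upperLT_of_mem hz)
        exact ⟨w, (upperLT_of_mem hz).le.trans hw, hw'⟩
      · exact ⟨x, .refl _, fun z hz => hx ⟨z, hz⟩⟩
  obtain ⟨w, hw, hw'⟩ := top x
  obtain ⟨t, ht, ht'⟩ := top y
  have := S.finite
  have e : w = t := by
    have h1 := hS.2 (S.dim x)
    rw [size, Set.ncard_le_one (Set.toFinite _)] at h1
    exact h1 w ⟨hw.dim_eq.symm, hw'⟩ t ⟨by rw [h, ht.dim_eq], ht'⟩
  subst e
  exact ⟨w, hw, ht⟩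

/-- Two incomparable faces are below two different faces of a common domain. -/
theorem exists_branching (h : S.dim x = S.dim y) (h1 : ¬ S.UpperLE x y) (h2 : ¬ S.UpperLT y x) :
    ∃ β, ∃ x' ∈ S.δ β, ∃ y' ∈ S.δ β, x' ≠ y' ∧ S.UpperLE x x' ∧ S.UpperLE y y' := by
  -- Take a minimal common upper bound `w`. The last steps from `x` and from `y` into `w` have equal
  -- codomains, hence are comparable.
  obtain ⟨w, ⟨hxw, hyw⟩, hmin⟩ := hS.1.wf_lt.has_min {w | S.UpperLE x w ∧ S.UpperLE y w}
    (hS.exists_common_upper h)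
  have hxw' : S.UpperLT x w := by
    rcases hxw with rfl | h
    · exact absurd (hyw.resolve_left fun e => h1 (e ▸ .refl _)) h2
    · exact h
  have hyw' : S.UpperLT y w := by
    rcases hyw with rfl | h
    · exact absurd hxw h1
    · exact h
  -- For `β ≤ β'`, the face of `δ β'` above `y` is dominated by a face of `δ β`. If that were `x'`,
  -- it would be a common upper bound below `w`.
  have main : ∀ x y β β', S.UpperLE β β' → S.γ β = S.γ β' → S.γ β = w →
      ∀ x' ∈ S.δ β, S.UpperLE x x' → ∀ y' ∈ S.δ β', S.UpperLE y y' →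
      (∀ z, S.UpperLE x z → S.UpperLE y z → ¬ S.UpperLT z w) →
      ∃ β, ∃ x' ∈ S.δ β, ∃ y' ∈ S.δ β, x' ≠ y' ∧ S.UpperLE x x' ∧ S.UpperLE y y' := by
    intro x y β β' hβ hγ hw x' hx' hxx' y' hy' hyy' hm
    obtain ⟨y'', hy'', hle⟩ := hS.1.exists_le_of_γ_eq hβ (dim_pos_of_mem_δ hx') hγ hy'
    refine ⟨β, x', hx', y'', hy'', ?_, hxx', hyy'.trans hle⟩
    rintro rfl
    exact hm _ hxx' (hyy'.trans hle) (hw ▸ upperLT_of_mem hx')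
  obtain ⟨β, x', hxx', hx', hβ⟩ := hxw'.exists_tail
  obtain ⟨β', y', hyy', hy', hβ'⟩ := hyw'.exists_tail
  have hcmp : S.UpperLE β β' ∨ S.UpperLE β' β := by
    by_cases e : β = β'
    · exact Or.inl (Or.inl e)
    · exact (hS.1.pencil_γ β β' (dim_pos_of_mem_δ hx') (dim_pos_of_mem_δ hy')
        (hβ.trans hβ'.symm) e).imp UpperLT.le UpperLT.le
  rcases hcmp with h | h
  · exact main x y β β' h (hβ.trans hβ'.symm) hβ x' hx' hxx' y' hy' hyy'
      fun z h1 h2 => hmin z ⟨h1, h2⟩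
  · obtain ⟨β, a, ha, b, hb, hne, h1, h2⟩ := main y x β' β h (hβ'.trans hβ.symm) hβ' y' hy' hyy'
      x' hx' hxx' fun z h1 h2 => hmin z ⟨h2, h1⟩
    exact ⟨β, b, hb, a, ha, hne.symm, h2, h1⟩

end IsOpetope

end PosHypergraph

namespace PosHypergraph

/-! ### Behaviour of `ι`-maps on orders and closures. -/

namespace IsIotaMap

variable {Q : PosHypergraph.{v}} {P : PosHypergraph.{u}} {h : Q.Face → P.Face}
  (hh : IsIotaMap Q P h) {x y q α : Q.Face}
include hh

theorem not_mem_ker : q ∉ ker h ↔ P.dim (h q) = Q.dim q := by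
  have := hh.dim_le q
  simp only [ker, Set.mem_ofPred_eq]
  omega

theorem mem_ker : q ∈ ker h ↔ P.dim (h q) ≠ Q.dim q := by
  rw [← not_iff_not, hh.not_mem_ker, not_not]

theorem map_γ_eq (h0 : 0 < Q.dim q) : h (Q.γ q) = P.γIter (Q.dim q - 1) (h q) := by
  rw [← hh.map_γ (Q.dim q - 1) q (by omega), γIter_pred h0]

theorem map_γ_of_dim_eq (hd : P.dim (h q) = Q.dim q) : h (Q.γ q) = P.γ (h q) := by
  rcases Nat.eq_zero_or_pos (Q.dim q) with h0 | h0
  · rw [Q.γ_zero q h0, P.γ_zero _ (by omega)]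
  · rw [hh.map_γ_eq h0, ← hd, γIter_pred (by omega)]

theorem map_γ_of_dim_ne (hd : P.dim (h q) ≠ Q.dim q) : h (Q.γ q) = h q := by
  have := hh.dim_le q
  rw [hh.map_γ_eq (by omega), γIter_of_le (by omega)]

theorem dim_map_γ (hd : P.dim (h q) = Q.dim q) : P.dim (h (Q.γ q)) = Q.dim (Q.γ q) := by
  rcases Nat.eq_zero_or_pos (Q.dim q) with h0 | h0
  · rw [Q.γ_zero q h0, hd]
  · have := Q.dim_γ q h0
    have := P.dim_γ (h q) (by omega)
    rw [hh.map_γ_of_dim_eq hd]; omega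

theorem map_γIter (k : ℕ) (hd : P.dim (h q) = Q.dim q) :
    h (Q.γIter k q) = P.γIter k (h q) ∧ P.dim (h (Q.γIter k q)) = Q.dim (Q.γIter k q) := by
  induction hn : Q.dim q - k generalizing q with
  | zero =>
    rw [γIter_of_le (by omega), γIter_of_le (by omega)]
    exact ⟨rfl, hd⟩
  | succ n ih =>
    have := Q.dim_γ q (by omega)
    rw [← γIter_γ (by omega), ← γIter_γ (p := h q) (by omega), ← hh.map_γ_of_dim_eq hd]
    exact ih (hh.dim_map_γ hd) (by omega)

/-- A face with a face of its domain outside the kernel drops dimension by at most one. -/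
theorem dim_of_mem_δ (hx : x ∈ Q.δ α) (hd : P.dim (h x) = Q.dim x) :
    P.dim (h α) = Q.dim α ∨ P.dim (h α) + 1 = Q.dim α := by
  have h1 := hh.dim_le α
  by_contra hc
  have := hh.subset_ker α (by omega) hx
  exact (hh.mem_ker.1 this) hd

theorem map_mem_δ (hx : x ∈ Q.δ α) (hd : P.dim (h x) = Q.dim x)
    (hα : P.dim (h α) = Q.dim α) : h x ∈ P.δ (h α) :=
  (hh.bijOn_δ α (dim_pos_of_mem_δ hx) hα).mapsTo ⟨hx, hh.not_mem_ker.2 hd⟩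

theorem map_eq_of_mem_δ (hx : x ∈ Q.δ α) (hd : P.dim (h x) = Q.dim x)
    (hα : P.dim (h α) ≠ Q.dim α) : h x = h α :=
  (hh.bijOn_singleton α ((hh.dim_of_mem_δ hx hd).resolve_left hα)).mapsTo
    ⟨hx, hh.not_mem_ker.2 hd⟩

theorem eq_of_map_eq (hx : x ∈ Q.δ α) (hd : P.dim (h x) = Q.dim x) (hy : y ∈ Q.δ α)
    (hd' : P.dim (h y) = Q.dim y) (e : h x = h y) : x = y := by
  rcases hh.dim_of_mem_δ hx hd with h1 | h1
  · exact (hh.bijOn_δ α (dim_pos_of_mem_δ hx) h1).injOn ⟨hx, hh.not_mem_ker.2 hd⟩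
      ⟨hy, hh.not_mem_ker.2 hd'⟩ e
  · exact (hh.bijOn_singleton α h1).injOn ⟨hx, hh.not_mem_ker.2 hd⟩
      ⟨hy, hh.not_mem_ker.2 hd'⟩ e

theorem exists_mem_δ {t : P.Face} (h0 : 0 < Q.dim α) (hα : P.dim (h α) = Q.dim α)
    (ht : t ∈ P.δ (h α)) : ∃ x ∈ Q.δ α, P.dim (h x) = Q.dim x ∧ h x = t := by
  obtain ⟨x, ⟨hx, hk⟩, e⟩ := (hh.bijOn_δ α h0 hα).surjOn ht
  exact ⟨x, hx, hh.not_mem_ker.1 hk, e⟩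

theorem exists_mem_δ_of_ker (hα : P.dim (h α) + 1 = Q.dim α) :
    ∃ x ∈ Q.δ α, P.dim (h x) = Q.dim x ∧ h x = h α := by
  obtain ⟨x, ⟨hx, hk⟩, e⟩ := (hh.bijOn_singleton α hα).surjOn rfl
  exact ⟨x, hx, hh.not_mem_ker.1 hk, e⟩

/-- Either `α` is uncollapsed and `h x` lies in the domain of `h α`, or `h x`, `h α` and `h (γ α)`
coincide. In both cases `γ α` stays outside the kernel. -/
theorem map_step (hx : x ∈ Q.δ α) (hd : P.dim (h x) = Q.dim x) :
    P.UpperLE (h x) (h (Q.γ α)) ∧ P.dim (h (Q.γ α)) = Q.dim (Q.γ α) := by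
  by_cases hα : P.dim (h α) = Q.dim α
  · rw [hh.map_γ_of_dim_eq hα]
    refine ⟨(upperLT_of_mem (hh.map_mem_δ hx hd hα)).le, ?_⟩
    rw [← hh.map_γ_of_dim_eq hα]
    exact hh.dim_map_γ hα
  · rw [hh.map_γ_of_dim_ne hα, hh.map_eq_of_mem_δ hx hd hα]
    refine ⟨.refl _, ?_⟩
    rw [← hh.map_eq_of_mem_δ hx hd hα, hd, dim_γ_eq_of_mem_δ hx]

theorem map_le (hxy : Q.UpperLE x y) (hd : P.dim (h x) = Q.dim x) :
    P.UpperLE (h x) (h y) ∧ P.dim (h y) = Q.dim y := by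
  rw [upperLE_iff_reflTransGen] at hxy
  induction hxy with
  | refl => exact ⟨.refl _, hd⟩
  | tail _ hs ih =>
    obtain ⟨α, hα, rfl⟩ := hs
    obtain ⟨h1, h2⟩ := hh.map_step hα ih.2
    exact ⟨ih.1.trans h1, h2⟩

/-- Only a collapsed `x` needs work. Then `h x = h (γ x)`, and `γ x` is `γ γ q` or lies in the
domain of some `b ∈ δ q` whose codomain is higher. Hence the induction on dimension, with an inner
one on `γ x`. -/
theorem map_faceOf_of_mem_δ (hQ : Q.IsOpetopicCardinal) (hx : x ∈ Q.δ q) :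
    P.FaceOf (h x) (h q) := by
  induction hn : Q.dim q using Nat.strong_induction_on generalizing x q with
  | _ n ihn =>
    induction hg : Q.γ x using hQ.wf_gt.induction generalizing x with
    | _ g ihg =>
      by_cases hd : P.dim (h x) = Q.dim x
      · by_cases hq : P.dim (h q) = Q.dim q
        · exact faceOf_δ (hh.map_mem_δ hx hd hq)
        · rw [hh.map_eq_of_mem_δ hx hd hq]; exact .refl _
      · have hdx := hh.dim_le x
        have hd1 := Q.dim_δ q x hx
        have hd2 := Q.dim_γ q (by omega)
        rw [← hh.map_γ_of_dim_ne hd]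
        rcases hQ.γ_cases hx (by omega) with e | ⟨b, hb, hab⟩
        · rw [e, hh.map_γ_eq (by omega), hh.map_γ_eq (q := q) (by omega)]
          exact (faceOf_γIter _ _).trans (faceOf_γIter _ _)
        · have hd3 := Q.dim_δ q b hb
          exact (ihn (Q.dim b) (by omega) hab rfl).trans
            (ihg _ (hg ▸ upperLT_of_mem hab) hb rfl)

theorem map_faceOf (hQ : Q.IsOpetopicCardinal) (hx : Q.FaceOf x q) : P.FaceOf (h x) (h q) := by
  induction hx with
  | refl => exact .refl _
  | tail _ hb ih =>
    refine ih.trans ?_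
    obtain ⟨h0, rfl | hb⟩ := hb
    · rw [hh.map_γ_eq h0]; exact faceOf_γIter _ _
    · exact hh.map_faceOf_of_mem_δ hQ hb

/-- Outside the kernel, an `ι`-map reflects the upper order, up to collapsed pairs. -/
theorem reflect_le (hQ : Q.IsOpetope) (hP : P.IsOpetopicCardinal)
    (hx : P.dim (h x) = Q.dim x) (hy : P.dim (h y) = Q.dim y) (hle : P.UpperLE (h x) (h y)) :
    Q.UpperLE x y ∨ (Q.UpperLT y x ∧ h x = h y) := by
  by_cases h1 : Q.UpperLE x y
  · exact Or.inl h1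
  by_cases h2 : Q.UpperLT y x
  · exact Or.inr ⟨h2, hP.le_antisymm hle (hh.map_le h2.le hy).1⟩
  exfalso
  -- Incomparable faces would branch below distinct `x', y' ∈ δ β`. Outside the kernel `h` is
  -- injective on `δ β`, while `h x' = h y'`: both lie above `h x` in one domain, or `β` is
  -- collapsed and both equal `h β`.
  obtain ⟨β, x', hx', y', hy', hne, hxx', hyy'⟩ :=
    hQ.exists_branching (by rw [← hx, ← hy, hle.dim_eq]) h1 h2
  obtain ⟨hle1, hd1⟩ := hh.map_le hxx' hx
  obtain ⟨hle2, hd2⟩ := hh.map_le hyy' hy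
  by_cases hβ : P.dim (h β) = Q.dim β
  · exact hne (hh.eq_of_map_eq hx' hd1 hy' hd2
      (hP.δ_eq_of_common (hh.map_mem_δ hx' hd1 hβ) (hh.map_mem_δ hy' hd2 hβ) hle1
        (hle.trans hle2)))
  · exact hne (hh.eq_of_map_eq hx' hd1 hy' hd2
      ((hh.map_eq_of_mem_δ hx' hd1 hβ).trans (hh.map_eq_of_mem_δ hy' hd2 hβ).symm))

end IsIotaMap

/-! ### Maps to the interval -/

namespace IsIotaMap

variable {Q : PosHypergraph.{v}} {ϱ : Q.Face → intervalOpetope.Face}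
  (hϱ : IsIotaMap Q intervalOpetope ϱ) {x y q : Q.Face}

theorem faceOf_neg {i : intervalOpetope.Face} (hi : intervalOpetope.FaceOf i IFace.neg) :
    i = IFace.neg := hi.eq_of_dim_le (Nat.zero_le _)

theorem faceOf_pos {i : intervalOpetope.Face} (hi : intervalOpetope.FaceOf i IFace.pos) :
    i = IFace.pos := hi.eq_of_dim_le (Nat.zero_le _)

include hϱ

theorem map_eq_neg (hQ : Q.IsOpetopicCardinal) (hx : Q.FaceOf x q) (hq : ϱ q = IFace.neg) :
    ϱ x = IFace.neg := faceOf_neg (hq ▸ hϱ.map_faceOf hQ hx)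

theorem map_eq_pos (hQ : Q.IsOpetopicCardinal) (hx : Q.FaceOf x q) (hq : ϱ q = IFace.pos) :
    ϱ x = IFace.pos := faceOf_pos (hq ▸ hϱ.map_faceOf hQ hx)

theorem map_eq_arrow (hQ : Q.IsOpetopicCardinal) (hx : Q.FaceOf x q) (hx' : ϱ x = IFace.arrow) :
    ϱ q = IFace.arrow := by
  rcases e : ϱ q with _ | _ | _
  · rw [hϱ.map_eq_neg hQ hx e] at hx'; cases hx'
  · rw [hϱ.map_eq_pos hQ hx e] at hx'; cases hx'
  · rfl

theorem dim_pos_of_arrow (hq : ϱ q = IFace.arrow) : 1 ≤ Q.dim q := by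
  have h1 := hϱ.dim_le q
  rw [hq] at h1
  exact h1

theorem γ_arrow (hq : ϱ q = IFace.arrow) (hd : 2 ≤ Q.dim q) : ϱ (Q.γ q) = IFace.arrow := by
  rw [hϱ.map_γ_eq (by omega), hq]
  exact γIter_of_le (by change 1 ≤ _; omega)

theorem γIter_arrow (hq : ϱ q = IFace.arrow) {k : ℕ} (hk : 1 ≤ k) :
    ϱ (Q.γIter k q) = IFace.arrow := by
  induction hn : Q.dim q - k generalizing q with
  | zero => rw [γIter_of_le (by omega)]; exact hq
  | succ n ih =>
    have := Q.dim_γ q (by omega)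
    rw [← γIter_γ (by omega)]
    exact ih (hϱ.γ_arrow hq (by omega)) (by omega)

theorem γ_pos (hq : ϱ q = IFace.arrow) (hd : Q.dim q = 1) : ϱ (Q.γ q) = IFace.pos := by
  rw [hϱ.map_γ_of_dim_eq (by rw [hq, hd]; rfl), hq]; rfl

theorem δ_neg (hq : ϱ q = IFace.arrow) (hd : Q.dim q = 1) (hx : x ∈ Q.δ q) :
    ϱ x = IFace.neg := by
  have h1 := Q.dim_δ q x hx
  have h2 := hϱ.dim_le x
  have := hϱ.map_mem_δ hx (by omega) (by rw [hq, hd]; rfl)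
  rw [hq] at this
  exact this

/-- Vertices are linearly ordered, and the opposite inequality would map to a step out of `pos` in
the interval, where there is none. -/
theorem lt_of_neg_pos (hQ : Q.IsOpetopicCardinal) (hx : Q.dim x = 0) (hy : Q.dim y = 0)
    (hx' : ϱ x = IFace.neg) (hy' : ϱ y = IFace.pos) : Q.UpperLT x y := by
  have hne : x ≠ y := by rintro rfl; rw [hx'] at hy'; cases hy'
  refine (hQ.linear_zero x y hx hy hne).resolve_right fun hlt => ?_
  have h2 := hϱ.dim_le y
  have h1 := (hϱ.map_le hlt.le (by omega)).1
  rw [hx', hy'] at h1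
  rcases h1 with h1 | h1
  · cases h1
  · obtain ⟨α, hα, -⟩ := h1.exists_head
    cases α
    · exact hα
    · exact hα
    · cases hα

end IsIotaMap

end PosHypergraph

/-! ### Splitting and threshold faces, and their chain structure. -/

section Active

variable {Q : PosHypergraph.{v}} {P : PosHypergraph.{u}}
  {h : Q.Face → P.Face} {ϱ : Q.Face → intervalOpetope.Face}

/-- A face is active if it is a splitting or a threshold face. -/
def IsActive (h : Q.Face → P.Face) (ϱ : Q.Face → intervalOpetope.Face) (q : Q.Face) : Prop :=
  IsSplitting h ϱ q ∨ IsThreshold h ϱ q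

theorem IsSplitting.arrow {q : Q.Face} (hq : IsSplitting h ϱ q) : ϱ q = IFace.arrow := by
  cases hq <;> assumption

theorem IsSplitting.dim_map {q : Q.Face} (hq : IsSplitting h ϱ q) :
    P.dim (h q) + 1 = Q.dim q := by
  cases hq <;> omega

theorem IsSplitting.exists_mem {q : Q.Face} (hq : IsSplitting h ϱ q) (hd : 2 ≤ Q.dim q) :
    ∃ s ∈ Q.δ q, IsSplitting h ϱ s := by
  cases hq with
  | base => omega
  | step _ s _ _ hs hs' => exact ⟨s, hs, hs'⟩

theorem IsThreshold.exists_mem {q : Q.Face} (hq : IsThreshold h ϱ q) (hd : 2 ≤ Q.dim q) :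
    ∃ s ∈ Q.δ q, IsSplitting h ϱ s := by
  rcases hq with hq | hq
  · omega
  · exact hq.2.2

theorem IsActive.exists_mem {q : Q.Face} (hq : IsActive h ϱ q) (hd : 2 ≤ Q.dim q) :
    ∃ s ∈ Q.δ q, IsSplitting h ϱ s :=
  hq.elim (·.exists_mem hd) (·.exists_mem hd)

/-- The data of two `ι`-maps, to a cardinal `P` and to the interval, out of an opetope. -/
structure IsCylPair (h : Q.Face → P.Face) (ϱ : Q.Face → intervalOpetope.Face) : Prop where
  opQ : Q.IsOpetope
  opP : P.IsOpetopicCardinal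
  map : IsIotaMap Q P h
  cut : IsIotaMap Q intervalOpetope ϱ

/-- In dimension `j`, active faces are transported by the faces of dimension `j + 1`. -/
def ActiveTransport (h : Q.Face → P.Face) (ϱ : Q.Face → intervalOpetope.Face) (j : ℕ) : Prop :=
  ∀ α, Q.dim α = j + 1 →
    (∀ x ∈ Q.δ α, IsActive h ϱ x → IsActive h ϱ (Q.γ α) ∧ ∀ y ∈ Q.δ α, IsActive h ϱ y → y = x) ∧
    (IsActive h ϱ (Q.γ α) → ∃ x ∈ Q.δ α, IsActive h ϱ x)

namespace IsCylPair

variable (H : IsCylPair h ϱ) {x y q s t α : Q.Face} {j : ℕ}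
include H

theorem threshold_dim (hq : IsThreshold h ϱ q) : P.dim (h q) = Q.dim q := by
  rcases hq with hq | hq
  · omega
  · exact H.map.not_mem_ker.1 hq.2.1

theorem active_arrow (hq : IsActive h ϱ q) : ϱ q = IFace.arrow := by
  rcases hq with hq | hq | ⟨-, -, s, hs, hs'⟩
  · exact hq.arrow
  · exact hq.2.2
  · exact H.cut.map_eq_arrow H.opQ.1 (faceOf_δ hs) hs'.arrow

theorem active_dim_pos (hq : IsActive h ϱ q) : 1 ≤ Q.dim q :=
  H.cut.dim_pos_of_arrow (H.active_arrow hq)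

theorem splitting_dim_pos (hq : IsSplitting h ϱ q) : 1 ≤ Q.dim q :=
  H.active_dim_pos (Or.inl hq)

theorem not_threshold_of_splitting (hq : IsSplitting h ϱ q) : ¬ IsThreshold h ϱ q := by
  intro ht
  have := H.threshold_dim ht
  have := hq.dim_map
  omega

theorem splitting_of_dim_ne (hq : IsActive h ϱ q) (hd : P.dim (h q) ≠ Q.dim q) :
    IsSplitting h ϱ q := hq.resolve_right fun ht => hd (H.threshold_dim ht)

omit H in
theorem threshold_of_dim_eq (hq : IsActive h ϱ q) (hd : P.dim (h q) = Q.dim q) :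
    IsThreshold h ϱ q := hq.resolve_left fun hs => by have := hs.dim_map; omega

theorem active_iff_arrow (hq : Q.dim q = 1) : IsActive h ϱ q ↔ ϱ q = IFace.arrow := by
  refine ⟨H.active_arrow, fun ha => ?_⟩
  have := H.map.dim_le q
  rcases Nat.eq_zero_or_pos (P.dim (h q)) with h0 | h0
  · exact Or.inl (.base q hq h0 ha)
  · exact Or.inr (Or.inl ⟨hq, by omega, ha⟩)

theorem active_of_mem (hs : s ∈ Q.δ q) (hs' : IsSplitting h ϱ s)
    (hd : Q.dim q ≤ P.dim (h q) + 1) : IsActive h ϱ q := by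
  have h1 := H.splitting_dim_pos hs'
  have h2 := Q.dim_δ q s hs
  have h3 := H.map.dim_le q
  by_cases h4 : P.dim (h q) = Q.dim q
  · exact Or.inr (Or.inr ⟨by omega, H.map.not_mem_ker.2 h4, s, hs, hs'⟩)
  · exact Or.inl (.step q s (by omega)
      (H.cut.map_eq_arrow H.opQ.1 (faceOf_δ hs) hs'.arrow) hs hs')

/-- If the codomain of `α` is splitting, then `h` lowers the dimension of `α` by two. -/
theorem dim_map_of_splitting_γ (hs : IsSplitting h ϱ (Q.γ α)) (h0 : 0 < Q.dim α) :
    P.dim (h α) + 2 = Q.dim α ∧ h (Q.γ α) = h α := by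
  have h1 := hs.dim_map
  have h2 := Q.dim_γ α h0
  have h3 : P.dim (h α) ≠ Q.dim α := fun hd => by
    have := H.map.dim_map_γ hd; omega
  have := H.map.map_γ_of_dim_ne h3
  refine ⟨?_, this⟩
  rw [this] at h1
  omega

/-- Here `h` lowers the dimension of `α` by two, so all of `δ α` is in the kernel, which excludes
threshold faces. -/
theorem splitting_of_splitting_γ (hs : IsSplitting h ϱ (Q.γ α)) (hx : x ∈ Q.δ α)
    (hx' : IsActive h ϱ x) : IsSplitting h ϱ x := by
  refine H.splitting_of_dim_ne hx' fun hd => ?_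
  have := (H.dim_map_of_splitting_γ hs (dim_pos_of_mem_δ hx)).1
  have := H.map.dim_of_mem_δ hx hd
  omega

/-! ### Consequences of the transport property in one dimension -/

section

variable (A : ActiveTransport h ϱ j)
include A

omit H in
theorem active_up (hxy : Q.UpperLE x y) (hd : Q.dim x = j) (hx : IsActive h ϱ x) :
    IsActive h ϱ y := by
  rw [upperLE_iff_reflTransGen] at hxy
  induction hxy with
  | refl => exact hx
  | tail hs hs' ih =>
    have := (upperLE_iff_reflTransGen.2 hs).dim_eq
    obtain ⟨α, hα, rfl⟩ := hs'
    have := Q.dim_δ α _ hα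
    exact ((A α (by omega)).1 _ hα ih).1

theorem splitting_down (hxy : Q.UpperLE x y) (hd : Q.dim x = j) (hx : IsActive h ϱ x)
    (hy : IsSplitting h ϱ y) : IsSplitting h ϱ x := by
  rw [upperLE_iff_reflTransGen] at hxy
  induction hxy with
  | refl => exact hy
  | tail hs hs' ih =>
    have hle := upperLE_iff_reflTransGen.2 hs
    obtain ⟨α, hα, rfl⟩ := hs'
    exact ih (H.splitting_of_splitting_γ hy hα (active_up A hle hd hx))

theorem threshold_up (hxy : Q.UpperLE x y) (hd : Q.dim x = j) (hx : IsThreshold h ϱ x) :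
    IsThreshold h ϱ y :=
  (active_up A hxy hd (Or.inr hx)).resolve_left fun hy =>
    H.not_threshold_of_splitting (H.splitting_down A hxy hd (Or.inr hx) hy) hx

/-- If two active faces were incomparable, branching would carry them up to two distinct active
faces of a single domain. -/
theorem active_chain (hx : IsActive h ϱ x) (hy : IsActive h ϱ y) (hdx : Q.dim x = j)
    (hdy : Q.dim y = j) : Q.UpperLE x y ∨ Q.UpperLT y x := by
  by_contra hc
  rw [not_or] at hc
  obtain ⟨β, x', hx', y', hy', hne, hxx', hyy'⟩ :=
    H.opQ.exists_branching (hdx.trans hdy.symm) hc.1 hc.2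
  have := Q.dim_δ β _ hx'
  have := hxx'.dim_eq
  exact hne (((A β (by omega)).1 _ hy' (active_up A hyy' hdy hy)).2 _ hx'
    (active_up A hxx' hdx hx))

theorem splitting_lt_threshold (hx : IsSplitting h ϱ x) (hy : IsThreshold h ϱ y)
    (hdx : Q.dim x = j) (hdy : Q.dim y = j) : Q.UpperLT x y := by
  rcases H.active_chain A (Or.inr hy) (Or.inl hx) hdy hdx with hc | hc
  · exact absurd hy (H.not_threshold_of_splitting (H.splitting_down A hc hdy (Or.inr hy) hx))
  · exact hc

/-- The bridge criterion: active faces of dimension `j + 1` are those crossing from the splitting to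
the threshold part of the chain in dimension `j`. If `γ x` were splitting, `h` would lower the
dimension of `x` by two, which is too much for an active face. -/
theorem active_succ_iff (h1 : 1 ≤ j) (hd : Q.dim x = j + 1) :
    IsActive h ϱ x ↔ (∃ s ∈ Q.δ x, IsSplitting h ϱ s) ∧ IsThreshold h ϱ (Q.γ x) := by
  have hd' := Q.dim_γ x (by omega)
  constructor
  · intro hx
    obtain ⟨s, hs, hs'⟩ := hx.exists_mem (by omega)
    refine ⟨⟨s, hs, hs'⟩, ((A x hd).1 s hs (Or.inl hs')).1.resolve_left fun hγ => ?_⟩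
    have h2 := (H.dim_map_of_splitting_γ hγ (by omega)).1
    rcases hx with hx | hx
    · have := hx.dim_map; omega
    · have := H.threshold_dim hx; omega
  · rintro ⟨⟨s, hs, hs'⟩, ht⟩
    refine H.active_of_mem hs hs' ?_
    have h2 := H.threshold_dim ht
    by_cases h3 : P.dim (h x) = Q.dim x
    · omega
    · rw [H.map.map_γ_of_dim_ne h3] at h2; omega

/-- Between a splitting face in the domain of `d` and the codomain of `d`. -/
theorem exists_between_of_active {d σ : Q.Face} (hσ : σ ∈ Q.δ d)
    (hσ' : IsSplitting h ϱ σ) (hd : Q.dim σ = j) (ht : IsThreshold h ϱ t) (htd : Q.dim t = j)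
    (hlt : Q.UpperLT t (Q.γ d)) : ∃ e, Q.UpperLT e d ∧ t ∈ Q.δ e :=
  (H.opQ.1.exists_between hσ (H.splitting_lt_threshold A hσ' ht hd htd) hlt).1

end

/-- Induction on `j`. There are no active vertices; active edges are the arrows of `ϱ`, so for them
the claim is the `ι`-map condition for `ϱ`. Higher up, the bridge criterion reduces it to the chain
one dimension lower. -/
theorem transport (j : ℕ) : ActiveTransport h ϱ j := by
  induction j using Nat.strong_induction_on with
  | _ j ih =>
  rcases j with _ | _ | j
  · intro α hα
    have hno : ∀ x, Q.dim x = 0 → ¬ IsActive h ϱ x := fun x h0 hx => by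
      have := H.active_dim_pos hx; omega
    refine ⟨fun x hx hx' => absurd hx' (hno x ?_), fun hγ => absurd hγ (hno _ ?_)⟩
    · have := Q.dim_δ α x hx; omega
    · have := Q.dim_γ α (by omega); omega
  · intro α hα
    have hdγ := Q.dim_γ α (by omega)
    have hker : ∀ x ∈ Q.δ α, IsActive h ϱ x →
        intervalOpetope.dim (ϱ x) = Q.dim x ∧ ϱ x = IFace.arrow := fun x hx hx' => by
      have := Q.dim_δ α x hx
      have := H.active_arrow hx'
      refine ⟨?_, this⟩
      rw [this]
      change 1 = _
      omega
    refine ⟨fun x hx hx' => ⟨?_, fun y hy hy' => ?_⟩, fun hγ => ?_⟩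
    · rw [H.active_iff_arrow (by omega)]
      exact H.cut.γ_arrow (H.cut.map_eq_arrow H.opQ.1 (faceOf_δ hx) (hker x hx hx').2) (by omega)
    · exact H.cut.eq_of_map_eq hy (hker y hy hy').1 hx (hker x hx hx').1
        ((hker y hy hy').2.trans (hker x hx hx').2.symm)
    · have ha := H.cut.map_eq_arrow H.opQ.1 (faceOf_γ α) (H.active_arrow hγ)
      obtain ⟨x, hx, -, e⟩ := H.cut.exists_mem_δ_of_ker (α := α) (by rw [ha, hα]; rfl)
      have := Q.dim_δ α x hx
      exact ⟨x, hx, (H.active_iff_arrow (by omega)).2 (e.trans ha)⟩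
  · have A := ih (j + 1) (by omega)
    have hQ := H.opQ.1
    intro α hα
    have hdγ := Q.dim_γ α (by omega)
    have hdγγ := Q.dim_γ (Q.γ α) (by omega)
    have hdδ : ∀ x ∈ Q.δ α, Q.dim x = j + 2 := fun x hx => by
      have := Q.dim_δ α x hx; omega
    have hdδδ : ∀ x ∈ Q.δ α, ∀ s ∈ Q.δ x, Q.dim s = j + 1 := fun x hx s hs => by
      have := Q.dim_δ x s hs; have := hdδ x hx; omega
    have hiff : ∀ x ∈ Q.δ α, _ := fun x hx =>
      H.active_succ_iff A (x := x) (by omega) (hdδ x hx)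
    have hiffγ := H.active_succ_iff A (x := Q.γ α) (by omega) (by omega)
    refine ⟨fun x hx hx' => ⟨?_, ?_⟩, fun hγ => ?_⟩
    -- `γ γ α` is a threshold face because `γ x ≤ γ γ α` is one. So `δ (γ α)` has an active face
    -- `a`, to be shown splitting. This holds if `a ≤ s`, and `s < a` contradicts the antichain
    -- property, as some face of `δ (γ α)` is below `s`.
    · obtain ⟨⟨s, hs, hs'⟩, ht⟩ := (hiff x hx).1 hx'
      have hdγx := Q.dim_γ x (by rw [hdδ x hx]; omega)
      have htγ := H.threshold_up A (hQ.γ_le_γγ hx) (by rw [hdδ x hx] at hdγx; omega) ht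
      obtain ⟨a, ha, ha'⟩ := (A (Q.γ α) (by omega)).2 (Or.inr htγ)
      have hda := Q.dim_δ _ a ha
      refine hiffγ.2 ⟨⟨a, ha, ?_⟩, htγ⟩
      rcases H.active_chain A ha' (Or.inl hs') (by omega) (hdδδ x hx s hs) with hc | hc
      · exact H.splitting_down A hc (by omega) ha' hs'
      · obtain ⟨d, hd, hds⟩ := hQ.exists_le_of_mem (by omega) (Or.inl ⟨x, hx, hs⟩)
        exact absurd (hds.trans_lt hc) (hQ.δ_antichain hd ha)
    -- If `s < s'` are the splitting faces of two active `x, y ∈ δ α`, then `s < s' < γ x`, so `s'`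
    -- is in the domain of some `e < x`. Both `e` and `y` have `s'` in their domains, hence are
    -- comparable, and `δ α` being an antichain forces `x = y`.
    · have key : ∀ x ∈ Q.δ α, IsActive h ϱ x → ∀ y ∈ Q.δ α, IsActive h ϱ y →
          ∀ s ∈ Q.δ x, IsSplitting h ϱ s → ∀ s' ∈ Q.δ y, IsSplitting h ϱ s' →
          Q.UpperLE s s' → x = y := by
        intro x hx hx' y hy hy' s hs hs' r hr hr' hle
        rcases hle with rfl | hlt
        · exact hQ.eq_of_mem_δδ hx hy hs hr
        have ht := ((hiff x hx).1 hx').2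
        have hdγx : Q.dim (Q.γ x) = j + 1 := by
          rw [dim_γ_eq_of_mem_δ hs]; exact hdδδ x hx s hs
        rcases H.active_chain A (Or.inr ht) (Or.inl hr') hdγx (hdδδ y hy r hr) with hc | hc
        · exact absurd ht (H.not_threshold_of_splitting
            (H.splitting_down A hc hdγx (Or.inr ht) hr'))
        · obtain ⟨e, he, hre⟩ := (hQ.exists_between hs hlt hc).1
          by_cases hey : e = y
          · subst hey; exact absurd he (hQ.δ_antichain hy hx)
          rcases hQ.pencil_δ e y r hre hr hey with h1 | h1
          · exact hQ.δ_eq_of_common hx hy he.le h1.le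
          · exact absurd (h1.trans he) (hQ.δ_antichain hy hx)
      intro y hy hy'
      obtain ⟨⟨s, hs, hs'⟩, -⟩ := (hiff x hx).1 hx'
      obtain ⟨⟨r, hr, hr'⟩, -⟩ := (hiff y hy).1 hy'
      rcases H.active_chain A (Or.inl hs') (Or.inl hr') (hdδδ x hx s hs) (hdδδ y hy r hr)
        with hc | hc
      · exact (key x hx hx' y hy hy' s hs hs' r hr hr' hc).symm
      · exact key y hy hy' x hx hx' r hr hr' s hs hs' hc.le
    · obtain ⟨⟨s, hs, hs'⟩, ht⟩ := hiffγ.1 hγ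
      -- Climb from `s` to `γ x` as long as `γ x` is splitting. The climb cannot reach `γ γ α`, a
      -- threshold face, so some `γ x` is a threshold face, and that `x` is a bridge.
      have key : ∀ s, IsSplitting h ϱ s → (∃ x ∈ Q.δ α, s ∈ Q.δ x) →
          ∃ x ∈ Q.δ α, IsActive h ϱ x := by
        intro s
        induction s using hQ.wf_gt.induction with
        | _ s ihs =>
          rintro hs' ⟨x, hx, hs⟩
          rcases ((A x (hdδ x hx)).1 s hs (Or.inl hs')).1 with hγx | hγx
          · rcases hQ.γ_cases hx (dim_pos_of_mem_δ hs) with e | hb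
            · rw [e] at hγx
              exact absurd ht (H.not_threshold_of_splitting hγx)
            · exact ihs _ (upperLT_of_mem hs) hγx hb
          · exact ⟨x, hx, (hiff x hx).2 ⟨⟨s, hs, hs'⟩, hγx⟩⟩
      exact key s hs' ((hQ.mem_δγ_iff (by omega)).1 hs).1

/-! ### Active faces -/

theorem active_le (hxy : Q.UpperLE x y) (hx : IsActive h ϱ x) : IsActive h ϱ y :=
  active_up (H.transport _) hxy rfl hx

theorem active_comparable (hx : IsActive h ϱ x) (hy : IsActive h ϱ y) (hd : Q.dim x = Q.dim y) :
    Q.UpperLE x y ∨ Q.UpperLT y x :=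
  H.active_chain (H.transport _) hx hy rfl hd.symm

theorem active_γ (hx : x ∈ Q.δ α) (hx' : IsActive h ϱ x) : IsActive h ϱ (Q.γ α) :=
  H.active_le (upperLT_of_mem hx).le hx'

theorem exists_active (hα : IsActive h ϱ (Q.γ α)) (h0 : 0 < Q.dim α) :
    ∃ x ∈ Q.δ α, IsActive h ϱ x :=
  (H.transport (Q.dim α - 1) α (by omega)).2 hα

theorem active_unique (hx : x ∈ Q.δ α) (hx' : IsActive h ϱ x) (hy : y ∈ Q.δ α)
    (hy' : IsActive h ϱ y) : x = y :=
  ((H.transport (Q.dim y) α (Q.dim_δ α y hy).symm).1 y hy hy').2 x hx hx'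

theorem threshold_γ (hx : IsActive h ϱ x) (hd : 2 ≤ Q.dim x) : IsThreshold h ϱ (Q.γ x) :=
  ((H.active_succ_iff (H.transport (Q.dim x - 1)) (by omega) (by omega)).1 hx).2

/-- Along the chain, a step `α` between splitting faces drops by two dimensions under `h`, so `h α`
has the dimension of the image of its splitting face. One is a face of the other, hence they agree.
-/
theorem map_splitting_eq (hx : IsSplitting h ϱ x) (hy : IsSplitting h ϱ y)
    (hd : Q.dim x = Q.dim y) : h x = h y := by
  have key : ∀ x y, Q.UpperLE x y → IsSplitting h ϱ x → IsSplitting h ϱ y → h x = h y := by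
    intro x y hxy hx hy
    rw [upperLE_iff_reflTransGen] at hxy
    induction hxy with
    | refl => rfl
    | tail hs hs' ih =>
      have hle := upperLE_iff_reflTransGen.2 hs
      obtain ⟨α, hα, rfl⟩ := hs'
      have hb := H.splitting_of_splitting_γ hy hα (H.active_le hle (Or.inl hx))
      rw [ih hb]
      obtain ⟨h1, h2⟩ := H.dim_map_of_splitting_γ hy (dim_pos_of_mem_δ hα)
      rw [h2]
      have := hb.dim_map
      have := Q.dim_δ α _ hα
      exact (H.map.map_faceOf H.opQ.1 (faceOf_δ hα)).eq_of_dim_le (by omega)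
  rcases H.active_comparable (Or.inl hx) (Or.inl hy) hd with hc | hc
  · exact key x y hc hx hy
  · exact (key y x hc.le hy hx).symm

/-- Below the images of splitting faces there is a least threshold face. -/
theorem exists_least_threshold (hs : IsSplitting h ϱ s) (hd : 2 ≤ Q.dim s) :
    ∃ θ, IsThreshold h ϱ θ ∧ Q.dim θ + 1 = Q.dim s ∧ h θ = h s ∧
      ∀ t, IsThreshold h ϱ t → Q.dim t = Q.dim θ → Q.UpperLE θ t := by
  -- The least threshold face is the codomain of a minimal splitting face `l` one dimension higher.
  obtain ⟨l, ⟨hl, hld⟩, hmin⟩ := H.opQ.1.wf_lt.has_min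
    {l | IsSplitting h ϱ l ∧ Q.dim l = Q.dim s} ⟨s, hs, rfl⟩
  have hd1 := Q.dim_γ l (by omega)
  have hd2 := hl.dim_map
  refine ⟨Q.γ l, H.threshold_γ (Or.inl hl) (by omega), by omega, ?_, fun t ht htd => ?_⟩
  · rw [H.map.map_γ_of_dim_ne (by omega), H.map_splitting_eq hl hs hld]
  · rcases H.active_comparable (Or.inr (H.threshold_γ (Or.inl hl) (by omega))) (Or.inr ht)
      htd.symm with hc | hc
    · exact hc
    · exfalso
      obtain ⟨σ, hσ, hσ'⟩ := hl.exists_mem (by omega)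
      have hd3 := Q.dim_δ l σ hσ
      -- A threshold face below `γ l` yields a face `e < l`. The last step of that chain has
      -- codomain `l`, so by transport its domain contains a splitting face, which is smaller than
      -- `l`.
      obtain ⟨e, he, -⟩ := H.exists_between_of_active (H.transport (Q.dim σ)) hσ hσ' rfl ht
        (by omega) hc
      obtain ⟨β, a, -, ha, rfl⟩ := he.exists_tail
      obtain ⟨b, hb, hb'⟩ := H.exists_active (Or.inl hl) (dim_pos_of_mem_δ ha)
      refine hmin b ⟨H.splitting_of_splitting_γ hl hb hb', ?_⟩ (upperLT_of_mem hb)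
      rw [← hld, ← dim_γ_eq_of_mem_δ hb]

end IsCylPair

end Active

/-! ### The iterated domains `D_j(p)`. -/

section Level

open CylFace

variable {S : PosHypergraph.{u}} {p q t : S.Face} {j : ℕ}

theorem dim_of_mem_domLevel (h : t ∈ domLevel j q) : S.dim t = j := by
  rcases h with ⟨hj, ht⟩ | ⟨rfl, rfl⟩
  · have := S.dim_δ _ t ht
    rw [dim_γIter (by omega)] at this
    omega
  · rfl

theorem le_dim_of_mem_domLevel (h : t ∈ domLevel j q) : j ≤ S.dim q := by
  rcases h with h | h
  · exact h.1.le
  · exact h.1.le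

theorem mem_domLevel_iff (h : j < S.dim q) :
    t ∈ domLevel j q ↔ t ∈ S.δ (S.γIter (j + 1) q) := by
  constructor
  · rintro (h' | h')
    · exact h'.2
    · omega
  · exact fun ht => Or.inl ⟨h, ht⟩

theorem mem_domLevel_dim_iff : t ∈ domLevel (S.dim q) q ↔ t = q := by
  constructor
  · rintro (h' | h')
    · omega
    · exact h'.2
  · exact fun ht => Or.inr ⟨rfl, ht⟩

theorem mem_domLevel_self (q : S.Face) : q ∈ domLevel (S.dim q) q := mem_domLevel_dim_iff.2 rfl

theorem faceOf_of_mem_domLevel (h : t ∈ domLevel j q) : S.FaceOf t q := by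
  rcases h with h | ⟨-, rfl⟩
  · exact (faceOf_δ h.2).trans (faceOf_γIter _ _)
  · exact .refl _

theorem le_γIter_of_mem_domLevel (h : t ∈ domLevel j q) : S.UpperLE t (S.γIter j q) := by
  rcases h with ⟨hj, h⟩ | ⟨rfl, rfl⟩
  · rw [← γ_γIter hj]; exact (upperLT_of_mem h).le
  · rw [γIter_of_le le_rfl]; exact .refl _

theorem PosHypergraph.IsOpetopicCardinal.domLevel_eq_of_common (hS : S.IsOpetopicCardinal)
    {a b c : S.Face} (ha : a ∈ domLevel j q) (hb : b ∈ domLevel j q) (hca : S.UpperLE c a)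
    (hcb : S.UpperLE c b) : a = b := by
  rcases ha with ⟨hj, ha⟩ | ⟨rfl, rfl⟩
  · exact hS.δ_eq_of_common ha ((mem_domLevel_iff hj).1 hb) hca hcb
  · exact (mem_domLevel_dim_iff.1 hb).symm

end Level

/-! ### The level of a face and the sequence of splitting images. -/

namespace IsCylPair

open CylFace

variable {Q : PosHypergraph.{v}} {P : PosHypergraph.{u}}
  {h : Q.Face → P.Face} {ϱ : Q.Face → intervalOpetope.Face}

/-- `t` is the threshold face of highest dimension in the iterated domains of `q`. -/
structure _root_.IsLevel (h : Q.Face → P.Face) (ϱ : Q.Face → intervalOpetope.Face)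
    (q t : Q.Face) : Prop where
  mem : t ∈ domLevel (Q.dim t) q
  thr : IsThreshold h ϱ t
  max : ∀ i, Q.dim t < i → i ≤ Q.dim q → ¬ IsActive h ϱ (Q.γIter i q)

/-- The sequence of images of the splitting faces. -/
noncomputable def _root_.splitSeq (h : Q.Face → P.Face) (ϱ : Q.Face → intervalOpetope.Face) :
    FaceSeq P := fun i => by
  classical
  exact if hs : ∃ s, Q.dim s = i + 1 ∧ IsSplitting h ϱ s then some (h hs.choose) else none

variable (H : IsCylPair h ϱ) {x y q r s t t' α : Q.Face} {a b : P.Face} {i j : ℕ}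
include H

theorem splitSeq_eq (hs : IsSplitting h ϱ s) (hd : Q.dim s = i + 1) :
    splitSeq h ϱ i = some (h s) := by
  have hex : ∃ s, Q.dim s = i + 1 ∧ IsSplitting h ϱ s := ⟨s, hd, hs⟩
  rw [splitSeq, dif_pos hex, H.map_splitting_eq hex.choose_spec.2 hs
    (hex.choose_spec.1.trans hd.symm)]

omit H in
theorem exists_of_splitSeq (ha : splitSeq h ϱ i = some a) :
    ∃ s, IsSplitting h ϱ s ∧ Q.dim s = i + 1 ∧ h s = a := by
  rw [splitSeq] at ha
  split_ifs at ha with hs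
  exact ⟨_, hs.choose_spec.2, hs.choose_spec.1, Option.some.inj ha⟩

omit H in
theorem exists_splitting_face (hs : IsSplitting h ϱ s) (h1 : 1 ≤ i) (hd : i ≤ Q.dim s) :
    ∃ t, IsSplitting h ϱ t ∧ Q.dim t = i ∧ Q.FaceOf t s := by
  induction hn : Q.dim s - i generalizing s with
  | zero => exact ⟨s, hs, by omega, .refl _⟩
  | succ n ih =>
    obtain ⟨s', hm, hs'⟩ := hs.exists_mem (by omega)
    have := Q.dim_δ s s' hm
    obtain ⟨t, ht, htd, htf⟩ := ih hs' (by omega) (by omega)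
    exact ⟨t, ht, htd, htf.trans (faceOf_δ hm)⟩

theorem splitSeq_boundary (hs : IsSplitting h ϱ s) (hd : Q.dim s = i + 2) :
    ∃ a, splitSeq h ϱ i = some a ∧ a ∈ P.boundary (h s) := by
  obtain ⟨s', hm, hs'⟩ := hs.exists_mem (by omega)
  have := Q.dim_δ s s' hm
  have := hs.dim_map
  have := hs'.dim_map
  exact ⟨h s', H.splitSeq_eq hs' (by omega),
    (H.map.map_faceOf H.opQ.1 (faceOf_δ hm)).mem_boundary (by omega)⟩

theorem map_mem_domLevel (ht : t ∈ domLevel j q) (hd : P.dim (h t) = Q.dim t)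
    (hq : P.dim (h q) = Q.dim q) : h t ∈ domLevel j (h q) := by
  rcases ht with ⟨hj, ht⟩ | ⟨hj, rfl⟩
  · refine Or.inl ⟨by omega, ?_⟩
    obtain ⟨h1, h2⟩ := H.map.map_γIter (j + 1) hq
    rw [← h1]
    exact H.map.map_mem_δ ht hd h2
  · exact Or.inr ⟨by omega, rfl⟩

theorem active_γIter_of_mem (ht : t ∈ domLevel j q) (ha : IsActive h ϱ t) :
    IsActive h ϱ (Q.γIter j q) := H.active_le (le_γIter_of_mem_domLevel ht) ha

theorem exists_mem_domLevel (hj : j ≤ Q.dim q) (ha : IsActive h ϱ (Q.γIter j q)) :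
    ∃ t ∈ domLevel j q, IsActive h ϱ t := by
  rcases hj.lt_or_eq with hj | rfl
  · rw [← γ_γIter hj] at ha
    obtain ⟨t, ht, ht'⟩ := H.exists_active ha (by rw [dim_γIter (by omega)]; omega)
    exact ⟨t, (mem_domLevel_iff hj).2 ht, ht'⟩
  · rw [γIter_of_le le_rfl] at ha
    exact ⟨q, mem_domLevel_self q, ha⟩

/-- The active face of `D_j(q)` at the highest active level is not splitting: otherwise `γ^(j+1) q`
would be active, or `q` itself would be collapsed. -/
theorem isLevel_of_active (hq : P.dim (h q) = Q.dim q) (hj : j ≤ Q.dim q)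
    (ha : IsActive h ϱ (Q.γIter j q))
    (hmax : ∀ i, j < i → i ≤ Q.dim q → ¬ IsActive h ϱ (Q.γIter i q)) :
    ∃ t, IsLevel h ϱ q t ∧ Q.dim t = j := by
  obtain ⟨t, ht, hta⟩ := H.exists_mem_domLevel hj ha
  have hd := dim_of_mem_domLevel ht
  refine ⟨t, ⟨hd ▸ ht, hta.resolve_left fun hs => ?_, hd ▸ hmax⟩, hd⟩
  have hdm := hs.dim_map
  rcases ht with ⟨hj', ht⟩ | ⟨-, rfl⟩
  · have h1 := (H.map.map_γIter (j + 1) hq).2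
    have h2 := Q.dim_δ _ t ht
    exact hmax (j + 1) (by omega) hj' (H.active_of_mem ht hs (by omega))
  · omega

theorem exists_isLevel (hq : P.dim (h q) = Q.dim q) (ha : ϱ q = IFace.arrow) :
    ∃ t, IsLevel h ϱ q t := by
  classical
  have h0 := H.cut.dim_pos_of_arrow ha
  have h1 : IsActive h ϱ (Q.γIter 1 q) :=
    (H.active_iff_arrow (dim_γIter h0)).2 (H.cut.γIter_arrow ha le_rfl)
  have hg := Nat.findGreatest_spec (P := fun j => IsActive h ϱ (Q.γIter j q)) h0 h1
  obtain ⟨t, ht, -⟩ := H.isLevel_of_active hq (Nat.findGreatest_le _) hg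
    fun i hi hi' => Nat.findGreatest_is_greatest hi hi'
  exact ⟨t, ht⟩

theorem isLevel_dim_pos (ht : IsLevel h ϱ q t) : 1 ≤ Q.dim t := H.active_dim_pos (Or.inr ht.thr)

theorem isLevel_active (ht : IsLevel h ϱ q t) : IsActive h ϱ (Q.γIter (Q.dim t) q) :=
  H.active_γIter_of_mem ht.mem (Or.inr ht.thr)

theorem isLevel_unique (ht : IsLevel h ϱ q t) (ht' : IsLevel h ϱ q t') : t = t' := by
  have key : ∀ t t', IsLevel h ϱ q t → IsLevel h ϱ q t' → Q.dim t' ≤ Q.dim t :=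
    fun t t' ht ht' => not_lt.1 fun hlt =>
      ht.max _ hlt (le_dim_of_mem_domLevel ht'.mem) (H.isLevel_active ht')
  have hd := le_antisymm (key _ _ ht' ht) (key _ _ ht ht')
  have h1 := ht.mem
  have h2 := ht'.mem
  rw [← hd] at h2
  rcases h1 with ⟨hj, h1⟩ | ⟨hj, h1⟩
  · exact H.active_unique h1 (Or.inr ht.thr) ((mem_domLevel_iff hj).1 h2) (Or.inr ht'.thr)
  · rw [hj] at h2
    rw [h1, mem_domLevel_dim_iff.1 h2]

omit H in
theorem isLevel_self (ht : IsThreshold h ϱ t) : IsLevel h ϱ t t :=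
  ⟨mem_domLevel_self t, ht, fun i hi hi' => by omega⟩

omit H in
theorem isLevel_of_threshold_mem (ht : IsThreshold h ϱ t) (htq : t ∈ Q.δ q)
    (hq : ¬ IsActive h ϱ q) : IsLevel h ϱ q t := by
  have hd := Q.dim_δ q t htq
  refine ⟨(mem_domLevel_iff (by omega)).2 (by rwa [γIter_of_le (by omega)]), ht, ?_⟩
  intro i hi hi'
  rwa [γIter_of_le (by omega)]

/-- The level of a face is that of its codomain, unless the codomain is active. -/
theorem isLevel_γ (hγ : ¬ IsActive h ϱ (Q.γ q)) (hq : ¬ IsActive h ϱ q) (h0 : 0 < Q.dim q)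
    (ht : IsLevel h ϱ q t) : IsLevel h ϱ (Q.γ q) t := by
  have hd := Q.dim_γ q h0
  have h1 := H.isLevel_active ht
  have h2 := le_dim_of_mem_domLevel ht.mem
  have h3 : Q.dim t < Q.dim (Q.γ q) := by
    by_contra hc
    rcases (show Q.dim t = Q.dim q ∨ Q.dim t = Q.dim q - 1 by omega) with e | e
    · rw [e, γIter_of_le le_rfl] at h1; exact hq h1
    · rw [e, γIter_pred h0] at h1; exact hγ h1
  refine ⟨(mem_domLevel_iff h3).2 ?_, ht.thr, fun i hi hi' => ?_⟩
  · rw [γIter_γ (by omega)]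
    exact (mem_domLevel_iff (by omega)).1 ht.mem
  · rw [γIter_γ (by omega)]
    exact ht.max i hi (by omega)

/-! ### Markers -/

/-- The face of dimension `i` that decides whether the star operation stops at level `i`, for the
p-flag given by the level `t`. -/
def _root_.IsMarker (h : Q.Face → P.Face) (ϱ : Q.Face → intervalOpetope.Face) (t : Q.Face)
    (i : ℕ) (a : P.Face) : Prop :=
  (i = Q.dim t ∧ a = h t) ∨ (i + 1 = Q.dim t ∧ a = P.γ (h t)) ∨
    (i + 1 < Q.dim t ∧ splitSeq h ϱ i = some a)

/-- Represents an entry of a p-flag by a threshold face of `Q`: the level `t`, its codomain, or the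
least threshold face of dimension `i`. Comparisons in `P` can then be moved to `Q`. -/
theorem exists_marker_face (ht : IsThreshold h ϱ t) (hi : 1 ≤ i) (ha : IsMarker h ϱ t i a) :
    ∃ θ, IsThreshold h ϱ θ ∧ Q.dim θ = i ∧ h θ = a ∧ ((θ = t ∧ i = Q.dim t) ∨
      (θ = Q.γ t ∧ i + 1 = Q.dim t) ∨
      (i + 1 < Q.dim t ∧ ∀ t, IsThreshold h ϱ t → Q.dim t = i → Q.UpperLE θ t)) := by
  rcases ha with ⟨hd, rfl⟩ | ⟨hd, rfl⟩ | ⟨hd, ha⟩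
  · exact ⟨t, ht, hd.symm, rfl, Or.inl ⟨rfl, hd⟩⟩
  · have := Q.dim_γ t (by omega)
    exact ⟨Q.γ t, H.threshold_γ (Or.inr ht) (by omega), by omega,
      H.map.map_γ_of_dim_eq (H.threshold_dim ht), Or.inr (Or.inl ⟨rfl, hd⟩)⟩
  · obtain ⟨s, hs, hsd, rfl⟩ := exists_of_splitSeq ha
    obtain ⟨θ, h1, h2, h3, h4⟩ := H.exists_least_threshold hs (by omega)
    exact ⟨θ, h1, by omega, h3, Or.inr (Or.inr ⟨hd, fun t ht htd => h4 t ht (by omega)⟩)⟩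

theorem dim_level_le (ht : IsLevel h ϱ q t) (hr : r ∈ Q.boundary q) (ht' : IsLevel h ϱ r t') :
    Q.dim t' ≤ Q.dim t := by
  by_contra hc
  have h1 := le_dim_of_mem_domLevel ht'.mem
  have h2 := dim_of_mem_boundary hr
  refine ht.max (Q.dim t') (by omega) (by omega) ?_
  have h3 := H.opQ.1.faceOf_le_γIter ((faceOf_γIter (Q.dim t') r).trans (faceOf_of_mem_boundary hr))
  rw [dim_γIter h1] at h3
  exact H.active_le h3 (H.isLevel_active ht')

/-- The star operation stops at the level of a face of the boundary. -/
theorem marker_le (ht : IsLevel h ϱ q t) (hr : r ∈ Q.boundary q) (ht' : IsLevel h ϱ r t')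
    (ha : IsMarker h ϱ t (Q.dim t') a) : P.UpperLE a (h t') := by
  have hQ := H.opQ.1
  have hi := H.isLevel_dim_pos ht'
  obtain ⟨θ, hθ, hθd, rfl, hc⟩ := H.exists_marker_face ht.thr hi ha
  have hrd := dim_of_mem_boundary hr
  have hdr := le_dim_of_mem_domLevel ht'.mem
  refine (H.map.map_le ?_ (H.threshold_dim hθ)).1
  refine (H.active_comparable (Or.inr hθ) (Or.inr ht'.thr) hθd).resolve_right fun hlt => ?_
  have hf := (faceOf_of_mem_domLevel ht'.mem).trans (faceOf_of_mem_boundary hr)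
  have hm := ht.mem
  rcases hc with ⟨rfl, hd⟩ | ⟨rfl, hd⟩ | ⟨-, hmin⟩
  -- With `θ = t`, a face `d` of the iterated domain containing `t` would satisfy `d ≤ t' < t`.
  · obtain ⟨d, hd1, hd2⟩ := hQ.faceOf_exists_le hf (by omega)
    rw [mem_domLevel_iff (by omega), ← hd] at hm
    exact hQ.δ_antichain hd1 hm (hd2.trans_lt hlt)
  -- With `θ = γ t`, the face `t'` lies strictly between `σ` and `γ t`, hence in the domain of some
  -- `e < t`. Unless `t = q`, compare `e` with the iterated codomain `g` of `r` whose domain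
  -- contains `t'`: the outcome violates the antichain property or makes `g` active.
  · obtain ⟨σ, hσ, hσ'⟩ := ht.thr.exists_mem (by omega)
    have hσd := Q.dim_δ _ σ hσ
    obtain ⟨e, he, hte⟩ := H.exists_between_of_active (H.transport _) hσ hσ' rfl ht'.thr
      (by omega) hlt
    by_cases hdq : Q.dim t = Q.dim q
    · rw [hdq, mem_domLevel_dim_iff] at hm
      subst hm
      have hm' := ht'.mem
      rw [show Q.dim t' = Q.dim r by omega, mem_domLevel_dim_iff] at hm'
      subst hm'
      obtain ⟨-, rfl | hr⟩ := hr
      · exact hQ.strictness _ hlt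
      · exact hQ.δ_antichain hσ hr
          (H.splitting_lt_threshold (H.transport _) hσ' ht'.thr rfl (by omega))
    · have hdt := le_dim_of_mem_domLevel hm
      rw [mem_domLevel_iff (by omega), ← hd] at hm
      have hg := ht'.mem
      rw [mem_domLevel_iff (by omega)] at hg
      have hgd : Q.dim (Q.γIter (Q.dim t' + 1) r) = Q.dim t' + 1 := dim_γIter (by omega)
      have hga := ht'.max (Q.dim t' + 1) (by omega) (by omega)
      have hgf := (faceOf_γIter (Q.dim t' + 1) r).trans (faceOf_of_mem_boundary hr)
      obtain ⟨d, hd1, hd2⟩ := hQ.faceOf_exists_le hgf (by omega)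
      rw [hgd] at hd1
      generalize Q.γIter (Q.dim t' + 1) r = g at *
      have hge : Q.UpperLE g e ∨ Q.UpperLT e g := by
        by_cases e' : g = e
        · exact Or.inl (Or.inl e')
        · exact (hQ.pencil_δ g e _ hg hte e').imp UpperLT.le id
      rcases hge with hge | hge
      · exact hQ.δ_antichain hd1 hm ((hd2.trans hge).trans_lt he)
      · rcases hQ.upset_linear he.le hge.le with h1 | h1
        · exact hga (H.active_le h1 (Or.inr ht.thr))
        · exact hQ.δ_antichain hd1 hm (hd2.trans_lt h1)
  · exact hQ.strictness _ (hlt.trans_le (hmin t' ht'.thr rfl))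

/-- The star operation does not stop at levels where no iterated codomain is active. -/
theorem not_marker_le (ht : IsLevel h ϱ q t) (hq : P.dim (h q) = Q.dim q)
    (hr : r ∈ Q.boundary q) (hrd : P.dim (h r) = Q.dim r) (hi : 1 ≤ i)
    (hna : ¬ IsActive h ϱ (Q.γIter i r)) (ha : IsMarker h ϱ t i a)
    (hb : b ∈ domLevel i (h r)) : ¬ P.UpperLE a b := by
  intro hab
  have hQ := H.opQ.1
  have hP := H.opP
  obtain ⟨θ, hθ, hθd, rfl, hc⟩ := H.exists_marker_face ht.thr hi ha
  have hrq := dim_of_mem_boundary hr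
  rcases hb with ⟨hj, hb⟩ | ⟨hj, rfl⟩
  · obtain ⟨h1, h2⟩ := H.map.map_γIter (i + 1) hrd
    rw [← h1] at hb
    have hgd : Q.dim (Q.γIter (i + 1) r) = i + 1 := dim_γIter (by omega)
    rw [← γ_γIter (by omega)] at hna
    generalize Q.γIter (i + 1) r = g at *
    obtain ⟨u, hu, hud, rfl⟩ := H.map.exists_mem_δ (by omega) h2 hb
    -- The order reflects to `θ ≤ u`, which activates `γ g`, or else `u < θ` have one image. Then
    -- `θ` and `γ g`, both above `u`, are comparable. If `γ g ≤ θ`, then `h u` would be at least the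
    -- codomain of `h g`, although `h u` is in its domain; if `θ < γ g`, then `γ g` is again active.
    rcases H.map.reflect_le H.opQ hP (H.threshold_dim hθ) hud hab with hle | ⟨hlt, he⟩
    · exact hna (H.active_γ hu (H.active_le hle (Or.inr hθ)))
    · rcases hQ.upset_linear (upperLT_of_mem hu).le hlt.le with hc | hc
      · have h3 := (H.map.map_le hc (H.map.dim_map_γ h2)).1
        rw [he, H.map.map_γ_of_dim_eq h2] at h3
        exact hP.not_lt_of_le h3 (upperLT_of_mem hb)
      · exact hna (H.active_le hc.le (Or.inr hθ))
  · rw [γIter_of_le (by omega)] at hna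
    rcases H.map.reflect_le H.opQ hP (H.threshold_dim hθ) hrd hab with hle | ⟨hlt, he⟩
    · exact hna (H.active_le hle (Or.inr hθ))
    · have hm := ht.mem
      rcases hc with ⟨rfl, hd⟩ | ⟨rfl, hd⟩ | ⟨hd, -⟩
      · rw [mem_domLevel_iff (by omega), γIter_of_le (by omega)] at hm
        obtain ⟨-, rfl | hr⟩ := hr
        · exact hQ.strictness _ (hlt.trans (upperLT_of_mem hm))
        · exact hQ.δ_antichain hr hm hlt
      · rw [show Q.dim t = Q.dim q by omega, mem_domLevel_dim_iff] at hm
        subst hm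
        obtain ⟨-, rfl | hr⟩ := hr
        · exact hQ.strictness _ hlt
        · have := upperLT_of_mem (H.map.map_mem_δ hr hrd hq)
          rw [← H.map.map_γ_of_dim_eq hq, he] at this
          exact hP.strictness _ this
      · have := le_dim_of_mem_domLevel hm
        omega

/-! ### Sides of the cut -/

theorem map_γIter_zero (hr : P.dim (h r) = Q.dim r) :
    h (Q.γIter 0 r) = P.γIter 0 (h r) := (H.map.map_γIter 0 hr).1

theorem dim_map_zero (hx : Q.dim x = 0) : P.dim (h x) = Q.dim x := by
  have := H.map.dim_le x; omega

/-- A vertex strictly between would be the codomain of an edge `e < t`. As `e` and `γ^(1) r` share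
this codomain they are comparable, which contradicts monotonicity of `γ` or the antichain containing
`t`. -/
theorem not_between (ht : IsLevel h ϱ q t) (hr : r ∈ Q.boundary q) (h1 : Q.dim t = 1)
    (hs : s ∈ Q.δ t) (hlt : Q.UpperLT s (Q.γIter 0 r)) :
    ¬ Q.UpperLT (Q.γIter 0 r) (Q.γ t) := by
  intro hlt'
  have hQ := H.opQ.1
  have hrq := dim_of_mem_boundary hr
  have hm := ht.mem
  by_cases hdq : Q.dim q = 1
  · rw [show Q.dim t = Q.dim q by omega, mem_domLevel_dim_iff] at hm
    subst hm
    rw [γIter_of_le (by omega)] at hlt hlt'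
    obtain ⟨-, rfl | hr⟩ := hr
    · exact hQ.strictness _ hlt'
    · exact hQ.δ_antichain hs hr hlt
  · obtain ⟨-, e, he, hγe, h0e⟩ := hQ.exists_between hs hlt hlt'
    rw [mem_domLevel_iff (by omega), h1] at hm
    have hgd : Q.dim (Q.γIter 1 r) = 1 := dim_γIter (by omega)
    have hgf := (faceOf_γIter 1 r).trans (faceOf_of_mem_boundary hr)
    rw [← γ_γIter (by omega)] at hγe hlt'
    obtain ⟨d, hd1, hd2⟩ := hQ.faceOf_exists_le hgf (by omega)
    rw [hgd] at hd1
    change Q.γ e = Q.γ (Q.γIter 1 r) at hγe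
    change Q.UpperLT (Q.γ (Q.γIter 1 r)) _ at hlt'
    generalize Q.γIter 1 r = g at *
    have hge : Q.UpperLE g e ∨ Q.UpperLT e g := by
      by_cases e' : g = e
      · exact Or.inl (Or.inl e')
      · exact (hQ.pencil_γ g e (by omega) h0e hγe.symm e').imp UpperLT.le id
    rcases hge with hge | hge
    · exact hQ.δ_antichain hd1 hm ((hd2.trans hge).trans_lt he)
    · rcases hQ.upset_linear he.le hge.le with h2 | h2
      · exact hQ.not_lt_of_le (hQ.γ_mono h2) hlt'
      · exact hQ.δ_antichain hd1 hm (hd2.trans_lt h2)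

omit H in
theorem dim_γIter_zero (r : Q.Face) : Q.dim (Q.γIter 0 r) = 0 := dim_γIter (Nat.zero_le _)

/-- Vertices before the cut, compared with a splitting edge. -/
theorem map_le_of_neg (hs : IsSplitting h ϱ s) (hd : Q.dim s = 1) (hx : Q.dim x = 0)
    (hxn : ϱ x = IFace.neg) : P.UpperLE (h x) (h s) := by
  have hγ := Q.dim_γ s (by omega)
  have hlt := H.cut.lt_of_neg_pos H.opQ.1 hx (by omega) hxn (H.cut.γ_pos hs.arrow hd)
  have := hs.dim_map
  have h1 := (H.map.map_le hlt.le (H.dim_map_zero hx)).1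
  rwa [H.map.map_γ_of_dim_ne (by omega)] at h1

theorem map_le_of_pos (hs : IsSplitting h ϱ s) (hd : Q.dim s = 1) (hx : Q.dim x = 0)
    (hxp : ϱ x = IFace.pos) : P.UpperLE (h s) (h x) := by
  obtain ⟨σ, hσ⟩ := Q.δ_nonempty s (by omega)
  have hσd := Q.dim_δ s σ hσ
  have hlt := H.cut.lt_of_neg_pos H.opQ.1 (by omega) hx (H.cut.δ_neg hs.arrow hd hσ) hxp
  have := hs.dim_map
  have h1 := (H.map.map_le hlt.le (H.dim_map_zero (by omega))).1
  rwa [H.map.map_eq_of_mem_δ hσ (H.dim_map_zero (by omega)) (by omega)] at h1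

/-- The edge `γ^(1) r` is uncollapsed and the image of its source is already at least `h s`, so its
target is strictly above. Strictness matters because the star operation chooses the sign `-` when
equality holds. -/
theorem map_lt_of_pos (hs : IsSplitting h ϱ s) (hd : Q.dim s = 1)
    (hr : P.dim (h r) = Q.dim r) (h1 : 1 ≤ Q.dim r) (hrp : ϱ r = IFace.pos) :
    P.UpperLT (h s) (P.γIter 0 (h r)) := by
  have h2 := H.map.map_γIter 1 hr
  have h3 : Q.dim (Q.γIter 1 r) = 1 := dim_γIter h1
  obtain ⟨d, hd'⟩ := Q.δ_nonempty (Q.γIter 1 r) (by omega)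
  have h4 := Q.dim_δ _ d hd'
  have h5 := H.map.map_mem_δ hd' (H.dim_map_zero (by omega)) h2.2
  have h6 := upperLT_of_mem h5
  rw [h2.1, γ_γIter (by omega)] at h6
  exact (H.map_le_of_pos hs hd (by omega) (H.cut.map_eq_pos H.opQ.1
    ((faceOf_δ hd').trans (faceOf_γIter _ _)) hrp)).trans_lt h6

theorem flat_neg (ht : IsLevel h ϱ q t) (hr : r ∈ Q.boundary q) (hrd : P.dim (h r) = Q.dim r)
    (h1 : Q.dim t = 1) (hrn : ϱ r = IFace.neg) :
    P.UpperLT (P.γIter 0 (h r)) (P.γ (h t)) := by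
  have htd := H.threshold_dim ht.thr
  have hta := H.active_arrow (Or.inr ht.thr)
  obtain ⟨σ, hσ⟩ := Q.δ_nonempty t (by omega)
  have hσd := Q.dim_δ t σ hσ
  have hγd := Q.dim_γ t (by omega)
  have hrn' := H.cut.map_eq_neg H.opQ.1 (faceOf_γIter 0 r) hrn
  have hv := dim_γIter_zero r
  have h2 := H.cut.lt_of_neg_pos H.opQ.1 hv (by omega) hrn' (H.cut.γ_pos hta h1)
  have h3 : Q.UpperLE (Q.γIter 0 r) σ := by
    by_cases e : Q.γIter 0 r = σ
    · exact Or.inl e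
    · exact Or.inr ((H.opQ.1.linear_zero _ σ hv (by omega) e).resolve_right
        fun hlt => H.not_between ht hr h1 hσ hlt h2)
  have h4 := (H.map.map_le h3 (H.dim_map_zero hv)).1
  rw [H.map_γIter_zero hrd] at h4
  exact h4.trans_lt (upperLT_of_mem (H.map.map_mem_δ hσ (H.dim_map_zero (by omega)) htd))

theorem flat_pos (ht : IsLevel h ϱ q t) (hr : r ∈ Q.boundary q) (hrd : P.dim (h r) = Q.dim r)
    (h1 : Q.dim t = 1) (hrp : ϱ r = IFace.pos) :
    ¬ P.UpperLT (P.γIter 0 (h r)) (P.γ (h t)) := by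
  have htd := H.threshold_dim ht.thr
  have hta := H.active_arrow (Or.inr ht.thr)
  obtain ⟨σ, hσ⟩ := Q.δ_nonempty t (by omega)
  have hσd := Q.dim_δ t σ hσ
  have hγd := Q.dim_γ t (by omega)
  have hv := dim_γIter_zero r
  have hrp' := H.cut.map_eq_pos H.opQ.1 (faceOf_γIter 0 r) hrp
  have h2 := H.cut.lt_of_neg_pos H.opQ.1 (by omega) hv (H.cut.δ_neg hta h1 hσ) hrp'
  have h3 : Q.UpperLE (Q.γ t) (Q.γIter 0 r) := by
    by_cases e : Q.γ t = Q.γIter 0 r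
    · exact Or.inl e
    · exact Or.inr ((H.opQ.1.linear_zero _ _ (by omega) hv e).resolve_right
        fun hlt => H.not_between ht hr h1 hσ h2 hlt)
  have h4 := (H.map.map_le h3 (H.dim_map_zero (by omega))).1
  rw [H.map_γIter_zero hrd, H.map.map_γ_of_dim_eq htd] at h4
  exact H.opP.not_lt_of_le h4

/-! ### The non-collapsed face of the domain of a collapsed face -/

/-- The entry is `h s = h θ` for a threshold face `θ`, and it is at most `γ^i (h r)`. Reflecting
this inequality, either `γ^i r` lies above `θ` and is active, or the two images agree. -/
theorem splitSeq_eq_γIter (hq : IsSplitting h ϱ q) (hr : r ∈ Q.δ q)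
    (hrd : P.dim (h r) = Q.dim r) (hi : 1 ≤ i) (hir : i ≤ Q.dim r)
    (hna : ¬ IsActive h ϱ (Q.γIter i r)) :
    splitSeq h ϱ i = some (P.γIter i (h r)) := by
  have hd := Q.dim_δ q r hr
  have hqm := hq.dim_map
  have he := H.map.map_eq_of_mem_δ hr hrd (by omega)
  obtain ⟨s, hs, hsd, hsf⟩ := exists_splitting_face hq (i := i + 1) (by omega) (by omega)
  rw [H.splitSeq_eq hs hsd]
  obtain ⟨θ, hθ, hθd, hθs, -⟩ := H.exists_least_threshold hs (by omega)
  have hsm := hs.dim_map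
  have hle := H.opP.faceOf_le_γIter (H.map.map_faceOf H.opQ.1 hsf)
  obtain ⟨h1, h2⟩ := H.map.map_γIter i hrd
  rw [show P.dim (h s) = i by omega, ← he, ← h1, ← hθs] at hle
  rcases H.map.reflect_le H.opQ H.opP (H.threshold_dim hθ) h2 hle with h3 | ⟨-, h3⟩
  · exact absurd (H.active_le h3 (Or.inr hθ)) hna
  · rw [← h1, ← h3, hθs]

theorem not_active_of_splitting (hq : IsSplitting h ϱ q) (hr : r ∈ Q.δ q)
    (hrd : P.dim (h r) = Q.dim r) (hd : 2 ≤ Q.dim q) : ¬ IsActive h ϱ r := by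
  intro ha
  obtain ⟨s, hs, hs'⟩ := hq.exists_mem hd
  have := H.active_unique hs (Or.inl hs') hr ha
  subst this
  have := hs'.dim_map
  omega

/-- Above the level, the entries are codomains. The entry at the level is in the boundary of the
codomain above it and at most `h t`, since it is the image of the least threshold face. So it is not
the codomain, and the antichain property makes it equal to `h t`. -/
theorem splitSeq_level (hq : IsSplitting h ϱ q) (hr : r ∈ Q.δ q)
    (hrd : P.dim (h r) = Q.dim r) (ht : IsLevel h ϱ r t) :
    Q.dim t < Q.dim r ∧ splitSeq h ϱ (Q.dim t) = some (h t) ∧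
      ∀ i, Q.dim t < i → i ≤ Q.dim r → splitSeq h ϱ i = some (P.γIter i (h r)) := by
  have h1 := H.isLevel_dim_pos ht
  have h2 := le_dim_of_mem_domLevel ht.mem
  have hd := Q.dim_δ q r hr
  have hlt : Q.dim t < Q.dim r := by
    refine lt_of_le_of_ne h2 fun e => ?_
    have h3 := H.isLevel_active ht
    rw [e, γIter_of_le le_rfl] at h3
    exact H.not_active_of_splitting hq hr hrd (by omega) h3
  have hX : ∀ i, Q.dim t < i → i ≤ Q.dim r → splitSeq h ϱ i = some (P.γIter i (h r)) :=
    fun i hi hi' => H.splitSeq_eq_γIter hq hr hrd (by omega) hi' (ht.max i hi hi')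
  refine ⟨hlt, ?_, hX⟩
  obtain ⟨s, hs, hsd, -⟩ := exists_splitting_face hq (i := Q.dim t + 2) (by omega) (by omega)
  obtain ⟨a, ha, hab⟩ := H.splitSeq_boundary hs hsd
  have hb := H.splitSeq_eq hs (i := Q.dim t + 1) hsd
  rw [hX _ (by omega) (by omega)] at hb
  rw [← Option.some.inj hb] at hab
  obtain ⟨s', hs', hsd', rfl⟩ := exists_of_splitSeq ha
  obtain ⟨θ, hθ, hθd, hθs, hmin⟩ := H.exists_least_threshold hs' (by omega)
  have hle := (H.map.map_le (hmin t ht.thr (by omega)) (H.threshold_dim hθ)).1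
  rw [hθs] at hle
  have hm := H.map_mem_domLevel ht.mem (H.threshold_dim ht.thr) hrd
  rw [mem_domLevel_iff (by omega)] at hm
  rw [ha]
  congr 1
  obtain ⟨-, e | hab⟩ := hab
  · rw [e] at hle
    exact absurd (upperLT_of_mem hm) (H.opP.not_lt_of_le hle)
  · exact H.opP.δ_eq_of_le hab hm hle

theorem splitSeq_zero_neg (hq : IsSplitting h ϱ q) (hr : r ∈ Q.δ q)
    (hrd : P.dim (h r) = Q.dim r) (hd : 2 ≤ Q.dim q) (hrn : ϱ r = IFace.neg) :
    splitSeq h ϱ 0 = some (P.γIter 0 (h r)) := by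
  have hd' := Q.dim_δ q r hr
  have hqm := hq.dim_map
  have he := H.map.map_eq_of_mem_δ hr hrd (by omega)
  obtain ⟨s, hs, hsd, hsf⟩ := exists_splitting_face hq (i := 1) le_rfl (by omega)
  rw [H.splitSeq_eq hs hsd]
  have hle := H.opP.faceOf_le_γIter (H.map.map_faceOf H.opQ.1 hsf)
  have := hs.dim_map
  rw [show P.dim (h s) = 0 by omega, ← he] at hle
  have h2 := H.map_le_of_neg hs hsd (dim_γIter_zero r)
    (H.cut.map_eq_neg H.opQ.1 (faceOf_γIter 0 r) hrn)
  rw [H.map_γIter_zero hrd] at h2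
  rw [H.opP.le_antisymm hle h2]

theorem splitSeq_zero_pos (hq : IsSplitting h ϱ q) (hr : r ∈ Q.δ q)
    (hrd : P.dim (h r) = Q.dim r) (hd : 2 ≤ Q.dim q) (hrp : ϱ r = IFace.pos) :
    splitSeq h ϱ 0 ≠ some (P.γIter 0 (h r)) := by
  have hd' := Q.dim_δ q r hr
  obtain ⟨s, hs, hsd, hsf⟩ := exists_splitting_face hq (i := 1) le_rfl (by omega)
  rw [H.splitSeq_eq hs hsd]
  intro e
  have h1 := H.map_lt_of_pos hs hsd hrd (by omega) hrp
  rw [← Option.some.inj e] at h1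
  exact H.opP.strictness _ h1

/-- For a collapsed, non-splitting `q`, this matches the level of the uncollapsed face `r` of its
domain with that of `γ q`, whence `H(r) = H(γ q)`. -/
theorem exists_isLevel_of_collapsed (hq : P.dim (h q) + 1 = Q.dim q) (hns : ¬ IsSplitting h ϱ q)
    (hr : r ∈ Q.δ q) (hrd : P.dim (h r) = Q.dim r) (ht : IsLevel h ϱ (Q.γ q) t) :
    ∃ t', IsLevel h ϱ r t' ∧ Q.dim t' = Q.dim t ∧ h t' = h t := by
  have hQ := H.opQ.1
  have hP := H.opP
  have hrq := Q.dim_δ q r hr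
  have hγq := Q.dim_γ q (by omega)
  have hhr := H.map.map_eq_of_mem_δ hr hrd (by omega)
  have hhγ := H.map.map_γ_of_dim_ne (q := q) (by omega)
  have htd := H.threshold_dim ht.thr
  have hmono : ∀ i, Q.UpperLE (Q.γIter i r) (Q.γIter i (Q.γ q)) := fun i =>
    hQ.γIter_mono i (upperLT_of_mem hr).le
  have hle := le_dim_of_mem_domLevel ht.mem
  have hmax : ∀ i, Q.dim t < i → i ≤ Q.dim r → ¬ IsActive h ϱ (Q.γIter i r) :=
    fun i hi hi' ha => ht.max i hi (by omega) (H.active_le (hmono i) ha)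
  -- If `t = γ q`, the active face of `δ q` is a threshold face, and so is `r` by injectivity.
  -- Otherwise `h t` lifts to some `u` in the domain of an iterated codomain `g` of `r`, and `γ g`
  -- is compared with `t`.
  have hact : IsActive h ϱ (Q.γIter (Q.dim t) r) := by
    have hm := ht.mem
    rcases hle.eq_or_lt with e | hlt
    · rw [e, mem_domLevel_dim_iff] at hm
      subst hm
      obtain ⟨x, hx, hx'⟩ := H.exists_active (Or.inr ht.thr) (by omega)
      have hxt : IsThreshold h ϱ x := hx'.resolve_left fun hs => hns
        (by
          refine (H.active_of_mem hx hs (by omega)).resolve_right fun h' => ?_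
          have := H.threshold_dim h'
          omega)
      have hxd := H.threshold_dim hxt
      have : x = r := H.map.eq_of_map_eq hx hxd hr hrd
        ((H.map.map_eq_of_mem_δ hx hxd (by omega)).trans hhr.symm)
      subst this
      rwa [γIter_of_le (by omega)]
    · rw [mem_domLevel_iff hlt] at hm
      obtain ⟨h1, h2⟩ := H.map.map_γIter (Q.dim t + 1) (q := Q.γ q) (by rw [hhγ]; omega)
      obtain ⟨h3, h4⟩ := H.map.map_γIter (Q.dim t + 1) hrd
      have h5 := H.map.map_mem_δ hm htd h2
      rw [h1, hhγ, ← hhr, ← h3] at h5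
      have hgd : Q.dim (Q.γIter (Q.dim t + 1) r) = Q.dim t + 1 := dim_γIter (by omega)
      rw [← γ_γIter (by omega)]
      generalize Q.γIter (Q.dim t + 1) r = g at *
      obtain ⟨u, hu, hud, hut⟩ := H.map.exists_mem_δ (by omega) h4 h5
      rcases H.map.reflect_le H.opQ hP htd hud (Or.inl hut.symm) with h6 | ⟨h6, -⟩
      · exact H.active_γ hu (H.active_le h6 (Or.inr ht.thr))
      · rcases hQ.upset_linear (upperLT_of_mem hu).le h6.le with h7 | h7
        · have h8 := (H.map.map_le h7 (H.map.dim_map_γ h4)).1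
          rw [H.map.map_γ_of_dim_eq h4] at h8
          exact absurd (upperLT_of_mem h5) (hP.not_lt_of_le h8)
        · exact H.active_le h7.le (Or.inr ht.thr)
  obtain ⟨t', ht', hd'⟩ := H.isLevel_of_active hrd (by omega) hact hmax
  refine ⟨t', ht', hd', ?_⟩
  have htd' := H.threshold_dim ht'.thr
  have hm1 := H.map_mem_domLevel ht.mem htd (by rw [hhγ]; omega)
  have hm2 := H.map_mem_domLevel ht'.mem htd' hrd
  rw [hhγ, ← hhr] at hm1
  rw [hd'] at hm2
  -- Both images lie in the same iterated domain of `h q`, and comparable elements of it are equal.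
  rcases H.active_comparable (Or.inr ht'.thr) (Or.inr ht.thr) hd' with hc | hc
  · exact hP.domLevel_eq_of_common hm2 hm1 (.refl _) (H.map.map_le hc htd').1
  · exact hP.domLevel_eq_of_common hm2 hm1 (H.map.map_le hc.le htd).1 (.refl _)

end IsCylPair

/-! ### First and last flags, punctured flags and the star operation. -/

section Flags

open CylFace

variable {P : PosHypergraph.{u}} {p : P.Face} {x y : FaceSeq P} {i j : ℕ} {a b c : P.Face}

theorem IsFlag.exists_eq (hx : IsFlag p x) (hi : i ≤ P.dim p) : ∃ a, x i = some a := by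
  rcases hi.lt_or_eq with hi | rfl
  · obtain ⟨a, b, ha, -⟩ := hx.2.2 i hi
    exact ⟨a, ha⟩
  · exact ⟨p, hx.1⟩

theorem IsFlag.mem_boundary (hx : IsFlag p x) (ha : x i = some a) (hb : x (i + 1) = some b) :
    a ∈ P.boundary b := by
  have hd := flag_level hx hb
  have hi : i < P.dim p := by
    by_contra hc
    rw [hx.2.1 (i + 1) (by omega)] at hb
    cases hb
  obtain ⟨a', b', ha', hb', hab⟩ := hx.2.2 i hi
  rw [ha] at ha'
  rw [hb] at hb'
  cases ha'
  cases hb'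
  exact hab

theorem IsFlag.faceOf (hx : IsFlag p x) (ha : x i = some a) : P.FaceOf a p := by
  induction hn : P.dim p - i generalizing i a with
  | zero =>
    by_cases hi : i = P.dim p
    · subst hi
      rw [hx.1] at ha
      cases ha
      exact .refl _
    · rw [hx.2.1 i (by omega)] at ha
      cases ha
  | succ n ih =>
    obtain ⟨b, hb⟩ := hx.exists_eq (i := i + 1) (by omega)
    exact (faceOf_of_mem_boundary (hx.mem_boundary ha hb)).trans (ih hb (by omega))

/-- The flag of iterated codomains. -/
def γFlag (p : P.Face) : FaceSeq P := fun i => if i ≤ P.dim p then some (P.γIter i p) else none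

theorem isFlag_γFlag (p : P.Face) : IsFlag p (γFlag p) := by
  refine ⟨by simp [γFlag, γIter_of_le], fun i hi => by simp [γFlag, hi], fun i hi =>
    ⟨P.γIter i p, P.γIter (i + 1) p, by simp [γFlag, hi.le], by simp [γFlag, hi],
      by rw [dim_γIter (by omega)]; omega, Or.inl (γ_γIter hi).symm⟩⟩

theorem isFlag_update_γFlag {d : P.Face} (hp : 1 ≤ P.dim p) (hd : d ∈ P.δ (P.γIter 1 p)) :
    IsFlag p (Function.update (γFlag p) 0 (some d)) := by
  have h := isFlag_γFlag p
  refine ⟨?_, fun i hi => ?_, fun i hi => ?_⟩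
  · rw [Function.update_of_ne (by omega)]; exact h.1
  · rw [Function.update_of_ne (by omega)]; exact h.2.1 i hi
  · rcases i with _ | i
    · exact ⟨d, P.γIter 1 p, by simp, by simp [γFlag, hp], mem_boundary_δ hd⟩
    · simpa using h.2.2 (i + 1) hi

theorem FaceSeq.sgn_congr {k : ℕ} (h : ∀ j ≤ k, x j = y j) : x.sgn k = y.sgn k := by
  induction k with
  | zero => rfl
  | succ k ih =>
    simp only [FaceSeq.sgn]
    rw [h k (by omega), h (k + 1) le_rfl, ih fun j hj => h j (by omega)]

namespace PosHypergraph.IsOpetopicCardinal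

variable (hP : P.IsOpetopicCardinal)
include hP

theorem pencilLT_asymm (h : PencilLT c a b) : ¬ PencilLT c b a := by
  have hγ := hP.γ_not_mem_δ
  rcases h with ⟨rfl, h⟩ | ⟨h1, h2, h3⟩ | ⟨h1, h2, h3⟩ <;>
  rintro (⟨h4, h5⟩ | ⟨h4, h5, h6⟩ | ⟨h4, h5, h6⟩)
  · exact hγ _ h5
  · exact hγ _ h4
  · exact hγ _ (h5 ▸ h)
  · exact hγ _ (h4 ▸ h1)
  · exact hP.strictness _ (h3.trans h6)
  · exact hγ _ (h4 ▸ h2)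
  · exact hγ _ (h2 ▸ h5)
  · exact hγ _ (h1 ▸ h5)
  · exact hP.strictness _ (h3.trans h6)

/-- Asymmetry, with an explicit flag preceding or following all others, suffices to identify the
first and the last flag; linearity of the order is not needed. -/
theorem flagLT_asymm (h : FlagLT x y) : ¬ FlagLT y x := by
  obtain ⟨k, h1, h2, h3⟩ := h
  rintro ⟨l, g1, g2, g3⟩
  obtain rfl : k = l := by
    rcases lt_trichotomy k l with hkl | hkl | hkl
    · exact absurd (g1 k hkl).symm h2
    · exact hkl
    · exact absurd (h1 l hkl).symm g2
  rcases h3 with ⟨rfl, a, b, ha, hb, hlt⟩ | ⟨m, a, b, c, rfl, hc, ha, hb, h3⟩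
  · rcases g3 with ⟨-, a', b', ha', hb', hlt'⟩ | ⟨m, a', b', c', hm, -⟩
    · rw [ha] at hb'; rw [hb] at ha'; cases ha'; cases hb'
      exact hP.strictness _ (hlt.trans hlt')
    · omega
  · rcases g3 with ⟨hm, -⟩ | ⟨m', a', b', c', hm, hc', ha', hb', g3⟩
    · omega
    obtain rfl : m = m' := by omega
    rw [ha] at hb'; rw [hb] at ha'; rw [← h1 m (by omega), hc] at hc'
    cases ha'; cases hb'; cases hc'
    rw [← FaceSeq.sgn_congr (x := x) (y := y) fun j hj => h1 j (by omega)] at g3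
    rcases h3 with ⟨h3, h4⟩ | ⟨h3, h4⟩ <;> rcases g3 with ⟨h5, h6⟩ | ⟨h5, h6⟩
    · exact hP.pencilLT_asymm h4 h6
    · rw [h3] at h5; omega
    · rw [h3] at h5; omega
    · exact hP.pencilLT_asymm h4 h6

omit hP in
theorem _root_.IsFlag.exists_least_ne (hx : IsFlag p x) (hy : IsFlag p y) (hne : x ≠ y) :
    ∃ k, (∀ j, j < k → x j = y j) ∧ k < P.dim p ∧ x k ≠ y k := by
  classical
  have hex : ∃ k, x k ≠ y k := by
    by_contra hc
    push Not at hc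
    exact hne (funext hc)
  refine ⟨Nat.find hex, fun j hj => not_not.1 (Nat.find_min hex hj), ?_, Nat.find_spec hex⟩
  by_contra hc
  have h1 := Nat.find_spec hex
  rcases (not_lt.1 hc).lt_or_eq with h2 | h2
  · exact h1 (by rw [hx.2.1 _ h2, hy.2.1 _ h2])
  · rw [← h2] at h1
    exact h1 (by rw [hx.1, hy.1])

theorem pencilLT_γIter (hb : P.FaceOf b p) (hd : P.dim b = i + 1) (hi : i < P.dim p)
    (hm : P.γIter i p ∈ P.boundary b) (hne : b ≠ P.γIter (i + 1) p) :
    PencilLT (P.γIter i p) (P.γIter (i + 1) p) b := by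
  have hle := hP.faceOf_le_γIter hb
  rw [hd] at hle
  obtain ⟨-, e | hm⟩ := hm
  · exact Or.inr (Or.inr ⟨γ_γIter hi, e.symm, hle.resolve_left hne⟩)
  · have h1 := hP.γ_mono hle
    rw [γ_γIter hi] at h1
    exact absurd (upperLT_of_mem hm) (hP.not_lt_of_le h1)

/-- The flag of iterated codomains has sign `+1` throughout, and at the first difference the
iterated codomain comes first in its pencil. -/
theorem flagLT_of_γ (hx : IsFlag p x) (hx' : ∀ i ≤ P.dim p, x i = some (P.γIter i p))
    (hy : IsFlag p y) (hne : y ≠ x) : FlagLT x y := by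
  obtain ⟨k, h1, h2, h3⟩ := hx.exists_least_ne hy hne.symm
  refine ⟨k, h1, h3, ?_⟩
  obtain ⟨b, hb⟩ := hy.exists_eq h2.le
  have hbd := flag_level hy hb
  have hbf := hy.faceOf hb
  have hxk := hx' k h2.le
  have hne' : b ≠ P.γIter k p := by
    rintro rfl; exact h3 (hxk.trans hb.symm)
  rcases k with _ | m
  · have hle := hP.faceOf_le_γIter hbf
    rw [hbd] at hle
    exact Or.inl ⟨rfl, _, _, hxk, hb, hle.resolve_left hne'⟩
  · have hxm := hx' m (by omega)
    have hs : x.sgn m = 1 := by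
      have : ∀ m ≤ P.dim p, x.sgn m = 1 := by
        intro m hm
        induction m with
        | zero => rfl
        | succ m ih =>
          simp only [FaceSeq.sgn]
          rw [if_pos, ih (by omega)]
          rw [hx' m (by omega), hx' (m + 1) hm, Option.map_some, γ_γIter (by omega)]
      exact this m (by omega)
    refine Or.inr ⟨m, _, _, _, rfl, hxm, hxk, hb, Or.inl ⟨hs, ?_⟩⟩
    refine hP.pencilLT_γIter hbf hbd (by omega) ?_ hne'
    exact hy.mem_boundary ((h1 m (by omega)).symm.trans hxm) hb

/-- Replacing the bottom vertex by the source `d` of `γ^(1) p` makes all signs from level `1` on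
equal to `-1`, so iterated codomains now come last in their pencils. Moreover `d` is the least
vertex, and over it the edge `γ^(1) p` comes last. -/
theorem flagLT_of_last (hx : IsFlag p x)
    (hx' : ∀ i, 1 ≤ i → i ≤ P.dim p → x i = some (P.γIter i p)) {d : P.Face}
    (hd : d ∈ P.δ (P.γIter 1 p)) (hx0 : x 0 = some d) (hy : IsFlag p y) (hne : y ≠ x) :
    FlagLT y x := by
  obtain ⟨k, h1, h2, h3⟩ := hy.exists_least_ne hx hne
  refine ⟨k, h1, h3, ?_⟩
  obtain ⟨b, hb⟩ := hy.exists_eq h2.le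
  have hbd := flag_level hy hb
  have hbf := hy.faceOf hb
  have hdim1 : P.dim (P.γIter 1 p) = 1 := dim_γIter (by omega)
  have hmin : ∀ v, P.FaceOf v p → P.dim v = 0 → P.UpperLE d v := by
    intro v hv hv0
    obtain ⟨d', hd', hle⟩ := hP.faceOf_exists_le hv (by omega)
    rw [hv0] at hd'
    rwa [P.δ_one _ hdim1 hd hd']
  rcases k with _ | m
  · refine Or.inl ⟨rfl, _, _, hb, hx0, (hmin b hbf hbd).resolve_left ?_⟩
    rintro rfl
    exact h3 (hb.trans hx0.symm)
  · have hxk := hx' (m + 1) (by omega) h2.le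
    have hne' : b ≠ P.γIter (m + 1) p := by
      rintro rfl; exact h3 (hb.trans hxk.symm)
    have hle := hP.faceOf_le_γIter hbf
    rw [hbd] at hle
    rcases m with _ | m
    · refine Or.inr ⟨0, _, _, d, rfl, (h1 0 (by omega)).trans hx0, hb, hxk, Or.inl ⟨rfl, ?_⟩⟩
      obtain ⟨h0, e | hm⟩ := hy.mem_boundary ((h1 0 (by omega)).trans hx0) hb
      · obtain ⟨w, hw⟩ := P.δ_nonempty b h0
        have hwd := P.dim_δ b w hw
        have h4 := hmin w ((faceOf_δ hw).trans hbf) (by omega)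
        rw [e] at h4
        exact absurd (upperLT_of_mem hw) (hP.not_lt_of_le h4)
      · exact Or.inr (Or.inl ⟨hm, hd, hle.resolve_left hne'⟩)
    · have hs : ∀ m, m + 1 ≤ P.dim p → x.sgn (m + 1) = -1 := by
        intro m hm
        induction m with
        | zero =>
          simp only [FaceSeq.sgn]
          rw [if_neg]
          rw [hx0, hx' 1 le_rfl hm]
          intro e
          have e := Option.some.inj e
          exact hP.γ_not_mem_δ _ (e ▸ hd)
        | succ m ih =>
          rw [FaceSeq.sgn, if_pos, ih (by omega)]
          rw [hx' (m + 1) (by omega) (by omega), hx' (m + 1 + 1) (by omega) hm, Option.map_some,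
            γ_γIter (by omega)]
      have hxm := hx' (m + 1) (by omega) (by omega)
      refine Or.inr ⟨m + 1, _, _, _, rfl, (h1 _ (by omega)).trans hxm, hb, hxk, Or.inr ⟨?_, ?_⟩⟩
      · rw [FaceSeq.sgn_congr (y := x) fun j hj => h1 j (by omega), hs m (by omega)]
      · exact hP.pencilLT_γIter hbf hbd (by omega)
          (hy.mem_boundary ((h1 _ (by omega)).trans hxm) hb) hne'

theorem isFirstFlag_iff (hx : IsFlag p x) :
    IsFirstFlag p x ↔ ∀ i ≤ P.dim p, x i = some (P.γIter i p) := by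
  have hstd : ∀ i ≤ P.dim p, γFlag p i = some (P.γIter i p) := fun i hi => if_pos hi
  refine ⟨fun h => ?_, fun h => ⟨hx, fun y hy hne => hP.flagLT_of_γ hx h hy hne⟩⟩
  have : γFlag p = x := by
    by_contra hne
    exact hP.flagLT_asymm (h.2 _ (isFlag_γFlag p) hne)
      (hP.flagLT_of_γ (isFlag_γFlag p) hstd hx (Ne.symm hne))
  rw [← this]
  exact hstd

theorem isLastFlag_iff (hx : IsFlag p x) (hp : 1 ≤ P.dim p) :
    IsLastFlag p x ↔ (∀ i, 1 ≤ i → i ≤ P.dim p → x i = some (P.γIter i p)) ∧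
      x 0 ≠ some (P.γIter 0 p) := by
  constructor
  · intro h
    have hdim1 : P.dim (P.γIter 1 p) = 1 := dim_γIter (by omega)
    obtain ⟨d, hd⟩ := P.δ_nonempty (P.γIter 1 p) (by omega)
    have hstd : ∀ i, 1 ≤ i → i ≤ P.dim p →
        Function.update (γFlag p) 0 (some d) i = some (P.γIter i p) := fun i hi hi' => by
      rw [Function.update_of_ne (by omega)]; exact if_pos hi'
    have hf := isFlag_update_γFlag hp hd
    have : Function.update (γFlag p) 0 (some d) = x := by
      by_contra hne
      exact hP.flagLT_asymm (h.2 _ hf hne)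
        (hP.flagLT_of_last hf hstd hd (Function.update_self ..) hx (Ne.symm hne))
    rw [← this]
    refine ⟨hstd, ?_⟩
    rw [Function.update_self, ← γ_γIter (by omega)]
    intro e
    exact hP.γ_not_mem_δ _ (Option.some.inj e ▸ hd)
  · rintro ⟨h, h0⟩
    obtain ⟨d, hd⟩ := hx.exists_eq (Nat.zero_le _)
    obtain ⟨-, e | hm⟩ := hx.mem_boundary hd (h 1 le_rfl hp)
    · rw [γ_γIter (by omega)] at e
      exact absurd (hd.trans (congrArg some e)) h0
    · exact ⟨hx, fun y hy hne => hP.flagLT_of_last hx h hm hd hy hne⟩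

end PosHypergraph.IsOpetopicCardinal

/-! ### Punctured flags -/

/-- `z = [p, γ(p), …, γ^(l+2)(p), t, 0, z_{l-1}, …, z_0]` is a p-flag under `p`. -/
structure IsLift (p : P.Face) (z : FaceSeq P) (l : ℕ) (t : P.Face) : Prop where
  mem : t ∈ domLevel (l + 1) p
  eq : z = liftSeq p t l z
  filled : ∀ i, i < l → ∃ a, z i = some a
  adj : ∀ i a b, i + 1 < l → z i = some a → z (i + 1) = some b → a ∈ P.boundary b
  bot : ∀ i a, i + 1 = l → z i = some a → ∃ b ∈ P.boundary t, a ∈ P.boundary b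

variable {z : FaceSeq P} {l : ℕ} {t : P.Face}

namespace IsLift

theorem hole (hz : IsLift p z l t) : z l = none := by
  rw [hz.eq]; simp [liftSeq]

theorem top (hz : IsLift p z l t) : z (l + 1) = some t := by
  rw [hz.eq]; simp [liftSeq]

theorem lt_dim (hz : IsLift p z l t) : l < P.dim p := le_dim_of_mem_domLevel hz.mem

theorem eq_γIter (hz : IsLift p z l t) (hi : l + 1 < i) (hip : i ≤ P.dim p) :
    z i = some (P.γIter i p) := by
  rw [hz.eq, liftSeq, if_neg (by omega), if_neg (by omega), if_neg (by omega), if_pos hip]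

theorem eq_none (hz : IsLift p z l t) (hip : P.dim p < i) : z i = none := by
  have := hz.lt_dim
  rw [hz.eq, liftSeq, if_neg (by omega), if_neg (by omega), if_neg (by omega), if_neg (by omega)]

theorem puncture_eq (hz : IsLift p z l t) : puncture z = l := by
  refine le_antisymm (Nat.sInf_le hz.hole) ?_
  refine le_csInf ⟨l, hz.hole⟩ fun i hi => ?_
  by_contra hc
  obtain ⟨a, ha⟩ := hz.filled i (by omega)
  rw [show z i = none from hi] at ha
  cases ha

theorem dim_t (hz : IsLift p z l t) : P.dim t = l + 1 := dim_of_mem_domLevel hz.mem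

theorem isPFlag (hP : P.IsOpetopicCardinal) (hz : IsLift p z l t) : IsPFlag p z := by
  have hl := hz.lt_dim
  have htd := hz.dim_t
  -- The face `c` refills the hole. Erasing it again gives a high p-flag if `t` is on top. Otherwise
  -- `l` is the low level: `t` lies in a domain, while everything above is a codomain.
  obtain ⟨c, hc, hcb⟩ : ∃ c ∈ P.boundary t, ∀ i a, i + 1 = l → z i = some a →
      a ∈ P.boundary c := by
    rcases l with _ | l
    · exact ⟨P.γ t, mem_boundary_γ (by omega), fun i a hi => by omega⟩
    · obtain ⟨a, ha⟩ := hz.filled l (by omega)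
      obtain ⟨b, hb, hab⟩ := hz.bot l a rfl ha
      refine ⟨b, hb, fun i a' hi ha' => ?_⟩
      obtain rfl : i = l := by omega
      rw [ha] at ha'
      cases ha'
      exact hab
  have hxl : Function.update z l (some c) l = some c := Function.update_self ..
  have hxi : ∀ i, i ≠ l → Function.update z l (some c) i = z i := fun i hi =>
    Function.update_of_ne hi ..
  have hflag : IsFlag p (Function.update z l (some c)) := by
    refine ⟨?_, fun i hi => ?_, fun i hi => ?_⟩
    · rw [hxi _ (by omega)]
      by_cases h1 : P.dim p = l + 1
      · have := hz.mem
        rw [← h1, mem_domLevel_dim_iff] at this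
        rw [h1, hz.top, this]
      · rw [hz.eq_γIter (by omega) le_rfl, γIter_of_le le_rfl]
    · rw [hxi _ (by omega), hz.eq_none hi]
    · rcases lt_trichotomy i l with h1 | rfl | h1
      · obtain ⟨a, ha⟩ := hz.filled i h1
        rcases (show i + 1 < l ∨ i + 1 = l by omega) with h2 | rfl
        · obtain ⟨b, hb⟩ := hz.filled (i + 1) h2
          exact ⟨a, b, by rwa [hxi _ (by omega)], by rwa [hxi _ (by omega)],
            hz.adj i a b h2 ha hb⟩
        · exact ⟨a, c, by rwa [hxi _ (by omega)], hxl, hcb i a rfl ha⟩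
      · exact ⟨c, t, hxl, by rw [hxi _ (by omega), hz.top], hc⟩
      · rw [hxi _ (by omega), hxi _ (by omega)]
        rcases (show i = l + 1 ∨ l + 1 < i by omega) with rfl | h2
        · refine ⟨t, _, hz.top, hz.eq_γIter (by omega) (by omega), mem_boundary_δ ?_⟩
          exact (mem_domLevel_iff (by omega)).1 hz.mem
        · refine ⟨_, _, hz.eq_γIter h2 (by omega), hz.eq_γIter (by omega) (by omega), ?_⟩
          rw [← γ_γIter (p := p) (k := i) (by omega)]
          exact mem_boundary_γ (by rw [dim_γIter (by omega)]; omega)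
  have her : FaceSeq.erase (Function.update z l (some c)) l = z := by
    rw [FaceSeq.erase, Function.update_idem, ← hz.hole, Function.update_eq_self]
  refine ⟨_, hflag, ?_⟩
  rcases (show l + 1 = P.dim p ∨ l + 1 < P.dim p by omega) with h1 | h1
  · exact Or.inl ⟨by omega, by rw [show P.dim p - 1 = l by omega, her]⟩
  · have htm := (mem_domLevel_iff h1).1 hz.mem
    have hne : Function.update z l (some c) (l + 1) ≠ some (P.γIter (l + 1) p) := by
      rw [hxi _ (by omega), hz.top, ← γ_γIter h1]
      intro e
      exact hP.γ_not_mem_δ _ (Option.some.inj e ▸ htm)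
    refine Or.inr ⟨by omega, fun hf => ?_, fun hf => ?_, ?_⟩
    · exact hne ((hP.isFirstFlag_iff hflag).1 hf _ h1.le)
    · exact hne (((hP.isLastFlag_iff hflag (by omega)).1 hf).1 _ (by omega) h1.le)
    · have : lowLevel p (Function.update z l (some c)) = l := by
        refine IsGreatest.csSup_eq ⟨⟨h1, t, _, ?_, ?_, htm⟩, ?_⟩
        · rw [hxi _ (by omega), hz.top]
        · rw [hxi _ (by omega), hz.eq_γIter (by omega) (by omega)]
        · rintro i ⟨hi, a, b, ha, hb, hab⟩
          by_contra hc
          rw [hxi _ (by omega), hz.eq_γIter (by omega) (by omega)] at ha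
          rw [hxi _ (by omega), hz.eq_γIter (by omega) (by omega)] at hb
          cases ha
          cases hb
          rw [← γ_γIter (p := p) (k := i + 1) (by omega)] at hab
          exact hP.γ_not_mem_δ _ hab
      rw [this, her]

end IsLift

/-- A flag whose levels above `l` are determined by codomains, except at level `l + 1`. -/
theorem IsFlag.isLift_erase (hx : IsFlag p x) (ht : x (l + 1) = some t)
    (hm : t ∈ domLevel (l + 1) p)
    (hγ : ∀ i, l + 1 < i → i ≤ P.dim p → x i = some (P.γIter i p)) :
    IsLift p (x.erase l) l t := by
  have hl : l + 1 ≤ P.dim p := le_dim_of_mem_domLevel hm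
  have hi : ∀ i, i ≠ l → x.erase l i = x i := fun i hi => Function.update_of_ne hi ..
  refine ⟨hm, ?_, fun i hil => ?_, fun i a b hil ha hb => ?_, fun i a hil ha => ?_⟩
  · funext i
    rw [liftSeq]
    split_ifs with h1 h2 h3 h4
    · rfl
    · rw [h2]; exact Function.update_self ..
    · rw [hi _ h2, h3, ht]
    · rw [hi _ h2, hγ i (by omega) h4]
    · rw [hi _ h2, hx.2.1 i (by omega)]
  · rw [hi _ (by omega)]
    exact hx.exists_eq (by omega)
  · rw [hi _ (by omega)] at ha hb
    exact hx.mem_boundary ha hb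
  · subst hil
    rw [hi _ (by omega)] at ha
    obtain ⟨b, hb⟩ := hx.exists_eq (i := i + 1) (by omega)
    exact ⟨b, hx.mem_boundary hb ht, hx.mem_boundary ha hb⟩

/-- By maximality of the low level, all entries higher than the one directly above it are iterated
codomains, so that entry lies in an iterated domain. -/
theorem IsFlag.exists_low (hx : IsFlag p x) (hne : ∃ i, 1 ≤ i ∧ i ≤ P.dim p ∧
    x i ≠ some (P.γIter i p)) : lowLevel p x + 1 < P.dim p ∧
    (∃ t, x (lowLevel p x + 1) = some t ∧ t ∈ domLevel (lowLevel p x + 1) p) ∧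
    ∀ i, lowLevel p x + 1 < i → i ≤ P.dim p → x i = some (P.γIter i p) := by
  have hbdd : BddAbove {i | i + 1 < P.dim p ∧
      ∃ a b, x (i + 1) = some a ∧ x (i + 2) = some b ∧ a ∈ P.δ b} :=
    ⟨P.dim p, fun i hi => by have := hi.1; omega⟩
  have key : ∀ k, (∀ i, k ≤ i → i + 1 < P.dim p → ¬ ∃ a b, x (i + 1) = some a ∧
      x (i + 2) = some b ∧ a ∈ P.δ b) →
      ∀ i, k + 1 ≤ i → i ≤ P.dim p → x i = some (P.γIter i p) := by
    intro k hk i hi hip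
    induction hn : P.dim p - i generalizing i with
    | zero =>
      obtain rfl : i = P.dim p := by omega
      rw [hx.1, γIter_of_le le_rfl]
    | succ n ih =>
      have hb := ih (i + 1) (by omega) (by omega) (by omega)
      obtain ⟨a, ha⟩ := hx.exists_eq hip
      obtain ⟨-, e | hm⟩ := hx.mem_boundary ha hb
      · rw [ha, e, γ_γIter (by omega)]
      · obtain ⟨i, rfl⟩ : ∃ i', i = i' + 1 := ⟨i - 1, by omega⟩
        exact absurd ⟨a, _, ha, hb, hm⟩ (hk i (by omega) (by omega))
  -- Nonemptiness keeps the supremum from being the default `0`; were the set empty, the flag would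
  -- consist of codomains from level `1` on.
  have hnon : {i | i + 1 < P.dim p ∧
      ∃ a b, x (i + 1) = some a ∧ x (i + 2) = some b ∧ a ∈ P.δ b}.Nonempty := by
    by_contra hc
    obtain ⟨i, h1, h2, h3⟩ := hne
    refine h3 (key 0 (fun i _ hi hex => hc ⟨i, hi, hex⟩) i (by omega) h2)
  have hmem := Nat.sSup_mem hnon hbdd
  have hγ : ∀ i, lowLevel p x + 1 < i → i ≤ P.dim p → x i = some (P.γIter i p) := by
    intro i hi hip
    refine key (lowLevel p x + 1) (fun i hi hi' hex => ?_) i (by omega) hip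
    have : i ≤ lowLevel p x := le_csSup hbdd ⟨hi', hex⟩
    omega
  obtain ⟨h1, a, b, ha, hb, hab⟩ := hmem
  change lowLevel p x + 1 < P.dim p at h1
  change x (lowLevel p x + 1) = some a at ha
  change x (lowLevel p x + 2) = some b at hb
  refine ⟨h1, ⟨a, ha, (mem_domLevel_iff h1).2 ?_⟩, hγ⟩
  rw [hγ _ (by omega) (by omega)] at hb
  cases hb
  exact hab

/-- Puts high and low p-flags into one normal form, the high ones with `t = p`. Neither first nor
last means exactly that some entry above level `0` is not an iterated codomain. -/
theorem IsPFlag.exists_isLift (hP : P.IsOpetopicCardinal) (hz : IsPFlag p z) :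
    ∃ l t, IsLift p z l t := by
  obtain ⟨x, hx, ⟨h, rfl⟩ | ⟨h, h1, h2, rfl⟩⟩ := hz
  · have e : P.dim p - 1 + 1 = P.dim p := by omega
    exact ⟨_, p, hx.isLift_erase (by rw [e, hx.1]) (by rw [e]; exact mem_domLevel_self p)
      fun i hi hi' => by omega⟩
  · have hne : ∃ i, 1 ≤ i ∧ i ≤ P.dim p ∧ x i ≠ some (P.γIter i p) := by
      by_contra hc
      push Not at hc
      by_cases h0 : x 0 = some (P.γIter 0 p)
      · refine h1 ((hP.isFirstFlag_iff hx).2 fun i hi => ?_)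
        rcases Nat.eq_zero_or_pos i with rfl | h3
        · exact h0
        · exact hc i h3 hi
      · exact h2 ((hP.isLastFlag_iff hx (by omega)).2 ⟨hc, h0⟩)
    obtain ⟨-, ⟨t, ht, hm⟩, hγ⟩ := hx.exists_low hne
    exact ⟨_, t, hx.isLift_erase ht hm hγ⟩

namespace CylFace

theorem ofSeq_of_isFlag (hx : IsFlag p x) : ofSeq p x = .flag p x hx := by
  rw [ofSeq, dif_pos hx]

theorem ofSeq_of_isPFlag (hz : IsPFlag p z) : ofSeq p z = .pflag p z hz := by
  obtain ⟨i, hi, hn⟩ := exists_hole hz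
  rw [ofSeq, dif_neg, dif_pos hz]
  intro hx
  obtain ⟨a, ha⟩ := hx.exists_eq hi.le
  rw [hn] at ha
  cases ha

end CylFace

/-! ### The star operation -/

/-- The marker of a p-flag at level `i ≥ 1`. -/
def SeqMarker (z : FaceSeq P) (l : ℕ) (t : P.Face) (i : ℕ) (a : P.Face) : Prop :=
  (i = l + 1 ∧ a = t) ∨ (i = l ∧ a = P.γ t) ∨ (i < l ∧ z i = some a)

/-- The star operation on `p` can stop at level `i`, with the face `u`. -/
def StopsAt (z : FaceSeq P) (l : ℕ) (t p : P.Face) (i : ℕ) (u : P.Face) : Prop :=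
  1 ≤ i ∧ u ∈ domLevel i p ∧ ∃ a, SeqMarker z l t i a ∧ P.UpperLE a u

theorem StopsAt.le {q u : P.Face} (h : StopsAt z l t q i u) : i ≤ l + 1 := by
  obtain ⟨-, -, a, ha, -⟩ := h
  rcases ha with ha | ha | ha <;> omega

theorem StopsAt.unique (hP : P.IsOpetopicCardinal) {q u u' : P.Face}
    (h : StopsAt z l t q i u) (h' : StopsAt z l t q i u') : u = u' := by
  obtain ⟨-, h1, a, ha, h2⟩ := h
  obtain ⟨-, h3, a', ha', h4⟩ := h'
  have : a = a' := by
    rcases ha with ⟨e, rfl⟩ | ⟨e, rfl⟩ | ⟨e, ha⟩ <;>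
      rcases ha' with ⟨e', rfl⟩ | ⟨e', rfl⟩ | ⟨e', ha'⟩ <;> first | rfl | omega | skip
    rw [ha] at ha'
    exact Option.some.inj ha'
  subst this
  exact hP.domLevel_eq_of_common h1 h3 h2 h4

namespace IsLift

variable (hP : P.IsOpetopicCardinal) (hz : IsLift p z l t) {q u : P.Face}
include hz

/-- The first case of the star operation is no separate case: it is a stop at level `l + 1` with the
unchanged face `t`. -/
theorem stopsAt_of_top (hl : l ≤ P.dim q)
    (h : P.dim q ≠ l ∧ z (P.dim q) = some q) : StopsAt z l t q (l + 1) t := by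
  refine ⟨by omega, ?_, t, Or.inl ⟨rfl, rfl⟩, .refl _⟩
  have hm := hz.mem
  rcases (show P.dim q = l + 1 ∨ l + 1 < P.dim q by omega) with e | e
  · rw [e, hz.top] at h
    rw [Option.some.inj h.2, ← e]
    exact mem_domLevel_self q
  · have hqp : P.dim q ≤ P.dim p := by
      by_contra hc
      rw [hz.eq_none (by omega)] at h
      exact absurd h.2 (by simp)
    rw [hz.eq_γIter e hqp] at h
    rw [mem_domLevel_iff (by omega)] at hm ⊢
    have e' := Option.some.inj h.2
    rw [← e', γIter_γIter (by omega)]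
    exact hm

theorem trunc_eq (hl : l ≤ P.dim q)
    (h : P.dim q ≠ l ∧ z (P.dim q) = some q) : z.trunc (P.dim q) = liftSeq q t l z := by
  funext i
  rw [FaceSeq.trunc, liftSeq]
  have hqp : P.dim q ≤ P.dim p := by
    by_contra hc
    rw [hz.eq_none (by omega)] at h
    exact absurd h.2 (by simp)
  by_cases h1 : i ≤ P.dim q
  · rw [if_pos h1]
    split_ifs with h2 h3 h4
    · rfl
    · rw [h3, hz.hole]
    · rw [h4, hz.top]
    · rw [hz.eq_γIter (by omega) (by omega)]
      congr 1
      have h5 := h.2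
      rw [hz.eq_γIter (by omega) hqp] at h5
      have e' := Option.some.inj h5
      exact (γIter_γIter h1).symm.trans (congrArg (P.γIter i) e')
  · rw [if_neg h1, if_neg (by omega), if_neg (by omega), if_neg (by omega), if_neg (by omega)]

theorem stopsAt_of_below {u : P.Face} (hb : Below z (l + 1) q u) :
    StopsAt z l t q (l + 1) u := by
  obtain ⟨hu, a, ha, hau⟩ := hb
  rw [hz.top] at ha
  cases ha
  exact ⟨by omega, hu, t, Or.inl ⟨rfl, rfl⟩, hau⟩

include hP in
-- The cases of the star operation are tried by decreasing level: `l + 1`, then `l`, then the lower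
-- ones. So the first applicable case is the highest stop, and `StopsAt.unique` makes the chosen
-- face irrelevant.
theorem star_eq (hl : l ≤ P.dim q) (hs : StopsAt z l t q i u)
    (hmax : ∀ j v, i < j → ¬ StopsAt z l t q j v) :
    CylFace.star q z = ofSeq q (liftSeq q u (i - 1) z) := by
  have key : ∀ j v, i ≤ j → StopsAt z l t q j v → j = i ∧ v = u := by
    intro j v hj hv
    have : j = i := by
      by_contra hc
      exact hmax j v (by omega) hv
    subst this
    exact ⟨rfl, hv.unique hP hs⟩
  have hsle := hs.le
  have hi1 := hs.1
  have hidim := le_dim_of_mem_domLevel hs.2.1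
  have hdown : i < l → Below z i q u := fun hil => by
    obtain ⟨-, hu, a, ha, hau⟩ := hs
    refine ⟨hu, a, ?_, hau⟩
    rcases ha with ha | ha | ha
    · omega
    · omega
    · exact ha.2
  have hup : ∀ j v, j + 2 ≤ l → Below z (j + 1) q v → StopsAt z l t q (j + 1) v := by
    rintro j v hj ⟨hv, a, ha, hav⟩
    exact ⟨by omega, hv, a, Or.inr (Or.inr ⟨by omega, ha⟩), hav⟩
  obtain rfl := hz.puncture_eq
  unfold CylFace.star
  dsimp only
  split_ifs with h1 h2 h3 h4 h5
  · obtain ⟨rfl, rfl⟩ := key _ _ hsle (hz.stopsAt_of_top hl h1)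
    rw [hz.trunc_eq hl h1]
    rfl
  · obtain ⟨rfl, e⟩ := key _ _ hsle (hz.stopsAt_of_below h2.2.choose_spec)
    rw [e]
    rfl
  · have hil : i ≠ puncture z + 1 := by
      rintro rfl
      refine h2 ⟨hidim, u, ?_⟩
      obtain ⟨-, hu, a, ha, hau⟩ := hs
      rcases ha with ⟨-, rfl⟩ | ha | ha
      · exact ⟨hu, _, hz.top, hau⟩
      · omega
      · omega
    obtain ⟨hv, a, ha, hav⟩ := h3.2.choose_spec
    rw [hz.top] at ha
    cases ha
    obtain ⟨rfl, e⟩ := key (puncture z) _ (by omega)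
      ⟨h3.1.1, hv, P.γ t, Or.inr (Or.inl ⟨rfl, rfl⟩), hav⟩
    rw [e]
  · obtain ⟨⟨hj1, hj2, hj3⟩, hj4⟩ := h4.choose_spec
    have hil : i < puncture z := by
      obtain ⟨-, hu, a, ha, hau⟩ := hs
      rcases ha with ⟨rfl, rfl⟩ | ⟨rfl, rfl⟩ | ha
      · exact absurd ⟨hidim, u, hu, _, hz.top, hau⟩ h2
      · exact absurd ⟨⟨hi1, hidim⟩, u, hu, _, hz.top, hau⟩ h3
      · exact ha.1
    have hge := hj4 (i - 1) ⟨by omega, by omega, u,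
      by rw [show i - 1 + 1 = i by omega]; exact hdown hil⟩
    obtain ⟨e1, e2⟩ := key _ _ (by omega) (hup _ _ hj1 hj3.choose_spec)
    rw [e2]
    congr 2
    omega
  all_goals
    exfalso
    have hil : i < puncture z := by
      obtain ⟨-, hu, a, ha, hau⟩ := hs
      rcases ha with ⟨rfl, rfl⟩ | ⟨rfl, rfl⟩ | ha
      · exact absurd ⟨hidim, u, hu, _, hz.top, hau⟩ h2
      · exact absurd ⟨⟨hi1, hidim⟩, u, hu, _, hz.top, hau⟩ h3
      · exact ha.1
    refine h4 ⟨i - 1, ⟨by omega, by omega, u, ?_⟩, ?_⟩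
    · rw [show i - 1 + 1 = i by omega]; exact hdown hil
    · rintro j ⟨hj1, -, v, hv⟩
      by_contra hc
      exact hmax _ _ (by omega) (hup j v hj1 hv)

open Classical in
theorem star_eq_flat (hl : l ≤ P.dim q) (hno : ∀ j v, ¬ StopsAt z l t q j v) :
    CylFace.star q z = if (0 < l ∧ ∃ a, z 0 = some a ∧ P.UpperLE (P.γIter 0 q) a) ∨
      (l = 0 ∧ P.UpperLT (P.γIter 0 q) (P.γ t)) then .minus q else .plus q := by
  obtain rfl := hz.puncture_eq
  unfold CylFace.star
  dsimp only
  rw [if_neg fun h1 => hno _ _ (hz.stopsAt_of_top hl h1),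
    dif_neg fun h2 => hno _ _ (hz.stopsAt_of_below h2.2.choose_spec), dif_neg, dif_neg]
  · congr 1
    refine propext (or_congr Iff.rfl (and_congr_right ?_))
    intro h0
    have ht := hz.top
    rw [h0] at ht
    rw [ht]
    simp
  · rintro ⟨j, ⟨hj1, -, v, hv, a, ha, hav⟩, -⟩
    exact hno (j + 1) v ⟨by omega, hv, a, Or.inr (Or.inr ⟨by omega, ha⟩), hav⟩
  · rintro ⟨⟨h1, -⟩, v, hv, a, ha, hav⟩
    rw [hz.top] at ha
    cases ha
    exact hno _ v ⟨h1, hv, _, Or.inr (Or.inl ⟨rfl, rfl⟩), hav⟩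

include hP in
theorem star_cases (hl : l ≤ P.dim q) :
    (∃ i u, StopsAt z l t q i u ∧ CylFace.star q z = ofSeq q (liftSeq q u (i - 1) z)) ∨
      CylFace.star q z = .minus q ∨ CylFace.star q z = .plus q := by
  classical
  by_cases hex : ∃ i, ∃ u, StopsAt z l t q i u
  · left
    obtain ⟨i, u, hi⟩ := hex
    obtain ⟨v, hv⟩ := Nat.findGreatest_spec (P := fun i => ∃ u, StopsAt z l t q i u) hi.le ⟨u, hi⟩
    refine ⟨_, v, hv, hz.star_eq hP hl hv fun j w hj hw => ?_⟩
    exact Nat.findGreatest_is_greatest hj hw.le ⟨w, hw⟩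
  · right
    push Not at hex
    rw [hz.star_eq_flat hl hex]
    split_ifs
    · exact Or.inl rfl
    · exact Or.inr rfl

end IsLift

end Flags

/-! ### Closed forms of `H` and its compatibility with boundaries. -/

section CylLift

open CylFace

variable {Q : PosHypergraph.{v}} {P : PosHypergraph.{u}}
  {h : Q.Face → P.Face} {ϱ : Q.Face → intervalOpetope.Face}

theorem FaceSeq.trunc_of_le {x : FaceSeq P} {i k : ℕ} (hi : i ≤ k) : x.trunc k i = x i :=
  if_pos hi

theorem FaceSeq.trunc_of_lt {x : FaceSeq P} {i k : ℕ} (hi : k < i) : x.trunc k i = none :=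
  if_neg (by omega)

namespace IsCylPair

variable (H : IsCylPair h ϱ) {x q r s t t' : Q.Face} {i j : ℕ}

/-- The sequence of the p-flag `H(q)`, if `t` is the level of `q`. -/
noncomputable def _root_.levelSeq (h : Q.Face → P.Face) (ϱ : Q.Face → intervalOpetope.Face)
    (q t : Q.Face) : FaceSeq P := liftSeq (h q) (h t) (Q.dim t - 1) (splitSeq h ϱ)

include H

theorem exists_splitSeq (hs : IsSplitting h ϱ s) (hi : i + 1 ≤ Q.dim s) :
    ∃ s', IsSplitting h ϱ s' ∧ Q.dim s' = i + 1 ∧ splitSeq h ϱ i = some (h s') ∧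
      Q.FaceOf s' s := by
  obtain ⟨s', h1, h2, h3⟩ := exists_splitting_face hs (i := i + 1) (by omega) hi
  exact ⟨s', h1, h2, H.splitSeq_eq h1 h2, h3⟩

theorem splitSeq_adj (hs : IsSplitting h ϱ s) (hi : i + 2 ≤ Q.dim s) {a b : P.Face}
    (ha : splitSeq h ϱ i = some a) (hb : splitSeq h ϱ (i + 1) = some b) : a ∈ P.boundary b := by
  obtain ⟨s', h1, h2, h3, -⟩ := H.exists_splitSeq hs (i := i + 1) (by omega)
  obtain ⟨a', h4, h5⟩ := H.splitSeq_boundary h1 h2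
  rw [h4] at ha
  rw [h3] at hb
  cases ha
  cases hb
  exact h5

theorem isFlag_splitting (hs : IsSplitting h ϱ s) :
    IsFlag (h s) ((splitSeq h ϱ).trunc (Q.dim s - 1)) := by
  have hd := hs.dim_map
  refine ⟨?_, fun i hi => FaceSeq.trunc_of_lt (by omega), fun i hi => ?_⟩
  · rw [FaceSeq.trunc_of_le (by omega)]
    exact H.splitSeq_eq hs hd.symm
  · obtain ⟨s₁, -, -, h1, -⟩ := H.exists_splitSeq hs (i := i) (by omega)
    obtain ⟨s₂, -, -, h2, -⟩ := H.exists_splitSeq hs (i := i + 1) (by omega)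
    refine ⟨_, _, ?_, ?_, H.splitSeq_adj hs (by omega) h1 h2⟩
    · rwa [FaceSeq.trunc_of_le (by omega)]
    · rwa [FaceSeq.trunc_of_le (by omega)]

theorem isLift_level (hq : P.dim (h q) = Q.dim q) (ht : IsLevel h ϱ q t) :
    IsLift (h q) (levelSeq h ϱ q t) (Q.dim t - 1) (h t) := by
  have h1 := H.isLevel_dim_pos ht
  have htd := H.threshold_dim ht.thr
  have hX : ∀ i, i < Q.dim t - 1 → levelSeq h ϱ q t i = splitSeq h ϱ i := fun i hi => if_pos hi
  refine ⟨?_, ?_, fun i hi => ?_, fun i a b hi ha hb => ?_, fun i a hi ha => ?_⟩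
  · rw [show Q.dim t - 1 + 1 = Q.dim t by omega]
    exact H.map_mem_domLevel ht.mem htd hq
  · funext i
    rw [levelSeq, liftSeq, liftSeq]
    split_ifs with h2
    · rw [liftSeq, if_pos h2]
    all_goals rfl
  all_goals
    obtain ⟨s, hs, hs'⟩ := ht.thr.exists_mem (by omega)
    have hsd := Q.dim_δ t s hs
    rw [hX _ (by omega)] at *
  · obtain ⟨s', -, -, h2, -⟩ := H.exists_splitSeq hs' (i := i) (by omega)
    exact ⟨_, h2⟩
  · exact H.splitSeq_adj hs' (by omega) ha hb
  · rw [H.splitSeq_eq hs' (by omega)] at ha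
    cases ha
    have hsm := hs'.dim_map
    -- The image of `s` has codimension two in `h t`, since `s` has codimension one in `t` and drops
    -- by one more.
    obtain ⟨y, hy, hb⟩ := (H.map.map_faceOf H.opQ.1 (faceOf_δ hs)).exists_boundary (by omega)
    have := dim_of_mem_boundary hb
    exact ⟨y, hb, hy.mem_boundary (by omega)⟩

theorem isPFlag_level (hq : P.dim (h q) = Q.dim q) (ht : IsLevel h ϱ q t) :
    IsPFlag (h q) (levelSeq h ϱ q t) := (H.isLift_level hq ht).isPFlag H.opP

/-- The map `H`, with values in the type of faces of the cylinder. -/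
noncomputable def _root_.cylMap (h : Q.Face → P.Face) (ϱ : Q.Face → intervalOpetope.Face)
    (q : Q.Face) : CylFace P := cylLift h ϱ q

omit H in
theorem _root_.cylMap_of_neg (hq : ϱ q = IFace.neg) : cylMap h ϱ q = .minus (h q) :=
  (cylLift.eq_1 h ϱ q).trans (if_pos hq)

omit H in
theorem _root_.cylMap_of_pos (hq : ϱ q = IFace.pos) : cylMap h ϱ q = .plus (h q) :=
  (cylLift.eq_1 h ϱ q).trans ((if_neg fun e => IFace.noConfusion (hq.symm.trans e)).trans (if_pos hq))

omit H in
open Classical in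
theorem _root_.cylMap_of_arrow (hq : ϱ q = IFace.arrow) : cylMap h ϱ q =
    if Q.dim q ≤ 1 then
      CylFace.ofSeq (h q) (Function.update (fun _ => none) (P.dim (h q)) (some (h q)))
    else if h₁ : (IsSplitting h ϱ q ∨ q ∉ ker h) ∧ ∃ s ∈ Q.δ q, IsSplitting h ϱ s then
      bracket (h q) (cylMap h ϱ h₁.2.choose)
    else if h₂ : q ∉ ker h ∧ ∃ t ∈ Q.δ q, IsThreshold h ϱ t then
      bracket (h q) (cylMap h ϱ h₂.2.choose)
    else if q ∉ ker h then bracket (h q) (cylMap h ϱ (Q.γ q))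
    else cylMap h ϱ (Q.γ q) :=
  (cylLift.eq_1 h ϱ q).trans ((if_neg fun e => IFace.noConfusion (hq.symm.trans e)).trans
    (if_neg fun e => IFace.noConfusion (hq.symm.trans e)))

theorem cylMap_of_splitting (hs : IsSplitting h ϱ s) :
    cylMap h ϱ s = .flag (h s) _ (H.isFlag_splitting hs) := by
  obtain ⟨n, hn⟩ : ∃ n, Q.dim s = n := ⟨_, rfl⟩
  induction n using Nat.strong_induction_on generalizing s with
  | _ n ih =>
  have hd := hs.dim_map
  rw [cylMap_of_arrow hs.arrow]
  have hX := H.splitSeq_eq hs hd.symm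
  rw [← ofSeq_of_isFlag]
  split_ifs with h1 h2
  · congr 1
    funext i
    rw [show P.dim (h s) = 0 by omega] at hX ⊢
    rcases i with _ | i
    · rw [Function.update_self, FaceSeq.trunc_of_le (by omega), hX]
    · rw [Function.update_of_ne (by omega), FaceSeq.trunc_of_lt (by omega)]
  · have hm := h2.2.choose_spec.1
    have hs' := h2.2.choose_spec.2
    generalize h2.2.choose = s' at hm hs' ⊢
    have hd' := Q.dim_δ s s' hm
    rw [ih _ (by omega) hs' rfl, bracket]
    congr 1
    funext i
    change Function.update ((splitSeq h ϱ).trunc (Q.dim s' - 1)) _ _ i = _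
    rcases lt_trichotomy i (P.dim (h s)) with h3 | rfl | h3
    · rw [Function.update_of_ne (by omega), FaceSeq.trunc_of_le (by omega),
        FaceSeq.trunc_of_le (by omega)]
    · rw [Function.update_self, FaceSeq.trunc_of_le (by omega), hX]
    · rw [Function.update_of_ne (by omega), FaceSeq.trunc_of_lt (by omega),
        FaceSeq.trunc_of_lt (by omega)]
  all_goals exact absurd ⟨Or.inl hs, hs.exists_mem (by omega)⟩ h2

/-- The recursion follows the level: it ends when `q = t`, passes to `τ(q) = t` when the threshold
face is in the domain, and otherwise to `γ q`, which has the same level. -/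
theorem cylMap_of_isLevel (hq : P.dim (h q) = Q.dim q) (ht : IsLevel h ϱ q t) :
    cylMap h ϱ q = .pflag (h q) _ (H.isPFlag_level hq ht) := by
  obtain ⟨n, hn⟩ : ∃ n, Q.dim q = n := ⟨_, rfl⟩
  induction n using Nat.strong_induction_on generalizing q t with
  | _ n ih =>
  have ha := H.cut.map_eq_arrow H.opQ.1 (faceOf_of_mem_domLevel ht.mem)
    (H.active_arrow (Or.inr ht.thr))
  have hns : ¬ IsSplitting h ϱ q := fun hs => by have := hs.dim_map; omega
  have hnk := H.map.not_mem_ker.2 hq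
  have ht1 := H.isLevel_dim_pos ht
  have htq := le_dim_of_mem_domLevel ht.mem
  rw [cylMap_of_arrow ha]
  rw [← ofSeq_of_isPFlag]
  split_ifs with h1 h2 h3
  · obtain rfl : t = q := by
      have := ht.mem
      rwa [show Q.dim t = Q.dim q by omega, mem_domLevel_dim_iff] at this
    congr 1
    funext i
    rw [levelSeq, liftSeq]
    rcases (show i = 0 ∨ i = 1 ∨ 1 < i by omega) with rfl | rfl | h3
    · rw [Function.update_of_ne (by omega), if_neg (by omega), if_pos (by omega)]
    · rw [show P.dim (h t) = 1 by omega, Function.update_self, if_neg (by omega),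
        if_neg (by omega), if_pos (by omega)]
    · rw [Function.update_of_ne (by omega), if_neg (by omega), if_neg (by omega),
        if_neg (by omega), if_neg (by omega)]
  · have hm := h2.2.choose_spec.1
    have hs' := h2.2.choose_spec.2
    generalize h2.2.choose = s' at hm hs' ⊢
    have hd' := Q.dim_δ q s' hm
    have htq : IsThreshold h ϱ q := Or.inr ⟨by omega, hnk, s', hm, hs'⟩
    obtain rfl := H.isLevel_unique ht (isLevel_self htq)
    rw [H.cylMap_of_splitting hs', bracket]
    congr 1
    funext i
    rw [levelSeq, liftSeq]
    change Function.update ((splitSeq h ϱ).trunc (Q.dim s' - 1)) _ _ i = _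
    rcases lt_trichotomy i (P.dim (h t)) with h3 | rfl | h3
    · rw [Function.update_of_ne (by omega)]
      by_cases h4 : i < Q.dim t - 1
      · rw [FaceSeq.trunc_of_le (by omega), if_pos h4]
      · rw [FaceSeq.trunc_of_lt (by omega), if_neg h4, if_pos (by omega)]
    · rw [Function.update_self, if_neg (by omega), if_neg (by omega), if_pos (by omega)]
    · rw [Function.update_of_ne (by omega), FaceSeq.trunc_of_lt (by omega), if_neg (by omega),
        if_neg (by omega), if_neg (by omega), if_neg (by omega)]
  all_goals
    have hnoS : ¬ ∃ s ∈ Q.δ q, IsSplitting h ϱ s := fun hs => h2 ⟨Or.inr hnk, hs⟩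
    have hna : ¬ IsActive h ϱ q := fun hact => hnoS (hact.exists_mem (by omega))
  · have hm := h3.2.choose_spec.1
    have hτ := h3.2.choose_spec.2
    generalize h3.2.choose = τ at hm hτ ⊢
    have hd' := Q.dim_δ q τ hm
    have hτd := H.threshold_dim hτ
    obtain rfl := H.isLevel_unique ht (isLevel_of_threshold_mem hτ hm hna)
    rw [ih _ (by omega) hτd (isLevel_self hτ) rfl, bracket]
    congr 1
    funext i
    change Function.update (liftSeq (h t) (h t) (Q.dim t - 1) (splitSeq h ϱ)) _ _ i =
      liftSeq (h q) (h t) (Q.dim t - 1) (splitSeq h ϱ) i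
    by_cases h4 : i = P.dim (h q)
    · subst h4
      rw [Function.update_self, liftSeq, if_neg (by omega), if_neg (by omega), if_neg (by omega),
        if_pos le_rfl, γIter_of_le le_rfl]
    · rw [Function.update_of_ne h4, liftSeq, liftSeq]
      by_cases h5 : i ≤ Q.dim t
      · split_ifs <;> first | rfl | omega
      · rw [if_neg (by omega), if_neg (by omega), if_neg (by omega), if_neg (by omega),
          if_neg (by omega), if_neg (by omega), if_neg (by omega), if_neg (by omega)]
  · have hd' := Q.dim_γ q (by omega)
    -- By transport, an active codomain would put a splitting or threshold face in `δ q`, and the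
    -- earlier cases have excluded both.
    have hγ : ¬ IsActive h ϱ (Q.γ q) := fun hact => by
      obtain ⟨x, hx, hx'⟩ := H.exists_active hact (by omega)
      rcases hx' with hx' | hx'
      · exact hnoS ⟨x, hx, hx'⟩
      · exact h3 ⟨hnk, x, hx, hx'⟩
    have htγ := H.isLevel_γ hγ hna (by omega) ht
    rw [ih _ (by omega) (H.map.dim_map_γ hq) htγ rfl, bracket]
    have htd := le_dim_of_mem_domLevel htγ.mem
    have hγd := H.map.dim_map_γ hq
    congr 1
    funext i
    change Function.update (liftSeq (h (Q.γ q)) (h t) (Q.dim t - 1) (splitSeq h ϱ)) _ _ i =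
      liftSeq (h q) (h t) (Q.dim t - 1) (splitSeq h ϱ) i
    by_cases h4 : i = P.dim (h q)
    · subst h4
      rw [Function.update_self, liftSeq, if_neg (by omega), if_neg (by omega), if_neg (by omega),
        if_pos le_rfl, γIter_of_le le_rfl]
    · rw [Function.update_of_ne h4, liftSeq, liftSeq]
      by_cases h5 : i ≤ P.dim (h (Q.γ q))
      · rw [if_pos h5, if_pos (show i ≤ P.dim (h q) by omega), H.map.map_γ_of_dim_eq hq,
          γIter_γ (by omega)]
      · rw [if_neg (by omega), if_neg (by omega), if_neg (by omega), if_neg (by omega),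
          if_neg (by omega), if_neg (by omega), if_neg (by omega), if_neg (by omega)]

theorem cylMap_of_collapsed (ha : ϱ q = IFace.arrow) (hq : P.dim (h q) ≠ Q.dim q)
    (hns : ¬ IsSplitting h ϱ q) : 2 ≤ Q.dim q ∧ cylMap h ϱ q = cylMap h ϱ (Q.γ q) := by
  have hnk : q ∈ ker h := H.map.mem_ker.2 hq
  have h1 := H.cut.dim_pos_of_arrow ha
  have h2 := H.map.dim_le q
  have hd : 2 ≤ Q.dim q := by
    by_contra hc
    exact hns (.base q (by omega) (by omega) ha)
  refine ⟨hd, ?_⟩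
  rw [cylMap_of_arrow ha, if_neg (by omega), dif_neg, dif_neg, if_neg]
  · exact fun hc => hc hnk
  · exact fun hc => hc.1 hnk
  · rintro ⟨hc | hc, -⟩
    · exact hns hc
    · exact hc hnk

omit H in
theorem _root_.IFace.cases (i : intervalOpetope.Face) :
    i = IFace.neg ∨ i = IFace.pos ∨ i = IFace.arrow := by
  cases i
  · exact Or.inl rfl
  · exact Or.inr (Or.inl rfl)
  · exact Or.inr (Or.inr rfl)

theorem proj_cylMap (q : Q.Face) :
    (cylMap h ϱ q).proj = h q ∧ (cylMap h ϱ q).projI = ϱ q := by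
  induction hn : Q.dim q using Nat.strong_induction_on generalizing q with
  | _ n ih =>
  rcases IFace.cases (ϱ q) with ha | ha | ha
  · rw [cylMap_of_neg ha, ha]; exact ⟨rfl, rfl⟩
  · rw [cylMap_of_pos ha, ha]; exact ⟨rfl, rfl⟩
  by_cases hs : IsSplitting h ϱ q
  · rw [H.cylMap_of_splitting hs, ha]; exact ⟨rfl, rfl⟩
  by_cases hq : P.dim (h q) = Q.dim q
  · obtain ⟨t, ht⟩ := H.exists_isLevel hq ha
    rw [H.cylMap_of_isLevel hq ht, ha]; exact ⟨rfl, rfl⟩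
  obtain ⟨hd, e⟩ := H.cylMap_of_collapsed ha hq hs
  have := Q.dim_γ q (by omega)
  rw [e, ← H.map.map_γ_of_dim_ne hq, ha, ← H.cut.γ_arrow ha hd]
  exact ih _ (by omega) _ rfl

theorem dim_cylMap_le (q : Q.Face) : (cylMap h ϱ q).dim ≤ Q.dim q := by
  induction hn : Q.dim q using Nat.strong_induction_on generalizing q with
  | _ n ih =>
  have hle := H.map.dim_le q
  rcases IFace.cases (ϱ q) with ha | ha | ha
  · rw [cylMap_of_neg ha]; exact hn ▸ hle
  · rw [cylMap_of_pos ha]; exact hn ▸ hle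
  by_cases hs : IsSplitting h ϱ q
  · rw [H.cylMap_of_splitting hs]; exact (hs.dim_map.trans hn).le
  by_cases hq : P.dim (h q) = Q.dim q
  · obtain ⟨t, ht⟩ := H.exists_isLevel hq ha
    rw [H.cylMap_of_isLevel hq ht]; exact hn ▸ hle
  obtain ⟨hd, e⟩ := H.cylMap_of_collapsed ha hq hs
  have := Q.dim_γ q (by omega)
  rw [e]
  exact (ih _ (by omega) _ rfl).trans (by omega)

/-- Identifies the complement of the kernel of `H`. Any other face on the arrow part has the value
of its codomain, whose dimension is too small. -/
theorem dim_cylMap_eq_iff (q : Q.Face) :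
    (cylMap h ϱ q).dim = Q.dim q ↔ P.dim (h q) = Q.dim q ∨ IsSplitting h ϱ q := by
  have hflat : ϱ q ≠ IFace.arrow → ¬ IsSplitting h ϱ q := fun ha hs => ha hs.arrow
  rcases IFace.cases (ϱ q) with ha | ha | ha
  · rw [cylMap_of_neg ha, or_iff_left (hflat (fun e => IFace.noConfusion (ha.symm.trans e)))]; rfl
  · rw [cylMap_of_pos ha, or_iff_left (hflat (fun e => IFace.noConfusion (ha.symm.trans e)))]; rfl
  by_cases hs : IsSplitting h ϱ q
  · rw [H.cylMap_of_splitting hs]; exact ⟨fun _ => Or.inr hs, fun _ => hs.dim_map⟩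
  by_cases hq : P.dim (h q) = Q.dim q
  · obtain ⟨t, ht⟩ := H.exists_isLevel hq ha
    rw [H.cylMap_of_isLevel hq ht]; exact ⟨fun _ => Or.inl hq, fun _ => hq⟩
  obtain ⟨hd, e⟩ := H.cylMap_of_collapsed ha hq hs
  have := Q.dim_γ q (by omega)
  have := H.dim_cylMap_le (Q.γ q)
  rw [e]
  simp only [hq, hs, or_self, iff_false]
  omega

/-- The faces of the boundary of an uncollapsed face are obtained by the star operation. -/
theorem star_level (hq : P.dim (h q) = Q.dim q) (ht : IsLevel h ϱ q t) (hr : r ∈ Q.boundary q)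
    (hrd : P.dim (h r) = Q.dim r) : CylFace.star (h r) (levelSeq h ϱ q t) = cylMap h ϱ r := by
  have hz := H.isLift_level hq ht
  have hrq := dim_of_mem_boundary hr
  have ht1 := H.isLevel_dim_pos ht
  have htq := le_dim_of_mem_domLevel ht.mem
  have hl : Q.dim t - 1 ≤ P.dim (h r) := by omega
  have hX : ∀ i, i < Q.dim t - 1 → levelSeq h ϱ q t i = splitSeq h ϱ i := fun i hi => if_pos hi
  have hmark : ∀ i a, SeqMarker (levelSeq h ϱ q t) (Q.dim t - 1) (h t) i a →
      IsMarker h ϱ t i a := by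
    rintro i a (⟨h1, h2⟩ | ⟨h1, h2⟩ | ⟨h1, h2⟩)
    · exact Or.inl ⟨by omega, h2⟩
    · exact Or.inr (Or.inl ⟨by omega, h2⟩)
    · rw [hX i h1] at h2
      exact Or.inr (Or.inr ⟨by omega, h2⟩)
  have hno : ∀ i u, ¬ IsActive h ϱ (Q.γIter i r) →
      ¬ StopsAt (levelSeq h ϱ q t) (Q.dim t - 1) (h t) (h r) i u := by
    rintro i u hna ⟨h1, h2, a, h3, h4⟩
    exact H.not_marker_le ht hq hr hrd h1 hna (hmark i a h3) h2 h4
  have hflat : ϱ r ≠ IFace.arrow → ∀ i u,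
      ¬ StopsAt (levelSeq h ϱ q t) (Q.dim t - 1) (h t) (h r) i u := fun ha i u =>
    hno i u fun hact => ha (H.cut.map_eq_arrow H.opQ.1 (faceOf_γIter i r) (H.active_arrow hact))
  have hzero : 0 < Q.dim t - 1 → ∃ s, IsSplitting h ϱ s ∧ Q.dim s = 1 ∧
      levelSeq h ϱ q t 0 = some (h s) := fun h0 => by
    obtain ⟨s, hs, hs'⟩ := ht.thr.exists_mem (by omega)
    have hsd := Q.dim_δ t s hs
    obtain ⟨s', h1, h2, h3, -⟩ := H.exists_splitSeq hs' (i := 0) (by omega)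
    exact ⟨s', h1, h2, by rw [hX 0 h0, h3]⟩
  have hv := dim_γIter_zero r
  rcases IFace.cases (ϱ r) with ha | ha | ha
  · rw [hz.star_eq_flat hl (hflat (fun e => IFace.noConfusion (ha.symm.trans e))), cylMap_of_neg ha, if_pos]
    rcases Nat.eq_zero_or_pos (Q.dim t - 1) with h0 | h0
    · exact Or.inr ⟨h0, H.flat_neg ht hr hrd (by omega) ha⟩
    · obtain ⟨s, hs, hsd, e⟩ := hzero h0
      refine Or.inl ⟨h0, _, e, ?_⟩
      rw [← H.map_γIter_zero hrd]
      exact H.map_le_of_neg hs hsd hv (H.cut.map_eq_neg H.opQ.1 (faceOf_γIter 0 r) ha)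
  · rw [hz.star_eq_flat hl (hflat (fun e => IFace.noConfusion (ha.symm.trans e))), cylMap_of_pos ha, if_neg]
    rintro (⟨h0, a, e', hle⟩ | ⟨h0, hlt⟩)
    · obtain ⟨s, hs, hsd, e⟩ := hzero h0
      rw [e] at e'
      cases e'
      exact H.opP.not_lt_of_le hle (H.map_lt_of_pos hs hsd hrd (by omega) ha)
    · exact H.flat_pos ht hr hrd (by omega) ha hlt
  · obtain ⟨t', ht'⟩ := H.exists_isLevel hrd ha
    have h1 := H.dim_level_le ht hr ht'
    have h2 := H.isLevel_dim_pos ht'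
    have hex : ∃ a, SeqMarker (levelSeq h ϱ q t) (Q.dim t - 1) (h t) (Q.dim t') a := by
      rcases (show Q.dim t' = Q.dim t - 1 + 1 ∨ Q.dim t' = Q.dim t - 1 ∨
        Q.dim t' < Q.dim t - 1 by omega) with h3 | h3 | h3
      · exact ⟨_, Or.inl ⟨h3, rfl⟩⟩
      · exact ⟨_, Or.inr (Or.inl ⟨h3, rfl⟩)⟩
      · obtain ⟨a, ha⟩ := hz.filled _ h3
        exact ⟨a, Or.inr (Or.inr ⟨h3, ha⟩)⟩
    obtain ⟨a, hm⟩ := hex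
    have hst : StopsAt (levelSeq h ϱ q t) (Q.dim t - 1) (h t) (h r) (Q.dim t') (h t') :=
      ⟨h2, H.map_mem_domLevel ht'.mem (H.threshold_dim ht'.thr) hrd, a, hm,
        H.marker_le ht hr ht' (hmark _ _ hm)⟩
    rw [hz.star_eq H.opP hl hst, H.cylMap_of_isLevel hrd ht', ← ofSeq_of_isPFlag]
    · congr 1
      funext i
      change _ = liftSeq (h r) (h t') (Q.dim t' - 1) (splitSeq h ϱ) i
      rw [liftSeq, liftSeq]
      by_cases h3 : i < Q.dim t' - 1
      · rw [if_pos h3, if_pos h3, hX i (by omega)]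
      · rw [if_neg h3, if_neg h3]
    -- No stop above the level of `r`: there its iterated codomains are inactive.
    · intro j u hj hsu
      refine hno j u (ht'.max j hj ?_) hsu
      have := le_dim_of_mem_domLevel hsu.2.1
      omega

/-- The uncollapsed face of the domain of a splitting face is mapped to the low face. -/
theorem low_splitting (hq : IsSplitting h ϱ q) (hd : 2 ≤ Q.dim q) (hr : r ∈ Q.δ q)
    (hrd : P.dim (h r) = Q.dim r) :
    low (h q) ((splitSeq h ϱ).trunc (Q.dim q - 1)) = cylMap h ϱ r := by
  have hf := H.isFlag_splitting hq
  have hqm := hq.dim_map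
  have hrq := Q.dim_δ q r hr
  have he := H.map.map_eq_of_mem_δ hr hrd (by omega)
  have hP := H.opP
  have hX : ∀ i, i ≤ P.dim (h q) → (splitSeq h ϱ).trunc (Q.dim q - 1) i = splitSeq h ϱ i :=
    fun i hi => FaceSeq.trunc_of_le (by omega)
  have hflat : ϱ r ≠ IFace.arrow → ∀ i, 1 ≤ i → i ≤ P.dim (h q) →
      (splitSeq h ϱ).trunc (Q.dim q - 1) i = some (P.γIter i (h q)) := fun ha i hi hi' => by
    rw [hX i hi', ← he]
    exact H.splitSeq_eq_γIter hq hr hrd hi (by omega) fun hact =>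
      ha (H.cut.map_eq_arrow H.opQ.1 (faceOf_γIter i r) (H.active_arrow hact))
  unfold low
  rcases IFace.cases (ϱ r) with ha | ha | ha
  · rw [if_pos, cylMap_of_neg ha, he]
    refine (hP.isFirstFlag_iff hf).2 fun i hi => ?_
    rcases Nat.eq_zero_or_pos i with rfl | hi'
    · rw [hX 0 hi, ← he, H.splitSeq_zero_neg hq hr hrd hd ha]
    · exact hflat (fun e => IFace.noConfusion (ha.symm.trans e)) i hi' hi
  · have h0 : (splitSeq h ϱ).trunc (Q.dim q - 1) 0 ≠ some (P.γIter 0 (h q)) := by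
      rw [hX 0 (Nat.zero_le _), ← he]
      exact H.splitSeq_zero_pos hq hr hrd hd ha
    rw [if_neg fun hc => h0 ((hP.isFirstFlag_iff hf).1 hc 0 (Nat.zero_le _)), if_pos,
      cylMap_of_pos ha, he]
    exact (hP.isLastFlag_iff hf (by omega)).2 ⟨hflat (fun e => IFace.noConfusion (ha.symm.trans e)), h0⟩
  · obtain ⟨t, ht⟩ := H.exists_isLevel hrd ha
    have h1 := H.isLevel_dim_pos ht
    obtain ⟨h2, h3, h4⟩ := H.splitSeq_level hq hr hrd ht
    rw [he] at h4
    have hm := H.map_mem_domLevel ht.mem (H.threshold_dim ht.thr) hrd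
    rw [he] at hm
    have hdom : ∀ j u, j < P.dim (h q) → u ∈ domLevel j (h q) → u ≠ P.γIter j (h q) := by
      rintro j _ hj hu rfl
      rw [mem_domLevel_iff hj, ← γ_γIter hj] at hu
      exact hP.γ_not_mem_δ _ hu
    have hne : (splitSeq h ϱ).trunc (Q.dim q - 1) (Q.dim t) ≠
        some (P.γIter (Q.dim t) (h q)) := by
      rw [hX _ (by omega), h3]
      exact fun e => hdom _ _ (by omega) hm (Option.some.inj e)
    rw [if_neg fun hc => hne ((hP.isFirstFlag_iff hf).1 hc _ (by omega)),
      if_neg fun hc => hne (((hP.isLastFlag_iff hf (by omega)).1 hc).1 _ h1 (by omega))]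
    obtain ⟨g1, ⟨u, gu, gu'⟩, g3⟩ := hf.exists_low ⟨_, h1, by omega, hne⟩
    -- The entry above the low level is the highest one that is not an iterated codomain; by
    -- `splitSeq_level` it sits at level `dim t`.
    have hlow : lowLevel (h q) ((splitSeq h ϱ).trunc (Q.dim q - 1)) = Q.dim t - 1 := by
      generalize lowLevel (h q) ((splitSeq h ϱ).trunc (Q.dim q - 1)) = L at g1 gu gu' g3 ⊢
      have h5 : Q.dim t ≤ L + 1 := by
        by_contra hc
        exact hne (g3 _ (by omega) (by omega))
      have h6 : L + 1 ≤ Q.dim t := by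
        by_contra hc
        rw [hX _ (by omega), h4 _ (by omega) (by omega)] at gu
        exact hdom _ _ (by omega) gu' (Option.some.inj gu).symm
      omega
    rw [hlow, H.cylMap_of_isLevel hrd ht, ← ofSeq_of_isPFlag, he]
    congr 1
    funext i
    rw [levelSeq, liftSeq, FaceSeq.erase, he]
    by_cases h5 : i = Q.dim t - 1
    · subst h5
      rw [Function.update_self, if_neg (by omega), if_pos rfl]
    rw [Function.update_of_ne h5]
    by_cases h6 : i ≤ P.dim (h q)
    · rw [hX i h6]
      split_ifs with h7 h8
      · rfl
      · rw [← h3]; congr 1; omega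
      · exact h4 i (by omega) (by omega)
    · rw [FaceSeq.trunc_of_lt (by omega), if_neg (by omega), if_neg (by omega),
        if_neg (by omega), if_neg (by omega)]

/-! ### The lift is an `ι`-map -/

theorem mem_ker_cylMap (q : Q.Face) :
    q ∉ {x | (cylMap h ϱ x).dim < Q.dim x} ↔ P.dim (h q) = Q.dim q ∨ IsSplitting h ϱ q := by
  rw [← H.dim_cylMap_eq_iff]
  have := H.dim_cylMap_le q
  change ¬ (cylMap h ϱ q).dim < Q.dim q ↔ _
  omega

theorem cylMap_γ_of_dim_lt (hlt : (cylMap h ϱ q).dim < Q.dim q) :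
    cylMap h ϱ (Q.γ q) = cylMap h ϱ q := by
  have hn := (H.dim_cylMap_eq_iff q).not.1 hlt.ne
  rw [not_or] at hn
  have hγ := H.map.map_γ_of_dim_ne hn.1
  rcases IFace.cases (ϱ q) with ha | ha | ha
  · rw [cylMap_of_neg ha, cylMap_of_neg (H.cut.map_eq_neg H.opQ.1 (faceOf_γ q) ha), hγ]
  · rw [cylMap_of_pos ha, cylMap_of_pos (H.cut.map_eq_pos H.opQ.1 (faceOf_γ q) ha), hγ]
  · exact (H.cylMap_of_collapsed ha hn.1 hn.2).2.symm

theorem cylMap_γ_of_dim_eq (h0 : 0 < Q.dim q) (he : (cylMap h ϱ q).dim = Q.dim q) :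
    cylMap h ϱ (Q.γ q) = CylFace.γ (cylMap h ϱ q) := by
  have hdγ := Q.dim_γ q h0
  have hn := (H.dim_cylMap_eq_iff q).1 he
  by_cases hs : IsSplitting h ϱ q
  · have hm := hs.dim_map
    have hγ := H.map.map_γ_of_dim_ne (q := q) (by omega)
    rw [H.cylMap_of_splitting hs]
    simp only [CylFace.γ]
    split_ifs with h1
    · rw [cylMap_of_pos (H.cut.γ_pos hs.arrow (by omega)), hγ]
    · have ht := H.threshold_γ (Or.inl hs) (by omega)
      rw [H.cylMap_of_isLevel (H.threshold_dim ht) (isLevel_self ht), ← ofSeq_of_isPFlag, hγ]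
      congr 1
      funext i
      rw [levelSeq, liftSeq, FaceSeq.erase, hγ]
      rcases (show i < P.dim (h q) - 1 ∨ i = P.dim (h q) - 1 ∨ i = P.dim (h q) ∨
        P.dim (h q) < i by omega) with h2 | h2 | h2 | h2
      · rw [if_pos (by omega), Function.update_of_ne (by omega), FaceSeq.trunc_of_le (by omega)]
      · rw [if_neg (by omega), if_pos (by omega), h2, Function.update_self]
      · rw [if_neg (by omega), if_neg (by omega), if_pos (by omega),
          Function.update_of_ne (by omega), FaceSeq.trunc_of_le (by omega), h2,
          H.splitSeq_eq hs hm.symm]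
      · rw [if_neg (by omega), if_neg (by omega), if_neg (by omega), if_neg (by omega),
          Function.update_of_ne (by omega), FaceSeq.trunc_of_lt (by omega)]
  have hq := hn.resolve_right hs
  have hγ := H.map.map_γ_of_dim_eq hq
  rcases IFace.cases (ϱ q) with ha | ha | ha
  · rw [cylMap_of_neg ha, cylMap_of_neg (H.cut.map_eq_neg H.opQ.1 (faceOf_γ q) ha), hγ]; rfl
  · rw [cylMap_of_pos ha, cylMap_of_pos (H.cut.map_eq_pos H.opQ.1 (faceOf_γ q) ha), hγ]; rfl
  · obtain ⟨t, ht⟩ := H.exists_isLevel hq ha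
    rw [H.cylMap_of_isLevel hq ht]
    simp only [CylFace.γ]
    rw [← hγ, H.star_level hq ht (mem_boundary_γ h0) (H.map.dim_map_γ hq)]

theorem bijOn_flat {e : P.Face → CylFace P} (he : Function.Injective e)
    (hx : ∀ x ∈ Q.δ q, cylMap h ϱ x = e (h x) ∧ ¬ IsSplitting h ϱ x) {B : Set P.Face}
    (hB : Set.BijOn h (Q.δ q \ ker h) B) :
    Set.BijOn (cylMap h ϱ) (Q.δ q \ {x | (cylMap h ϱ x).dim < Q.dim x}) (e '' B) := by
  have hset : Q.δ q \ {x | (cylMap h ϱ x).dim < Q.dim x} = Q.δ q \ ker h := by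
    ext x
    refine and_congr_right fun hm => ?_
    rw [H.mem_ker_cylMap, or_iff_left (hx x hm).2, H.map.not_mem_ker]
  rw [hset]
  exact Set.BijOn.congr ((he.injOn.bijOn_image).comp hB) fun x hm => ((hx x hm.1).1).symm

theorem flat_neg_spec (ha : ϱ q = IFace.neg) : ∀ x ∈ Q.δ q,
    cylMap h ϱ x = .minus (h x) ∧ ¬ IsSplitting h ϱ x := fun x hx => by
  have := H.cut.map_eq_neg H.opQ.1 (faceOf_δ hx) ha
  refine ⟨cylMap_of_neg this, fun hs => ?_⟩
  rw [hs.arrow] at this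
  cases this

theorem flat_pos_spec (ha : ϱ q = IFace.pos) : ∀ x ∈ Q.δ q,
    cylMap h ϱ x = .plus (h x) ∧ ¬ IsSplitting h ϱ x := fun x hx => by
  have := H.cut.map_eq_pos H.opQ.1 (faceOf_δ hx) ha
  refine ⟨cylMap_of_pos this, fun hs => ?_⟩
  rw [hs.arrow] at this
  cases this

omit H in
theorem _root_.CylFace.minus_injective : Function.Injective (CylFace.minus (P := P)) :=
  fun _ _ e => CylFace.minus.inj e

omit H in
theorem _root_.CylFace.plus_injective : Function.Injective (CylFace.plus (P := P)) :=
  fun _ _ e => CylFace.plus.inj e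

/-- The flag of a splitting face is the side face of a sequence that continues it. -/
theorem side_eq (hs : IsSplitting h ϱ s) {z : FaceSeq P}
    (hz : ∀ i, i ≤ P.dim (h s) → z i = splitSeq h ϱ i) :
    side z (P.dim (h s)) = {cylMap h ϱ s} := by
  have hm := hs.dim_map
  have hX := H.splitSeq_eq hs hm.symm
  have htr : z.trunc (P.dim (h s)) = (splitSeq h ϱ).trunc (Q.dim s - 1) := by
    funext i
    by_cases hi : i ≤ P.dim (h s)
    · rw [FaceSeq.trunc_of_le hi, FaceSeq.trunc_of_le (by omega), hz i hi]
    · rw [FaceSeq.trunc_of_lt (by omega), FaceSeq.trunc_of_lt (by omega)]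
  ext φ
  rw [Set.mem_singleton_iff, H.cylMap_of_splitting hs]
  constructor
  · rintro ⟨q', e, hq', rfl⟩
    rw [hz _ le_rfl, hX] at e
    cases e
    congr 1
  · rintro rfl
    refine ⟨h s, by rw [hz _ le_rfl, hX], by rw [htr]; exact H.isFlag_splitting hs, ?_⟩
    congr 1
    exact htr.symm

theorem cylMap_ne (hs : IsSplitting h ϱ s) (hr : P.dim (h r) = Q.dim r)
    (hd : Q.dim s = Q.dim r) : cylMap h ϱ s ≠ cylMap h ϱ r := by
  intro e
  have h1 := (H.proj_cylMap s).1
  rw [e, (H.proj_cylMap r).1] at h1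
  have := hs.dim_map
  rw [← h1] at this
  omega

/-- For `dim q ≥ 2` exactly two faces of the domain survive, the splitting face `s` and the
uncollapsed face `r`. They go to the side face and to the low face of the flag. -/
theorem bijOn_splitting (hs : IsSplitting h ϱ q) :
    Set.BijOn (cylMap h ϱ) (Q.δ q \ {x | (cylMap h ϱ x).dim < Q.dim x})
      (CylFace.δ (cylMap h ϱ q)) := by
  have hm := hs.dim_map
  have h1 := H.splitting_dim_pos hs
  rw [H.cylMap_of_splitting hs]
  simp only [CylFace.δ]
  split_ifs with h0
  · obtain ⟨x, hx⟩ := Q.δ_nonempty q (by omega)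
    have hd := Q.dim_δ q x hx
    have hxd := H.dim_map_zero (x := x) (by omega)
    have hδ : Q.δ q \ {x | (cylMap h ϱ x).dim < Q.dim x} = {x} := by
      ext y
      rw [Set.mem_singleton_iff]
      constructor
      · exact fun hy => Q.δ_one q (by omega) hy.1 hx
      · rintro rfl
        exact ⟨hx, (H.mem_ker_cylMap _).2 (Or.inl hxd)⟩
    rw [hδ, Set.bijOn_singleton, cylMap_of_neg (H.cut.δ_neg hs.arrow (by omega) hx),
      H.map.map_eq_of_mem_δ hx hxd (by omega)]
  · obtain ⟨s, hsm, hs'⟩ := hs.exists_mem (by omega)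
    obtain ⟨r, hrm, hrd, hre⟩ := H.map.exists_mem_δ_of_ker hm
    have hsd := Q.dim_δ q s hsm
    have hrd' := Q.dim_δ q r hrm
    have hsm' := hs'.dim_map
    have hside := H.side_eq hs' (z := (splitSeq h ϱ).trunc (Q.dim q - 1))
      fun i hi => FaceSeq.trunc_of_le (by omega)
    rw [show P.dim (h q) - 1 = P.dim (h s) by omega, hside,
      H.low_splitting hs (by omega) hrm hrd]
    have hδ : Q.δ q \ {x | (cylMap h ϱ x).dim < Q.dim x} = {s} ∪ {r} := by
      ext y
      rw [Set.mem_union, Set.mem_singleton_iff, Set.mem_singleton_iff, Set.mem_sdiff,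
        H.mem_ker_cylMap]
      constructor
      · rintro ⟨hy, hy' | hy'⟩
        · exact Or.inr (H.map.eq_of_map_eq hy hy' hrm hrd
            ((H.map.map_eq_of_mem_δ hy hy' (by omega)).trans hre.symm))
        · exact Or.inl (H.active_unique hy (Or.inl hy') hsm (Or.inl hs'))
      · rintro (rfl | rfl)
        · exact ⟨hsm, Or.inr hs'⟩
        · exact ⟨hrm, Or.inl hrd⟩
    rw [hδ]
    have hne := H.cylMap_ne hs' hrd (by omega)
    refine Set.BijOn.union (Set.bijOn_singleton.2 rfl) (Set.bijOn_singleton.2 rfl) ?_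
    rintro a (rfl | rfl) b (rfl | rfl) e
    · rfl
    · exact absurd e hne
    · exact absurd e.symm hne
    · rfl

/-- Uncollapsed faces of the domain account for the star part. A splitting face is present exactly
when `q` is its own level with `dim q > 1`; the p-flag is then high and the splitting face gives the
extra side face. -/
theorem bijOn_level (hq : P.dim (h q) = Q.dim q) (ht : IsLevel h ϱ q t) :
    Set.BijOn (cylMap h ϱ) (Q.δ q \ {x | (cylMap h ϱ x).dim < Q.dim x})
      (CylFace.δ (cylMap h ϱ q)) := by
  have h1 := le_dim_of_mem_domLevel ht.mem
  have h2 := H.isLevel_dim_pos ht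
  have hz := H.isLift_level hq ht
  rw [H.cylMap_of_isLevel hq ht]
  simp only [CylFace.δ]
  have hstar : ∀ r ∈ Q.δ q, P.dim (h r) = Q.dim r →
      CylFace.star (h r) (levelSeq h ϱ q t) = cylMap h ϱ r := fun r hr hrd =>
    H.star_level hq ht (mem_boundary_δ hr) hrd
  have himg : (fun u => CylFace.star u (levelSeq h ϱ q t)) '' P.δ (h q) =
      cylMap h ϱ '' {r ∈ Q.δ q | P.dim (h r) = Q.dim r} := by
    ext φ
    constructor
    · rintro ⟨u, hu, rfl⟩
      obtain ⟨r, hr, hrd, rfl⟩ := H.map.exists_mem_δ (by omega) hq hu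
      exact ⟨r, ⟨hr, hrd⟩, (hstar r hr hrd).symm⟩
    · rintro ⟨r, ⟨hr, hrd⟩, rfl⟩
      exact ⟨h r, H.map.map_mem_δ hr hrd hq, hstar r hr hrd⟩
  have hside : (if 1 < P.dim (h q) ∧ levelSeq h ϱ q t (P.dim (h q) - 1) = none
      then side (levelSeq h ϱ q t) (P.dim (h q) - 2) else ∅) =
      cylMap h ϱ '' {s ∈ Q.δ q | IsSplitting h ϱ s} := by
    split_ifs with hc
    · have htq : Q.dim t = Q.dim q := by
        by_contra hne
        have : levelSeq h ϱ q t (P.dim (h q) - 1) ≠ none := by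
          rcases (show P.dim (h q) - 1 = Q.dim t - 1 + 1 ∨ Q.dim t - 1 + 1 < P.dim (h q) - 1 by
            omega) with e | e
          · rw [e, hz.top]; exact nofun
          · rw [hz.eq_γIter e (by omega)]; exact nofun
        exact this hc.2
      obtain rfl : t = q := by
        have := ht.mem
        rwa [htq, mem_domLevel_dim_iff] at this
      obtain ⟨s, hs, hs'⟩ := ht.thr.exists_mem (by omega)
      have hsd := Q.dim_δ t s hs
      have hsm := hs'.dim_map
      rw [show P.dim (h t) - 2 = P.dim (h s) by omega, H.side_eq hs' (z := levelSeq h ϱ t t) fun i hi => if_pos (by omega)]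
      have : {s ∈ Q.δ t | IsSplitting h ϱ s} = {s} := by
        ext y
        rw [Set.mem_singleton_iff]
        constructor
        · exact fun hy => H.active_unique hy.1 (Or.inl hy.2) hs (Or.inl hs')
        · rintro rfl; exact ⟨hs, hs'⟩
      rw [this, Set.image_singleton]
    -- A splitting face in `δ q` would make `q` a threshold face, thus its own level, with the
    -- puncture just below the top.
    · symm
      rw [Set.image_eq_empty, Set.eq_empty_iff_forall_notMem]
      rintro s ⟨hs, hs'⟩
      have hsd := Q.dim_δ q s hs
      have := H.splitting_dim_pos hs'
      have hact := H.active_of_mem hs hs' (by omega)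
      obtain rfl := H.isLevel_unique ht (isLevel_self (threshold_of_dim_eq hact hq))
      refine hc ⟨by omega, ?_⟩
      rw [show P.dim (h t) - 1 = Q.dim t - 1 by omega]
      exact hz.hole
  rw [himg, hside, ← Set.image_union]
  have hδ : Q.δ q \ {x | (cylMap h ϱ x).dim < Q.dim x} =
      {r ∈ Q.δ q | P.dim (h r) = Q.dim r} ∪ {s ∈ Q.δ q | IsSplitting h ϱ s} := by
    ext y
    rw [Set.mem_sdiff, H.mem_ker_cylMap, and_or_left]
    rfl
  rw [hδ]
  refine Set.InjOn.bijOn_image ?_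
  have hd : ∀ a ∈ Q.δ q, ∀ b ∈ Q.δ q, Q.dim a = Q.dim b := fun a ha b hb => by
    have := Q.dim_δ q a ha
    have := Q.dim_δ q b hb
    omega
  rintro a (⟨ha, ha'⟩ | ⟨ha, ha'⟩) b (⟨hb, hb'⟩ | ⟨hb, hb'⟩) e
  · refine H.map.eq_of_map_eq ha ha' hb hb' ?_
    rw [← (H.proj_cylMap a).1, ← (H.proj_cylMap b).1, e]
  · exact absurd e.symm (H.cylMap_ne hb' ha' (hd b hb a ha))
  · exact absurd e (H.cylMap_ne ha' hb' (hd a ha b hb))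
  · exact H.active_unique ha (Or.inl ha') hb (Or.inl hb')

/-- Since `H(q) = H(γ q)`, the face `γ q` is uncollapsed or splitting. In the first case the only
survivor in `δ q` is the uncollapsed face, with the same level data; in the second it is the active
face, with the same flag. -/
theorem bijOn_collapsed (ha : ϱ q = IFace.arrow) (hq : P.dim (h q) ≠ Q.dim q)
    (hns : ¬ IsSplitting h ϱ q) (hd : (cylMap h ϱ q).dim + 1 = Q.dim q) :
    Set.BijOn (cylMap h ϱ) (Q.δ q \ {x | (cylMap h ϱ x).dim < Q.dim x}) {cylMap h ϱ q} := by
  obtain ⟨h2, e⟩ := H.cylMap_of_collapsed ha hq hns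
  have hdγ := Q.dim_γ q (by omega)
  have hγ := H.map.map_γ_of_dim_ne hq
  rw [e] at hd ⊢
  have key : ∀ r ∈ Q.δ q, (∀ y ∈ Q.δ q, (P.dim (h y) = Q.dim y ∨ IsSplitting h ϱ y) → y = r) →
      (P.dim (h r) = Q.dim r ∨ IsSplitting h ϱ r) → cylMap h ϱ r = cylMap h ϱ (Q.γ q) →
      Set.BijOn (cylMap h ϱ) (Q.δ q \ {x | (cylMap h ϱ x).dim < Q.dim x})
        {cylMap h ϱ (Q.γ q)} := by
    intro r hr hun hr' er
    have : Q.δ q \ {x | (cylMap h ϱ x).dim < Q.dim x} = {r} := by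
      ext y
      rw [Set.mem_sdiff, H.mem_ker_cylMap, Set.mem_singleton_iff]
      constructor
      · exact fun hy => hun y hy.1 hy.2
      · rintro rfl; exact ⟨hr, hr'⟩
    rw [this, Set.bijOn_singleton, er]
  rcases (H.dim_cylMap_eq_iff (Q.γ q)).1 (by omega) with hγd | hγs
  · rw [hγ] at hγd
    have hno : ∀ y ∈ Q.δ q, ¬ IsSplitting h ϱ y := fun y hy hy' =>
      hns (H.splitting_of_dim_ne (H.active_of_mem hy hy' (by omega)) hq)
    obtain ⟨r, hr, hrd, hre⟩ := H.map.exists_mem_δ_of_ker (α := q) (by omega)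
    refine key r hr (fun y hy hy' => ?_) (Or.inl hrd) ?_
    · have hyd := hy'.resolve_right (hno y hy)
      exact H.map.eq_of_map_eq hy hyd hr hrd
        ((H.map.map_eq_of_mem_δ hy hyd hq).trans hre.symm)
    · have hγd' : P.dim (h (Q.γ q)) = Q.dim (Q.γ q) := by rw [hγ, hγd]
      obtain ⟨t, ht⟩ := H.exists_isLevel hγd' (H.cut.γ_arrow ha h2)
      obtain ⟨t', ht', htd, hte⟩ := H.exists_isLevel_of_collapsed (by omega) hns hr hrd ht
      rw [H.cylMap_of_isLevel hrd ht', H.cylMap_of_isLevel hγd' ht, ← ofSeq_of_isPFlag,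
        ← ofSeq_of_isPFlag, levelSeq, levelSeq, hre, hγ, htd, hte]
  · obtain ⟨s, hs, hs'⟩ := H.exists_active (Or.inl hγs) (by omega)
    replace hs' := H.splitting_of_splitting_γ hγs hs hs'
    have hqd := (H.dim_map_of_splitting_γ hγs (by omega)).1
    refine key s hs (fun y hy hy' => ?_) (Or.inr hs') ?_
    · rcases hy' with hy' | hy'
      · have := H.map.dim_of_mem_δ hy hy'
        omega
      · exact H.active_unique hy (Or.inl hy') hs (Or.inl hs')
    · have hsd := Q.dim_δ q s hs
      rw [H.cylMap_of_splitting hs', H.cylMap_of_splitting hγs, ← ofSeq_of_isFlag,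
        ← ofSeq_of_isFlag, H.map_splitting_eq hs' hγs (by omega),
        show Q.dim s = Q.dim (Q.γ q) by omega]

theorem isIotaMap_cylMap : IsIotaMap Q (cylinder P) (cylMap h ϱ) where
  dim_le := H.dim_cylMap_le
  map_γ k q hk := by
    have hle := H.dim_cylMap_le q
    rw [show k = Q.dim q - 1 by omega, γIter_pred (by omega)]
    by_cases he : (cylMap h ϱ q).dim = Q.dim q
    · have he' : (cylinder P).dim (cylMap h ϱ q) = Q.dim q := he
      rw [H.cylMap_γ_of_dim_eq (by omega) he, ← he']
      exact (γIter_pred (S := cylinder P) (he'.trans_gt (by omega))).symm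
    · rw [H.cylMap_γ_of_dim_lt (by omega)]
      exact (γIter_of_le (S := cylinder P) (show (cylMap h ϱ q).dim ≤ _ by omega)).symm
  bijOn_δ q h0 he := by
    have hn := (H.dim_cylMap_eq_iff q).1 he
    by_cases hs : IsSplitting h ϱ q
    · exact H.bijOn_splitting hs
    have hq := hn.resolve_right hs
    rcases IFace.cases (ϱ q) with ha | ha | ha
    · rw [cylMap_of_neg ha]
      exact H.bijOn_flat minus_injective (H.flat_neg_spec ha) (H.map.bijOn_δ q h0 hq)
    · rw [cylMap_of_pos ha]
      exact H.bijOn_flat plus_injective (H.flat_pos_spec ha) (H.map.bijOn_δ q h0 hq)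
    · obtain ⟨t, ht⟩ := H.exists_isLevel hq ha
      exact H.bijOn_level hq ht
  bijOn_singleton q hd := by
    replace hd : (cylMap h ϱ q).dim + 1 = Q.dim q := hd
    have hn := (H.dim_cylMap_eq_iff q).not.1 (by omega)
    rw [not_or] at hn
    rcases IFace.cases (ϱ q) with ha | ha | ha
    · rw [cylMap_of_neg ha] at hd ⊢
      have := H.bijOn_flat minus_injective (H.flat_neg_spec ha) (H.map.bijOn_singleton q hd)
      rwa [Set.image_singleton] at this
    · rw [cylMap_of_pos ha] at hd ⊢
      have := H.bijOn_flat plus_injective (H.flat_pos_spec ha) (H.map.bijOn_singleton q hd)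
      rwa [Set.image_singleton] at this
    · exact H.bijOn_collapsed ha hn.1 hn.2 hd
  subset_ker q hd x hx := by
    replace hd : (cylMap h ϱ q).dim + 1 < Q.dim q := hd
    have hn := (H.dim_cylMap_eq_iff q).not.1 (by omega)
    rw [not_or] at hn
    by_contra hc
    replace hc := (H.mem_ker_cylMap x).1 hc
    rcases IFace.cases (ϱ q) with ha | ha | ha
    · rw [cylMap_of_neg ha] at hd
      exact H.map.not_mem_ker.2 (hc.resolve_right (H.flat_neg_spec ha x hx).2)
        (H.map.subset_ker q hd hx)
    · rw [cylMap_of_pos ha] at hd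
      exact H.map.not_mem_ker.2 (hc.resolve_right (H.flat_pos_spec ha x hx).2)
        (H.map.subset_ker q hd hx)
    · obtain ⟨h2, e⟩ := H.cylMap_of_collapsed ha hn.1 hn.2
      have hdγ := Q.dim_γ q (by omega)
      rw [e] at hd
      have hnγ := (H.dim_cylMap_eq_iff (Q.γ q)).not.1 (by omega)
      rw [not_or] at hnγ
      rcases hc with hc | hc
      · exact hnγ.1 (H.map.map_step hx hc).2
      · exact hnγ.2 (H.splitting_of_dim_ne (H.active_γ hx (Or.inl hc)) hnγ.1)

end IsCylPair

end CylLift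

/-! ### Faces of the cylinder are determined by their boundaries; uniqueness of the lift. -/

section Uniqueness

open CylFace

variable {P : PosHypergraph.{u}} {p q t t' : P.Face} {x y z z' : FaceSeq P} {i l l' : ℕ}

theorem IsFlag.trunc {a : P.Face} (hx : IsFlag p x) (ha : x i = some a) :
    IsFlag a (x.trunc i) := by
  obtain rfl := flag_level hx ha
  refine ⟨(FaceSeq.trunc_of_le le_rfl).trans ha, fun i hi => FaceSeq.trunc_of_lt hi,
    fun i hi => ?_⟩
  have hp : P.dim a ≤ P.dim p := by
    by_contra hc
    rw [hx.2.1 _ (by omega)] at ha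
    cases ha
  obtain ⟨b, c, hb, hc, hbc⟩ := hx.2.2 i (by omega)
  exact ⟨b, c, by rwa [FaceSeq.trunc_of_le (by omega)],
    by rwa [FaceSeq.trunc_of_le (by omega)], hbc⟩

namespace CylFace

theorem proj_ofSeq (p : P.Face) (x : FaceSeq P) : (ofSeq p x).proj = p := by
  unfold ofSeq
  split_ifs <;> rfl

theorem proj_star (p : P.Face) (z : FaceSeq P) : (star p z).proj = p := by
  unfold star
  dsimp only
  split_ifs <;> first | exact proj_ofSeq _ _ | rfl

theorem proj_low (p : P.Face) (x : FaceSeq P) : (low p x).proj = p := by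
  unfold low
  split_ifs <;> first | exact proj_ofSeq _ _ | rfl

theorem eq_of_ofSeq_eq_pflag {hz : IsPFlag q z} (h : ofSeq p x = .pflag q z hz) : x = z := by
  unfold ofSeq at h
  split_ifs at h
  exact (CylFace.pflag.inj h).2

theorem flag_ne_star {hx : IsFlag p x} (hl : puncture z ≤ P.dim q) (hn : z (puncture z) = none) :
    CylFace.flag p x hx ≠ star q z := by
  intro e
  have h1 := congrArg CylFace.proj e
  have h2 := congrArg CylFace.dim e
  rw [proj_star] at h1
  rw [dim_star hl hn] at h2
  subst h1
  exact Nat.succ_ne_self _ h2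

theorem flag_ne_low {hx : IsFlag p x} (hq : 0 < P.dim q) : CylFace.flag p x hx ≠ low q y := by
  intro e
  have h1 := congrArg CylFace.proj e
  have h2 := congrArg CylFace.dim e
  rw [proj_low] at h1
  rw [dim_low hq] at h2
  subst h1
  exact Nat.succ_ne_self _ h2

theorem exists_side_mem_δ_flag (hx : IsFlag p x) (hp : 0 < P.dim p) :
    ∃ q, ∃ hq : IsFlag q (x.trunc (P.dim p - 1)),
      CylFace.flag q _ hq ∈ CylFace.δ (.flag p x hx) := by
  obtain ⟨q, hq⟩ := hx.exists_eq (i := P.dim p - 1) (by omega)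
  refine ⟨q, hx.trunc hq, ?_⟩
  simp only [CylFace.δ]
  rw [if_neg hp.ne']
  exact Or.inl ⟨q, hq, hx.trunc hq, rfl⟩

theorem trunc_eq_of_mem_side {hx : IsFlag q x} (h : CylFace.flag q x hx ∈ side y i) :
    x = y.trunc i := by
  obtain ⟨a, -, ha, e⟩ := h
  exact (CylFace.flag.inj e).2

/-- The side face records all levels below the top, and it cannot be matched with the low face,
which is no flag for dimension reasons. -/
theorem flag_eq_of_δ_subset {hx : IsFlag p x} {hy : IsFlag p y}
    (h : CylFace.δ (.flag p x hx) ⊆ CylFace.δ (.flag p y hy)) : x = y := by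
  have htop : ∀ i, P.dim p ≤ i → x i = y i := fun i hi => by
    rcases hi.eq_or_lt with rfl | hi
    · rw [hx.1, hy.1]
    · rw [hx.2.1 i hi, hy.2.1 i hi]
  rcases Nat.eq_zero_or_pos (P.dim p) with h0 | h0
  · exact funext fun i => htop i (by omega)
  · obtain ⟨q, hq, hm⟩ := exists_side_mem_δ_flag hx h0
    replace hm := h hm
    simp only [CylFace.δ] at hm
    rw [if_neg h0.ne'] at hm
    have e := trunc_eq_of_mem_side (hm.resolve_right (flag_ne_low h0))
    funext i
    by_cases hi : P.dim p ≤ i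
    · exact htop i hi
    · have := congrFun e i
      rwa [FaceSeq.trunc_of_le (by omega), FaceSeq.trunc_of_le (by omega)] at this

end CylFace

namespace IsLift

theorem exists_eq (hz : IsLift p z l t) (hi : i ≤ P.dim p) (hil : i ≠ l) : ∃ a, z i = some a := by
  rcases (show i < l ∨ i = l + 1 ∨ l + 1 < i by omega) with h | rfl | h
  · exact hz.filled i h
  · exact ⟨t, hz.top⟩
  · exact ⟨_, hz.eq_γIter h hi⟩

theorem eq_of_none (hz : IsLift p z l t) (hi : i ≤ P.dim p) (h : z i = none) : i = l := by
  by_contra hc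
  obtain ⟨a, ha⟩ := hz.exists_eq hi hc
  rw [h] at ha
  cases ha

theorem ext (hz : IsLift p z l t) (hz' : IsLift p z' l t) (h : ∀ i, i < l → z i = z' i) :
    z = z' := by
  rw [hz.eq, hz'.eq]
  funext i
  rw [liftSeq, liftSeq]
  by_cases hi : i < l
  · rw [if_pos hi, if_pos hi, h i hi]
  · rw [if_neg hi, if_neg hi]

theorem lift (hz : IsLift p z l t) (ht : t ∈ domLevel (l + 1) q) :
    IsLift q (liftSeq q t l z) l t := by
  have h : ∀ i, i < l → liftSeq q t l z i = z i := fun i hi => if_pos hi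
  refine ⟨ht, ?_, fun i hi => ?_, fun i a b hi ha hb => ?_, fun i a hi ha => ?_⟩
  · funext i
    by_cases hi : i < l
    · rw [h i hi, liftSeq, if_pos hi, h i hi]
    · rw [liftSeq, liftSeq, if_neg hi, if_neg hi]
  · rw [h i hi]
    exact hz.filled i hi
  · rw [h _ (by omega)] at ha hb
    exact hz.adj i a b hi ha hb
  · rw [h _ (by omega)] at ha
    exact hz.bot i a hi ha

variable (hP : P.IsOpetopicCardinal)
include hP

theorem star_eq_pflag (hz : IsLift p z l t) (ht : t ∈ domLevel (l + 1) q) :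
    CylFace.star q z = .pflag q _ ((hz.lift ht).isPFlag hP) := by
  have hl : l + 1 ≤ P.dim q := le_dim_of_mem_domLevel ht
  rw [hz.star_eq hP (by omega) ⟨by omega, ht, t, Or.inl ⟨rfl, rfl⟩, .refl _⟩
    fun j v hj hs => by have := hs.le; omega, ← ofSeq_of_isPFlag]
  rfl

theorem isFlag_trunc (hz : IsLift p z l t) {a : P.Face} (hi : i < l) (ha : z i = some a) :
    IsFlag a (z.trunc i) := by
  obtain rfl := pflag_level (hz.isPFlag hP) ha
  refine ⟨(FaceSeq.trunc_of_le le_rfl).trans ha, fun i hi => FaceSeq.trunc_of_lt hi,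
    fun j hj => ?_⟩
  obtain ⟨b, hb⟩ := hz.filled j (by omega)
  obtain ⟨c, hc⟩ := hz.filled (j + 1) (by omega)
  exact ⟨b, c, by rwa [FaceSeq.trunc_of_le (by omega)],
    by rwa [FaceSeq.trunc_of_le (by omega)], hz.adj j b c (by omega) hb hc⟩

/-- A high p-flag is determined by its domain. -/
theorem eq_of_δ_subset_of_high (hz : IsLift p z l t) (hz' : IsLift p z' l' t')
    (hl : l + 1 = P.dim p)
    (h : CylFace.δ (.pflag p z (hz.isPFlag hP)) ⊆ CylFace.δ (.pflag p z' (hz'.isPFlag hP))) :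
    z = z' := by
  have hlt' := hz'.lt_dim
  obtain rfl : t = p := by
    have := hz.mem
    rwa [hl, mem_domLevel_dim_iff] at this
  have key : l' = l → (∀ i, i < l → z i = z' i) → z = z' := by
    rintro rfl he
    obtain rfl : t' = t := by
      have := hz'.mem
      rwa [hl, mem_domLevel_dim_iff] at this
    exact hz.ext hz' he
  rcases Nat.eq_zero_or_pos l with h0 | h0
  · exact key (by omega) fun i hi => by omega
  -- The side face carries every entry below the hole. It must be the side face of `z'`, as star
  -- faces are never flags, so `z'` is high too.
  obtain ⟨a, ha⟩ := hz.filled (l - 1) (by omega)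
  have hf := hz.isFlag_trunc hP (by omega) ha
  have hm : CylFace.flag a _ hf ∈ CylFace.δ (.pflag t z (hz.isPFlag hP)) := by
    simp only [CylFace.δ]
    rw [if_pos ⟨by omega, by rw [show P.dim t - 1 = l by omega]; exact hz.hole⟩,
      show P.dim t - 2 = l - 1 by omega]
    exact Or.inr ⟨a, ha, hf, rfl⟩
  replace hm := h hm
  simp only [CylFace.δ] at hm
  rcases hm with ⟨r, hr, e⟩ | hm
  · have hrd := P.dim_δ t r hr
    exact absurd e.symm (flag_ne_star (by rw [hz'.puncture_eq]; omega)
      (by rw [hz'.puncture_eq]; exact hz'.hole))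
  · split_ifs at hm with hc
    · have e := trunc_eq_of_mem_side hm
      refine key ?_ fun i hi => ?_
      · have := hz'.eq_of_none (by omega) hc.2
        omega
      · have := congrFun e i
        rwa [FaceSeq.trunc_of_le (by omega), FaceSeq.trunc_of_le (by omega)] at this
    · exact absurd hm (Set.notMem_empty _)

/-- A low p-flag with the puncture two levels below the top is determined by its domain. -/
theorem eq_of_δ_subset_of_low (hz : IsLift p z l t) (hz' : IsLift p z' l' t')
    (hl : l + 2 = P.dim p) (hl' : l' + 1 < P.dim p)
    (h : CylFace.δ (.pflag p z (hz.isPFlag hP)) ⊆ CylFace.δ (.pflag p z' (hz'.isPFlag hP))) :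
    z = z' := by
  have htm := hz.mem
  have htd := hz.dim_t
  have htp : t ∈ P.δ p := by
    have := (mem_domLevel_iff (by omega)).1 htm
    rwa [γIter_of_le (by omega)] at this
  have hself : t ∈ domLevel (l + 1) t := by
    rw [← htd]
    exact mem_domLevel_self t
  -- Since `t ∈ δ p`, the face `t ⋆ z` retains `t`, the puncture and all lower entries, so it
  -- determines `z`. Projection forces it to be `t ⋆ z'`.
  have hm : CylFace.star t z ∈ CylFace.δ (.pflag p z (hz.isPFlag hP)) := by
    simp only [CylFace.δ]
    exact Or.inl ⟨t, htp, rfl⟩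
  replace hm := h hm
  rw [hz.star_eq_pflag hP hself] at hm
  have hzt := hz.lift hself
  simp only [CylFace.δ] at hm
  rcases hm with ⟨r, hr, e⟩ | hm
  · obtain rfl : r = t := by
      have := congrArg CylFace.proj e
      simp only [proj_star] at this
      exact this
    simp only at e
    rcases hz'.star_cases hP (q := r) (by omega) with ⟨i, u, hs, e'⟩ | e' | e' <;> rw [e'] at e
    · have hsq := eq_of_ofSeq_eq_pflag e
      have hi1 := hs.1
      have hid := le_dim_of_mem_domLevel hs.2.1
      have hil : i - 1 = l := by
        refine hzt.eq_of_none (by omega) ?_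
        rw [← hsq, liftSeq, if_neg (by omega), if_pos rfl]
      have hsl := hs.le
      obtain rfl : l' = l := by omega
      obtain ⟨-, hu, a, ha, hau⟩ := hs
      obtain rfl : i = l' + 1 := by omega
      obtain rfl : u = r := by
        rwa [← htd, mem_domLevel_dim_iff] at hu
      have hat : a = t' := by
        rcases ha with ha | ha | ha
        · exact ha.2
        · omega
        · omega
      subst hat
      obtain rfl : a = u := hP.domLevel_eq_of_common hz'.mem htm (.refl _) hau
      refine hz.ext hz' fun i hi => ?_
      have := congrFun hsq i
      rw [liftSeq, liftSeq, if_pos (by omega), if_pos hi] at this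
      exact this.symm
    · cases e
    · cases e
  · split_ifs at hm
    · obtain ⟨a, -, ha, e⟩ := hm
      cases e
    · exact absurd hm (Set.notMem_empty _)

/-- A low p-flag with a lower puncture is determined by its codomain. -/
theorem eq_of_γ_eq (hz : IsLift p z l t) (hz' : IsLift p z' l' t')
    (hl : l + 2 < P.dim p) (hl' : l' + 2 < P.dim p)
    (h : CylFace.star (P.γ p) z = CylFace.star (P.γ p) z') : z = z' := by
  have hγ := P.dim_γ p (by omega)
  have hm : ∀ {l t}, l + 2 < P.dim p → t ∈ domLevel (l + 1) p → t ∈ domLevel (l + 1) (P.γ p) := by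
    intro l t hl ht
    rw [mem_domLevel_iff (by omega)] at ht ⊢
    rwa [γIter_γ (by omega)]
  have h1 := hz.lift (hm hl hz.mem)
  have h2 := hz'.lift (hm hl' hz'.mem)
  rw [hz.star_eq_pflag hP (hm hl hz.mem), hz'.star_eq_pflag hP (hm hl' hz'.mem)] at h
  have e := (CylFace.pflag.inj h).2
  obtain rfl : l = l' := by
    refine h2.eq_of_none (by omega) ?_
    rw [← e]
    exact h1.hole
  obtain rfl : t = t' := by
    have := h2.top
    rw [← e, h1.top] at this
    exact Option.some.inj this
  refine hz.ext hz' fun i hi => ?_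
  have := congrFun e i
  rwa [liftSeq, liftSeq, if_pos hi, if_pos hi] at this

end IsLift

theorem CylFace.pflag_eq_of_δ_eq (hP : P.IsOpetopicCardinal) {hz : IsPFlag p z}
    {hz' : IsPFlag p z'} (hδ : CylFace.δ (.pflag p z hz) = CylFace.δ (.pflag p z' hz'))
    (hγ : CylFace.γ (.pflag p z hz) = CylFace.γ (.pflag p z' hz')) : z = z' := by
  obtain ⟨l, t, h⟩ := hz.exists_isLift hP
  obtain ⟨l', t', h'⟩ := hz'.exists_isLift hP
  have hl := h.lt_dim
  have hl' := h'.lt_dim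
  by_cases h1 : l + 1 = P.dim p
  · exact h.eq_of_δ_subset_of_high hP h' h1 hδ.le
  by_cases h2 : l' + 1 = P.dim p
  · exact (h'.eq_of_δ_subset_of_high hP h h2 hδ.ge).symm
  by_cases h3 : l + 2 = P.dim p
  · exact h.eq_of_δ_subset_of_low hP h' h3 (by omega) hδ.le
  by_cases h4 : l' + 2 = P.dim p
  · exact (h'.eq_of_δ_subset_of_low hP h h4 (by omega) hδ.ge).symm
  exact h.eq_of_γ_eq hP h' (by omega) (by omega) hγ

variable {Q : PosHypergraph.{v}} {F G : Q.Face → CylFace P} {c : Q.Face}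

namespace PosHypergraph.IsIotaMap

variable (hF : IsIotaMap Q (cylinder P) F) (hG : IsIotaMap Q (cylinder P) G)
include hF

theorem eq_map_γ_of_dim_lt (h : (F c).dim < Q.dim c) : F c = F (Q.γ c) := by
  have h1 := hF.map_γ (Q.dim c - 1) c (by omega)
  rw [γIter_pred (by omega)] at h1
  exact (h1.trans (γIter_of_le (S := cylinder P) (show (F c).dim ≤ _ by omega))).symm

theorem γ_eq_of_dim_eq (h0 : 0 < Q.dim c) (h : (F c).dim = Q.dim c) :
    CylFace.γ (F c) = F (Q.γ c) := by
  have h1 := hF.map_γ (Q.dim c - 1) c (by omega)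
  rw [γIter_pred (by omega), ← h] at h1
  exact (h1.trans (γIter_pred (S := cylinder P) (show 0 < (F c).dim by omega))).symm

theorem δ_eq_image (h0 : 0 < Q.dim c) (h : (F c).dim = Q.dim c) :
    CylFace.δ (F c) = F '' {x ∈ Q.δ c | (F x).dim = Q.dim x} := by
  have h1 : F '' (Q.δ c \ ker (P := cylinder P) F) = CylFace.δ (F c) :=
    (hF.bijOn_δ c h0 h).image_eq
  rw [← h1]
  congr 1
  ext x
  refine and_congr_right fun _ => ?_
  have : (F x).dim ≤ Q.dim x := hF.dim_le x
  change ¬ (F x).dim < Q.dim x ↔ (F x).dim = Q.dim x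
  omega

include hG

/-- If `F c` drops dimension, so does `G c`, and both are values at `γ c`. Otherwise `G` lowers `c`
by one, while the side flag in the domain of `F c` is `F s = G s` for a surviving `s`; then `G s`
must equal the p-flag `G c`. -/
theorem not_flag_pflag (h0 : 0 < Q.dim c) (hδ : ∀ x ∈ Q.δ c, F x = G x)
    (hγ : F (Q.γ c) = G (Q.γ c)) {hx : IsFlag p x} {hz : IsPFlag p z} (h1 : F c = .flag p x hx)
    (h2 : G c = .pflag p z hz) : False := by
  have hp := pflag_dim_pos hz
  have hle : (F c).dim ≤ Q.dim c := hF.dim_le c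
  have hFd : (F c).dim = P.dim p + 1 := by rw [h1]; rfl
  have hGd : (G c).dim = P.dim p := by rw [h2]; rfl
  rcases hle.lt_or_eq with hlt | heq
  · have e := hF.eq_map_γ_of_dim_lt hlt
    rw [hγ, ← hG.eq_map_γ_of_dim_lt (by omega), h1, h2] at e
    cases e
  · obtain ⟨q, hq, hm⟩ := exists_side_mem_δ_flag hx hp
    rw [← h1, hF.δ_eq_image h0 heq] at hm
    obtain ⟨s, ⟨hs, hsd⟩, e⟩ := hm
    have hGs : G s ∈ ({G c} : Set (CylFace P)) :=
      (hG.bijOn_singleton c (show (G c).dim + 1 = _ by omega)).mapsTo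
        ⟨hs, fun hk : (G s).dim < _ => by rw [← hδ s hs] at hk; omega⟩
    rw [Set.mem_singleton_iff, ← hδ s hs, e, h2] at hGs
    cases hGs

theorem eq_of_proj_eq (hP : P.IsOpetopicCardinal) (h1 : ∀ c, (F c).proj = (G c).proj)
    (h2 : ∀ c, (F c).projI = (G c).projI) : F = G := by
  suffices ∀ n c, Q.dim c = n → F c = G c from funext fun c => this _ c rfl
  intro n
  induction n using Nat.strong_induction_on with
  | _ n ih =>
  intro c hc
  have hFle : (F c).dim ≤ Q.dim c := hF.dim_le c
  have hGle : (G c).dim ≤ Q.dim c := hG.dim_le c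
  have e1 := h1 c
  have e2 := h2 c
  have hδ : ∀ x ∈ Q.δ c, F x = G x := fun x hx => by
    have := Q.dim_δ c x hx
    exact ih _ (by omega) x rfl
  have hγ : 0 < Q.dim c → F (Q.γ c) = G (Q.γ c) := fun h0 => by
    have := Q.dim_γ c h0
    exact ih _ (by omega) _ rfl
  have hlow : (F c).dim < Q.dim c → (G c).dim < Q.dim c → F c = G c := fun h3 h4 => by
    rw [hF.eq_map_γ_of_dim_lt h3, hG.eq_map_γ_of_dim_lt h4, hγ (by omega)]
  have hδeq : 0 < Q.dim c → (F c).dim = Q.dim c → (G c).dim = Q.dim c →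
      CylFace.δ (F c) = CylFace.δ (G c) := fun h0 h3 h4 => by
    rw [hF.δ_eq_image h0 h3, hG.δ_eq_image h0 h4]
    have : {x ∈ Q.δ c | (F x).dim = Q.dim x} = {x ∈ Q.δ c | (G x).dim = Q.dim x} := by
      ext x
      refine and_congr_right fun hx => ?_
      rw [hδ x hx]
    rw [← this]
    exact Set.image_congr fun x hx => hδ x hx.1
  have hγeq : 0 < Q.dim c → (F c).dim = Q.dim c → (G c).dim = Q.dim c →
      CylFace.γ (F c) = CylFace.γ (G c) := fun h0 h3 h4 => by
    rw [hF.γ_eq_of_dim_eq h0 h3, hG.γ_eq_of_dim_eq h0 h4, hγ h0]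
  rcases hFc : F c with p | p | ⟨p, x, hx⟩ | ⟨p, z, hz⟩ <;>
    rcases hGc : G c with p' | p' | ⟨p', x', hx'⟩ | ⟨p', z', hz'⟩ <;>
    rw [hFc, hGc] at e1 e2 hlow hδeq hγeq <;> rw [hFc] at hFle <;> rw [hGc] at hGle <;>
    obtain rfl : p = p' := e1
  -- Equal projections settle the flat faces and the mixed signs, leaving the four combinations of
  -- flags and p-flags.
  all_goals first
    | rfl
    | exact IFace.noConfusion e2
    | skip
  · replace hFle : P.dim p + 1 ≤ Q.dim c := hFle
    rcases hFle.lt_or_eq with h3 | h3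
    · exact hlow h3 h3
    · obtain rfl := flag_eq_of_δ_subset (hδeq (by omega) h3 h3).le
      rfl
  · replace hFle : P.dim p + 1 ≤ Q.dim c := hFle
    exact (hF.not_flag_pflag hG (by omega) hδ (hγ (by omega)) hFc hGc).elim
  · replace hGle : P.dim p + 1 ≤ Q.dim c := hGle
    exact (hG.not_flag_pflag hF (by omega) (fun x hx => (hδ x hx).symm) (hγ (by omega)).symm
      hGc hFc).elim
  · have hp := pflag_dim_pos hz
    replace hFle : P.dim p ≤ Q.dim c := hFle
    rcases hFle.lt_or_eq with h3 | h3
    · exact hlow h3 h3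
    · obtain rfl := pflag_eq_of_δ_eq hP (hδeq (by omega) h3 h3) (hγeq (by omega) h3 h3)
      rfl

end PosHypergraph.IsIotaMap

end Uniqueness

theorem mainTheorem4 (P : PosHypergraph.{u}) (Q : PosHypergraph.{v})
    (hP : P.IsOpetope) (hQ : Q.IsOpetope)
    (h : Q.Face → P.Face) (ϱ : Q.Face → intervalOpetope.Face)
    (hh : PosHypergraph.IsIotaMap Q P h) (hϱ : PosHypergraph.IsIotaMap Q intervalOpetope ϱ) :
    (PosHypergraph.IsIotaMap Q (cylinder P) (cylLift h ϱ) ∧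
      CylFace.proj ∘ cylLift h ϱ = h ∧ CylFace.projI ∘ cylLift h ϱ = ϱ) ∧
    ∀ H' : Q.Face → (cylinder P).Face,
      PosHypergraph.IsIotaMap Q (cylinder P) H' →
      CylFace.proj ∘ H' = h → CylFace.projI ∘ H' = ϱ → H' = cylLift h ϱ := by
  have H : IsCylPair h ϱ := ⟨hQ, hP.1, hh, hϱ⟩
  have h1 : IsIotaMap Q (cylinder P) (cylLift h ϱ) := H.isIotaMap_cylMap
  refine ⟨⟨h1, funext fun q => (H.proj_cylMap q).1, funext fun q => (H.proj_cylMap q).2⟩,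
    fun H' hH' e1 e2 => ?_⟩
  exact hH'.eq_of_proj_eq h1 hP.1
    (fun q => (congrFun e1 q).trans (H.proj_cylMap q).1.symm)
    (fun q => (congrFun e2 q).trans (H.proj_cylMap q).2.symm)
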